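/- Let $\Bbbk$ be a field (of any characteristic) and let $A,B,C$ be small dg categories over $\Bbbk$ (differentials of degree $+1$, $d(gf)=(dg)f+(-1)^{|g|}g\,(df)$). **The dg category $\mathrm{Coh}(C,D)$.** Its objects are the dg functors $C\to D$. A morphism $\Psi:F\Rightarrow G$ of degree $|\Psi|$ is a family, over all $n\ge 0$ and all chains $X_0\xrightarrow{f_1}X_1\to\cdots\xrightarrow{f_n}X_n$ of homogeneous morphisms of $C$, of elements $\Psi(f_n,\dots,f_1)\in D(F X_0,G X_n)$ of degree $|\Psi|+\sum_i(|f_i|-1)$, linear in every $f_i$ and vanishing as soon as some $f_i$ is an identity morphism (for $n=0$: an element of $D(FX_0,GX_0)$ for every object $X_0$). Its differential is $$\begin{aligned} (d\Psi)(f_n,\dots,f_1)={}&d\big(\Psi(f_n,\dots,f_1)\big)+(-1)^{|\Psi|}\sum_{i=1}^n(-1)^{\sum_{j>i}(|f_j|+1)}\Psi(f_n,\dots,df_i,\dots,f_1)\\ &+(-1)^{|\Psi|(|f_n|+1)}G(f_n)\,\Psi(f_{n-1},\dots,f_1)+(-1)^{|\Psi|}\sum_{i=1}^{n-1}(-1)^{\sum_{j>i}(|f_j|+1)}\Psi(f_n,\dots,f_{i+1}f_i,\dots,f_1)\\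 &-(-1)^{|\Psi|+\sum_{j\ge2}(|f_j|+1)}\Psi(f_n,\dots,f_2)\,F(f_1), \end{aligned}$$ (for $n=0$ only the first term occurs). The composition is the cup product $$(\Psi_2\cup\Psi_1)(f_n,\dots,f_1)=\sum_{m=0}^n(-1)^{|\Psi_1|\sum_{i>m}(|f_i|+1)}\,\Psi_2(f_n,\dots,f_{m+1})\,\Psi_1(f_m,\dots,f_1),$$ and the identity of $F$ is $\mathrm{id}_{F X_0}$ for $n=0$ and $0$ for $n\ge1$. This is a dg category. **The twisted tensor product $C\widetilde\otimes D$.** It is the dg category with objects $\mathrm{Ob}\,C\times\mathrm{Ob}\,D$ generated by morphisms $\mathrm{id}_x\otimes g:(x,y)\to(x,y')$ for $g\in D(y,y')$ and $\varepsilon(f;g_1,\dots,g_n):(x,y_0)\to(x',y_n)$ for $f\in C(x,x')$ and chains $y_0\xrightarrow{g_1}\cdots\xrightarrow{g_n}y_n$ in $D$, $n\ge 0$, of degree $|f|+\sum_i(|g_i|-1)$, where $\varepsilon(f;\,)=f\otimes\mathrm{id}_{y_0}$ for $n=0$, subject to the following relations: $g\mapsto\mathrm{id}_x\otimes g$ is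 a dg functor $D\to C\widetilde\otimes D$ for every $x$; $\mathrm{id}_x\otimes\mathrm{id}_y=\mathrm{id}_{(x,y)}$ (also when the left-hand side is read as $\varepsilon(\mathrm{id}_x;\,)$ at $y$); $\varepsilon$ is linear in each argument; $\varepsilon(f;g_1,\dots,g_n)=0$ if some $g_i$ is an identity morphism, and $\varepsilon(\mathrm{id}_x;g_1,\dots,g_n)=0$ for $n\ge1$; $$\varepsilon(f_2f_1;g_1,\dots,g_n)=\sum_{m=0}^n(-1)^{|f_1|\sum_{j>m}(|g_j|+1)}\varepsilon(f_2;g_{m+1},\dots,g_n)\,\varepsilon(f_1;g_1,\dots,g_m);$$ $$\begin{aligned} d\,\varepsilon(f;g_1,\dots,g_n)={}&\varepsilon(df;g_1,\dots,g_n)-(-1)^{|f|}\sum_{i=1}^n(-1)^{\sum_{j>i}(|g_j|+1)}\varepsilon(f;g_1,\dots,dg_i,\dots,g_n)\\ &-(-1)^{|f|}\sum_{i=1}^{n-1}(-1)^{\sum_{j>i}(|g_j|+1)}\varepsilon(f;g_1,\dots,g_{i+1}g_i,\dots,g_n)\\ &+(-1)^{|f|+\sum_{j\ge2}(|g_j|+1)}\varepsilon(f;g_2,\dots,g_n)\,(\mathrm{id}_x\otimes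 g_1)-(-1)^{|f|(|g_n|+1)}(\mathrm{id}_{x'}\otimes g_n)\,\varepsilon(f;g_1,\dots,g_{n-1}) \end{aligned}$$ (for $n=0$ only the first term occurs). **Braces.** For $\Theta:G\Rightarrow G'$ in $\mathrm{Coh}(B,C)$, a chain $F_0\overset{\Psi_1}{\Longrightarrow}F_1\Rightarrow\cdots\overset{\Psi_k}{\Longrightarrow}F_k$ in $\mathrm{Coh}(A,B)$, $k\ge0$, and a chain $f_1,\dots,f_N$ in $A$, put $$\Theta\{\Psi_k,\dots,\Psi_1\}_{[-1]}(f_N,\dots,f_1)=\sum(-1)^{\sum_{s}(|\Psi_s|-1)\sum_{j}(|f_j|+1)}\;\Theta\big(F_k(f_N),\dots,\Psi_k(\cdots),\dots,F_{1}(\cdot),\dots,\Psi_1(\cdots),F_0(\cdot),\dots,F_0(f_1)\big).$$ The sum is over all choices of pairwise disjoint, possibly empty blocks of consecutive arguments, placed in the order of the $\Psi_s$; $\Psi_s$ is applied to the $s$-th block; $F_s$ is applied to each single argument lying between the blocks of $\Psi_s$ and $\Psi_{s+1}$ (to the right of the block of $\Psi_1$ for $s=0$, to the left of the block of $\Psi_k$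 for $s=k$); and in the exponent, for each $s$, $j$ runs over the arguments to the left of the $s$-th block. **Proposition.** There is a unique dg functor $$\widetilde m:\ \mathrm{Coh}(B,C)\,\widetilde\otimes\,\mathrm{Coh}(A,B)\longrightarrow\mathrm{Coh}(A,C)$$ given by $(G,F)\mapsto G\circ F$ on objects, such that $$\widetilde m(\Theta\otimes\mathrm{id}_F)(f_N,\dots,f_1)=\Theta(F(f_N),\dots,F(f_1)),\qquad \widetilde m(\mathrm{id}_G\otimes\Psi)(f_N,\dots,f_1)=G(\Psi(f_N,\dots,f_1)),$$ $$\widetilde m(\varepsilon(\Theta;\Psi_1,\dots,\Psi_k))=\Theta\{\Psi_k,\dots,\Psi_1\}_{[-1]}\qquad(k\ge 0).$$ In particular, for all $k\ge0$, all chains $\Psi_1,\dots,\Psi_k$ as above, all $\Theta:G\Rightarrow G'$ and all composable $\Theta_1,\Theta_2$, $$d\,\widetilde m(\varepsilon(\Theta;\Psi_1,\dots,\Psi_k))=\widetilde m(d\,\varepsilon(\Theta;\Psi_1,\dots,\Psi_k)),$$ that is, explicitly, $$\begin{aligned} d\,\widetilde m(\varepsilon(\Theta;\Psi_1,\dots,\Psi_k))={}&\widetilde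 m(\varepsilon(d\Theta;\Psi_1,\dots,\Psi_k))-(-1)^{|\Theta|}\sum_{i}(-1)^{\sum_{j>i}(|\Psi_j|+1)}\widetilde m(\varepsilon(\Theta;\Psi_1,\dots,d\Psi_i,\dots,\Psi_k))\\ &-(-1)^{|\Theta|}\sum_{i=1}^{k-1}(-1)^{\sum_{j>i}(|\Psi_j|+1)}\widetilde m(\varepsilon(\Theta;\Psi_1,\dots,\Psi_{i+1}\cup\Psi_i,\dots,\Psi_k))\\ &+(-1)^{|\Theta|+\sum_{j\ge2}(|\Psi_j|+1)}\widetilde m(\varepsilon(\Theta;\Psi_2,\dots,\Psi_k))\cup\widetilde m(\mathrm{id}_{G}\otimes\Psi_1)\\ &-(-1)^{|\Theta|(|\Psi_k|+1)}\widetilde m(\mathrm{id}_{G'}\otimes\Psi_k)\cup\widetilde m(\varepsilon(\Theta;\Psi_1,\dots,\Psi_{k-1})) \end{aligned}$$ (only the first term for $k=0$), and $$\sum_{\ell=0}^k(-1)^{|\Theta_1|\sum_{s>\ell}(|\Psi_s|+1)}\,\widetilde m(\varepsilon(\Theta_2;\Psi_{\ell+1},\dots,\Psi_k))\cup\widetilde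 m(\varepsilon(\Theta_1;\Psi_1,\dots,\Psi_\ell))=\widetilde m(\varepsilon(\Theta_2\cup\Theta_1;\Psi_1,\dots,\Psi_k)).$$ Moreover there is a dg functor (the categorified Tsygan map) $$\widetilde m_1:\ \mathrm{Coh}(B,C)\longrightarrow\mathrm{Coh}\big(\mathrm{Coh}(A,B),\mathrm{Coh}(A,C)\big)$$ which sends an object $G$ to the dg functor $F\mapsto G\circ F$, $\Psi\mapsto\big((f_N,\dots,f_1)\mapsto G(\Psi(f_N,\dots,f_1))\big)$, and a morphism $\Theta$ to the cochain $(\Psi_k,\dots,\Psi_1)\mapsto\widetilde m(\varepsilon(\Theta;\Psi_1,\dots,\Psi_k))$. -/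

import Mathlib

universe u

namespace DG

/-- The sign `(-1)^n`, as a scalar of `k`. -/
def sgn (k : Type u) [Field k] (n : ℤ) : k := ((n.negOnePow : ℤˣ) : ℤ)

section sign
variable (k : Type u) [Field k]

theorem sgn_add (m n : ℤ) : sgn k (m + n) = sgn k m * sgn k n := by
  simp [sgn, Int.negOnePow_add]

theorem sgn_zero : sgn k 0 = 1 := by simp [sgn]

theorem sgn_one : sgn k 1 = -1 := by simp [sgn]

theorem sgn_neg (n : ℤ) : sgn k (-n) = sgn k n := by simp [sgn, Int.negOnePow_neg]

theorem sgn_sub (m n : ℤ) : sgn k (m - n) = sgn k m * sgn k n := by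
  rw [sub_eq_add_neg, sgn_add, sgn_neg]

theorem sgn_cases (n : ℤ) : sgn k n = 1 ∨ sgn k n = -1 := by
  rcases Int.even_or_odd n with h | h
  · left; simp [sgn, Int.negOnePow_even n h]
  · right; simp [sgn, Int.negOnePow_odd n h]

end sign

/-- A small dg category over the field `k`: `Hom x y n` is the degree `n` part of the complex of
morphisms `x ⟶ y`, the differential has degree `+1`, and `comp h g f` is the composite `g ∘ f`
(first `f`, then `g`).  Degrees are carried by equations such as `h : p + q = r`. -/
structure DGCat (k : Type u) [Field k] where
  Obj : Type u
  Hom : Obj → Obj → ℤ → Type u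
  [addCommGroup : ∀ x y n, AddCommGroup (Hom x y n)]
  [module : ∀ x y n, Module k (Hom x y n)]
  id : ∀ x, Hom x x 0
  comp : ∀ {x y z : Obj} {p q r : ℤ}, p + q = r →
    (Hom y z p →ₗ[k] Hom x y q →ₗ[k] Hom x z r)
  d : ∀ {x y : Obj} {p q : ℤ}, p + 1 = q → (Hom x y p →ₗ[k] Hom x y q)
  id_comp : ∀ {x y : Obj} {p : ℤ} (f : Hom x y p), comp (zero_add p) (id y) f = f
  comp_id : ∀ {x y : Obj} {p : ℤ} (f : Hom x y p), comp (add_zero p) f (id x) = f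
  assoc : ∀ {w x y z : Obj} {p q r pq qr s : ℤ} (hpq : p + q = pq) (hqr : q + r = qr)
    (h : pq + r = s) (h' : p + qr = s) (f₃ : Hom y z p) (f₂ : Hom x y q) (f₁ : Hom w x r),
    comp h (comp hpq f₃ f₂) f₁ = comp h' f₃ (comp hqr f₂ f₁)
  d_d : ∀ {x y : Obj} {p q r : ℤ} (h : p + 1 = q) (h' : q + 1 = r) (f : Hom x y p),
    d h' (d h f) = 0
  leibniz : ∀ {x y z : Obj} {p q r p' q' r' : ℤ} (h : p + q = r) (hp : p + 1 = p')
    (hq : q + 1 = q') (hr : r + 1 = r') (h₁ : p' + q = r') (h₂ : p + q' = r')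
    (g : Hom y z p) (f : Hom x y q),
    d hr (comp h g f) = comp h₁ (d hp g) f + sgn k p • comp h₂ g (d hq f)

attribute [instance] DGCat.addCommGroup DGCat.module

variable {k : Type u} [Field k]

theorem DGCat.d_id (C : DGCat k) (x : C.Obj) {q : ℤ} (h : 0 + 1 = q) : C.d h (C.id x) = 0 := by
  subst h
  have := C.leibniz (add_zero 0) (zero_add 1) (zero_add 1) (zero_add 1) (add_zero 1) (zero_add 1)
    (C.id x) (C.id x)
  rw [C.id_comp, C.id_comp, sgn_zero, one_smul] at this
  have h2 := C.comp_id (C.d (zero_add 1) (C.id x))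
  rw [h2] at this
  simpa using this

/-- The structure of a dg functor on a given map of objects. -/
structure DGMaps (C D : DGCat k) (obj : C.Obj → D.Obj) where
  map : ∀ {x y : C.Obj} {n : ℤ}, C.Hom x y n →ₗ[k] D.Hom (obj x) (obj y) n
  map_id : ∀ x, map (C.id x) = D.id (obj x)
  map_comp : ∀ {x y z : C.Obj} {p q r : ℤ} (h : p + q = r) (g : C.Hom y z p) (f : C.Hom x y q),
    map (C.comp h g f) = D.comp h (map g) (map f)
  map_d : ∀ {x y : C.Obj} {p q : ℤ} (h : p + 1 = q) (f : C.Hom x y p),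
    map (C.d h f) = D.d h (map f)

/-- A dg functor `C ⟶ D`. -/
structure DGFunctor (C D : DGCat k) where
  obj : C.Obj → D.Obj
  toMaps : DGMaps C D obj

/-- The action of a dg functor on morphisms. -/
def DGFunctor.map {C D : DGCat k} (F : DGFunctor C D) {x y : C.Obj} {n : ℤ} :
    C.Hom x y n →ₗ[k] D.Hom (F.obj x) (F.obj y) n := F.toMaps.map

/-- The composite `G ∘ F` of dg functors. -/
abbrev DGFunctor.comp {C D E : DGCat k} (G : DGFunctor D E) (F : DGFunctor C D) : DGFunctor C E where
  obj x := G.obj (F.obj x)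
  toMaps :=
    { map := G.toMaps.map ∘ₗ F.toMaps.map
      map_id := fun x => by simp [F.toMaps.map_id, G.toMaps.map_id]
      map_comp := fun h g f => by simp [F.toMaps.map_comp, G.toMaps.map_comp]
      map_d := fun h f => by simp [F.toMaps.map_d, G.toMaps.map_d] }

/-- `Chain C x y e` is the type of chains of composable homogeneous morphisms
`x = X₀ ⟶ X₁ ⟶ ⋯ ⟶ Xₙ = y` (`n ≥ 0`), written `(fₙ, …, f₁)`, with
`e = ∑ᵢ (|fᵢ| - 1)`; `cons fₙ (fₙ₋₁, …, f₁) = (fₙ, …, f₁)`. -/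
inductive Chain (C : DGCat k) : C.Obj → C.Obj → ℤ → Type u
  | nil (x : C.Obj) : Chain C x x 0
  | cons {x y z : C.Obj} {a e e' : ℤ} (f : C.Hom y z a) (c : Chain C x y e)
      (h : a - 1 + e = e') : Chain C x z e'

namespace Chain
variable {C D : DGCat k}

/-- The transport of a chain along an equality of degrees. -/
def cast {x y : C.Obj} {e e' : ℤ} (h : e = e') (c : Chain C x y e) : Chain C x y e' := h ▸ c

/-- Concatenation `(fₙ, …, fₘ₊₁), (fₘ, …, f₁) ↦ (fₙ, …, f₁)`. -/
def append {x y : C.Obj} {e₁ : ℤ} (r : Chain C x y e₁) :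
    ∀ {z : C.Obj} {e₂ e : ℤ}, Chain C y z e₂ → e₂ + e₁ = e → Chain C x z e
  | _, _, _, nil _, h => r.cast (by omega)
  | _, _, e, cons (a := a) f c _, h => cons f (append r c rfl) (e' := e) (by omega)

/-- The chain `(F(fₙ), …, F(f₁))`. -/
def map (F : DGFunctor C D) : ∀ {x y : C.Obj} {e : ℤ}, Chain C x y e →
    Chain D (F.obj x) (F.obj y) e
  | x, _, _, nil _ => nil (F.obj x)
  | _, _, _, cons f c h => cons (F.map f) (map F c) h

/-- `SlotLin t c₁ c₂ c₃`: the three chains differ in one slot only, where they have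
`f`, `g` and `t • f + g`, respectively. -/
inductive SlotLin (t : k) : ∀ {x y : C.Obj} {e : ℤ},
    Chain C x y e → Chain C x y e → Chain C x y e → Prop
  | head {x y z : C.Obj} {a e e' : ℤ} (f g : C.Hom y z a) (c : Chain C x y e)
      (h : a - 1 + e = e') : SlotLin t (cons f c h) (cons g c h) (cons (t • f + g) c h)
  | tail {x y z : C.Obj} {a e e' : ℤ} (f : C.Hom y z a) {c₁ c₂ c₃ : Chain C x y e}
      (h : a - 1 + e = e') (H : SlotLin t c₁ c₂ c₃) :
      SlotLin t (cons f c₁ h) (cons f c₂ h) (cons f c₃ h)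

/-- One of the morphisms of the chain is an identity morphism. -/
inductive HasId : ∀ {x y : C.Obj} {e : ℤ}, Chain C x y e → Prop
  | head {x y : C.Obj} {e e' : ℤ} (c : Chain C x y e) (h : 0 - 1 + e = e') :
      HasId (cons (C.id y) c h)
  | tail {x y z : C.Obj} {a e e' : ℤ} (f : C.Hom y z a) {c : Chain C x y e}
      (h : a - 1 + e = e') (H : HasId c) : HasId (cons f c h)

/-- A decomposition of a chain of degree `e` as a concatenation `left, right`. -/
structure Split (C : DGCat k) (x z : C.Obj) (e : ℤ) where
  {y : C.Obj}
  {e₁ e₂ : ℤ}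
  left : Chain C y z e₁
  right : Chain C x y e₂
  h : e₁ + e₂ = e

/-- All decompositions `(fₙ, …, fₘ₊₁), (fₘ, …, f₁)`, `0 ≤ m ≤ n`, of a chain. -/
def splits : ∀ {x z : C.Obj} {e : ℤ}, Chain C x z e → List (Split C x z e)
  | x, _, _, nil _ => [⟨nil x, nil x, add_zero 0⟩]
  | _, z, e', cons f c h => ⟨nil z, cons f c h, zero_add e'⟩ ::
      (splits c).map fun s => ⟨cons f s.left rfl, s.right, by have := s.h; omega⟩

/-- A decomposition `fₙ, (fₙ₋₁, …, f₁)` of a chain of degree `e`. -/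
structure Head (C : DGCat k) (x z : C.Obj) (e : ℤ) where
  {y : C.Obj}
  {a e₁ : ℤ}
  f : C.Hom y z a
  tail : Chain C x y e₁
  h : a - 1 + e₁ = e

/-- The list whose only entry is the decomposition `fₙ, (fₙ₋₁, …, f₁)`; empty for `n = 0`. -/
def heads : ∀ {x z : C.Obj} {e : ℤ}, Chain C x z e → List (Head C x z e)
  | _, _, _, nil _ => []
  | _, _, _, cons f c h => [⟨f, c, h⟩]

/-- A decomposition `(fₙ, …, f₂), f₁` of a chain of degree `e`. -/
structure Last (C : DGCat k) (x z : C.Obj) (e : ℤ) where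
  {y : C.Obj}
  {a e₁ : ℤ}
  init : Chain C y z e₁
  f : C.Hom x y a
  h : e₁ + (a - 1) = e

/-- The list whose only entry is the decomposition `(fₙ, …, f₂), f₁`; empty for `n = 0`. -/
def lasts : ∀ {x z : C.Obj} {e : ℤ}, Chain C x z e → List (Last C x z e)
  | _, _, _, nil _ => []
  | _, z, _, cons f (nil _) h => [⟨nil z, f, by omega⟩]
  | _, _, _, cons f (cons g c h') h => (lasts (cons g c h')).map fun s =>
      ⟨cons f s.init rfl, s.f, by have := s.h; omega⟩

/-- The signed chains `(-1)^(∑_{j>i} (|fⱼ|+1)) (fₙ, …, dfᵢ, …, f₁)`. -/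
def dTerms : ∀ {x z : C.Obj} {e : ℤ}, Chain C x z e → List (k × Chain C x z (e + 1))
  | _, _, _, nil _ => []
  | _, _, _, cons (a := a) f c h => (1, cons (C.d rfl f) c (by omega)) ::
      (dTerms c).map fun t => (sgn k (a - 1) * t.1, cons f t.2 (by omega))

/-- The signed chains `(-1)^(∑_{j>i} (|fⱼ|+1)) (fₙ, …, fᵢ₊₁ ∘ fᵢ, …, f₁)`. -/
def mTerms : ∀ {x z : C.Obj} {e : ℤ}, Chain C x z e → List (k × Chain C x z (e + 1))
  | _, _, _, nil _ => []
  | _, _, _, cons _ (nil _) _ => []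
  | _, _, _, cons (a := a) f (cons (a := b) g c h') h =>
      (sgn k (a - 1), cons (C.comp (rfl : a + b = a + b) f g) c (by omega)) ::
      (mTerms (cons g c h')).map fun t => (sgn k (a - 1) * t.1, cons f t.2 (by omega))

end Chain
end DG

namespace DG
variable {k : Type u} [Field k] {C D E : DGCat k}

/-- Families of maps `Ψ : (fₙ, …, f₁) ↦ Ψ(fₙ, …, f₁)` of degree `d`, defined on all chains
`X₀ ⟶ ⋯ ⟶ Xₙ = y` (`n ≥ 0`, with `y` fixed), with values in `D(F X₀, W)`. As the degree of
`(fₙ, …, f₁)` is `∑ᵢ |fᵢ| - n`, the `n`-th component of `Ψ` has degree `d - n` as a map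
of graded spaces. -/
abbrev Raw (F : DGFunctor C D) (W : D.Obj) (y : C.Obj) (d : ℤ) : Type u :=
  ∀ (x : C.Obj) (e : ℤ), Chain C x y e → D.Hom (F.obj x) W (e + d)

namespace Raw
variable {F G H : DGFunctor C D} {W : D.Obj} {y z : C.Obj} {d : ℤ}

/-- The value `Ψ(fₙ, …, f₁)`, with its degree written as `r`. -/
def ev (ψ : Raw F W y d) {x : C.Obj} {e r : ℤ} (h : e + d = r) (c : Chain C x y e) :
    D.Hom (F.obj x) W r := h ▸ ψ x e c

theorem ev_rfl (ψ : Raw F W y d) {x : C.Obj} {e : ℤ} (h : e + d = e + d) (c : Chain C x y e) :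
    ψ.ev h c = ψ x e c := rfl

theorem ext_ev {ψ φ : Raw F W y d}
    (H : ∀ {x : C.Obj} {e r : ℤ} (h : e + d = r) (c : Chain C x y e), ψ.ev h c = φ.ev h c) :
    ψ = φ := by
  funext x e c; exact H rfl c

section
variable {x : C.Obj} {e r : ℤ} (h : e + d = r) (c : Chain C x y e) (ψ φ : Raw F W y d) (t : k)

theorem ev_zero : ev (0 : Raw F W y d) h c = 0 := by subst h; rfl
theorem ev_add : ev (ψ + φ) h c = ψ.ev h c + φ.ev h c := by subst h; rfl
theorem ev_sub : ev (ψ - φ) h c = ψ.ev h c - φ.ev h c := by subst h; rfl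
theorem ev_neg : ev (-ψ) h c = -ψ.ev h c := by subst h; rfl
theorem ev_smul : ev (t • ψ) h c = t • ψ.ev h c := by subst h; rfl

end

/-- `Ψ` is linear in every argument. -/
def Multilinear (ψ : Raw F W y d) : Prop :=
  ∀ ⦃x : C.Obj⦄ ⦃e r : ℤ⦄ (h : e + d = r) ⦃t : k⦄ ⦃c₁ c₂ c₃ : Chain C x y e⦄,
    Chain.SlotLin t c₁ c₂ c₃ → ψ.ev h c₃ = t • ψ.ev h c₁ + ψ.ev h c₂

/-- `Ψ` vanishes as soon as one of its arguments is an identity morphism. -/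
def Normalized (ψ : Raw F W y d) : Prop :=
  ∀ ⦃x : C.Obj⦄ ⦃e r : ℤ⦄ (h : e + d = r) ⦃c : Chain C x y e⦄, Chain.HasId c → ψ.ev h c = 0

/-- `d(Ψ(fₙ, …, f₁)) + (-1)^|Ψ| ∑ᵢ (-1)^(∑_{j>i} (|fⱼ|+1)) Ψ(fₙ, …, dfᵢ, …, f₁)
+ (-1)^|Ψ| ∑ᵢ (-1)^(∑_{j>i} (|fⱼ|+1)) Ψ(fₙ, …, fᵢ₊₁ ∘ fᵢ, …, f₁)
- (-1)^|Ψ| (-1)^(∑_{j>1} (|fⱼ|+1)) Ψ(fₙ, …, f₂) ∘ F(f₁)`. -/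
def diff (ψ : Raw F W y d) {d' : ℤ} (hd : d + 1 = d') : Raw F W y d' := fun _ _ c =>
  D.d (by omega) (ψ.ev rfl c)
    + sgn k d • (c.dTerms.map fun t => t.1 • ψ.ev (by omega) t.2).sum
    + sgn k d • (c.mTerms.map fun t => t.1 • ψ.ev (by omega) t.2).sum
    - sgn k d • (c.lasts.map fun s =>
        sgn k s.e₁ • D.comp (by have := s.h; omega) (ψ.ev rfl s.init) (F.map s.f)).sum

/-- `(-1)^(|Ψ|(|fₙ|+1)) G(fₙ) ∘ Ψ(fₙ₋₁, …, f₁)`. -/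
def lact (ψ : ∀ y, Raw F (G.obj y) y d) {d' : ℤ} (hd : d + 1 = d') :
    Raw F (G.obj y) y d' := fun _ _ c =>
  (c.heads.map fun s =>
    sgn k (d * (s.a - 1)) • D.comp (by have := s.h; omega) (G.map s.f) ((ψ _).ev rfl s.tail)).sum

/-- `∑ₘ (-1)^(|Ψ₁| ∑_{i>m} (|fᵢ|+1)) Ψ₂(fₙ, …, fₘ₊₁) ∘ Ψ₁(fₘ, …, f₁)`. -/
def cup {d₁ d₂ : ℤ} (ψ₂ : Raw G W y d₂) (ψ₁ : ∀ y, Raw F (G.obj y) y d₁)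
    (hd : d₂ + d₁ = d) : Raw F W y d := fun _ _ c =>
  (c.splits.map fun s => sgn k (d₁ * s.e₁) •
    D.comp (by have := s.h; omega) (ψ₂.ev rfl s.left) ((ψ₁ _).ev rfl s.right)).sum

/-! Auxiliary operations: `freeze ψ f` is `c ↦ ψ (f, c)`; `merge ψ f` absorbs `f` in the first
entry of `c`. -/

def freeze (ψ : Raw F W z d) {a : ℤ} (f : C.Hom y z a) {d' : ℤ} (hd : a - 1 + d = d') :
    Raw F W y d' := fun _ _ c =>
  ψ.ev (by omega) (Chain.cons f c rfl)

def merge (ψ : Raw F W z d) {a : ℤ} (f : C.Hom y z a) {d' : ℤ} (hd : a + d = d') :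
    Raw F W y d' := fun _ _ c =>
  match c with
  | .nil _ => D.comp (by omega) (ψ.ev (zero_add d) (.nil z)) (F.map f)
  | .cons (a := b) g c _ =>
      sgn k a • ψ.ev (by omega) (.cons (C.comp (rfl : a + b = a + b) f g) c rfl)

def pcomp {V : D.Obj} {p : ℤ} (u : D.Hom V W p) (ψ : Raw F V y d) {d' : ℤ} (hd : p + d = d') :
    Raw F W y d' := fun _ _ c => D.comp (by omega) u (ψ.ev rfl c)

section
variable {x : C.Obj} {e r : ℤ}

theorem ev_diff (ψ : Raw F W y d) {d' : ℤ} (hd : d + 1 = d') (h : e + d' = r)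
    (c : Chain C x y e) : (diff ψ hd).ev h c =
  D.d (by omega) (ψ.ev rfl c)
    + sgn k d • (c.dTerms.map fun t => t.1 • ψ.ev (by omega) t.2).sum
    + sgn k d • (c.mTerms.map fun t => t.1 • ψ.ev (by omega) t.2).sum
    - sgn k d • (c.lasts.map fun s =>
        sgn k s.e₁ • D.comp (by have := s.h; omega) (ψ.ev rfl s.init) (F.map s.f)).sum := by
  subst h; rfl

theorem ev_lact (ψ : ∀ y, Raw F (G.obj y) y d) {d' : ℤ} (hd : d + 1 = d') (h : e + d' = r)
    (c : Chain C x y e) : (lact ψ hd).ev h c = (c.heads.map fun s =>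
    sgn k (d * (s.a - 1)) • D.comp (by have := s.h; omega) (G.map s.f)
      ((ψ _).ev rfl s.tail)).sum := by
  subst h; rfl

theorem ev_cup {d₁ d₂ : ℤ} (ψ₂ : Raw G W y d₂) (ψ₁ : ∀ y, Raw F (G.obj y) y d₁)
    (hd : d₂ + d₁ = d) (h : e + d = r) (c : Chain C x y e) : (cup ψ₂ ψ₁ hd).ev h c =
    (c.splits.map fun s => sgn k (d₁ * s.e₁) •
    D.comp (by have := s.h; omega) (ψ₂.ev rfl s.left) ((ψ₁ _).ev rfl s.right)).sum := by
  subst h; rfl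

theorem ev_freeze (ψ : Raw F W z d) {a : ℤ} (f : C.Hom y z a) {d' : ℤ} (hd : a - 1 + d = d')
    (h : e + d' = r) (c : Chain C x y e) {e' : ℤ} (he : a - 1 + e = e') :
    (freeze ψ f hd).ev h c = ψ.ev (by omega) (.cons f c he) := by
  subst h he; rfl

theorem ev_freeze' (ψ : Raw F W z d) {a : ℤ} (f : C.Hom y z a) {d' : ℤ} (hd : a - 1 + d = d')
    (h : e + d' = r) (c : Chain C x y e) :
    (freeze ψ f hd).ev h c = ψ.ev (by omega) (.cons f c rfl) := by
  subst h; rfl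

theorem ev_merge_nil (ψ : Raw F W z d) {a : ℤ} (f : C.Hom y z a) {d' : ℤ} (hd : a + d = d')
    (h : 0 + d' = r) :
    (merge ψ f hd).ev h (.nil y) =
      D.comp (by omega) (ψ.ev (zero_add d) (.nil z)) (F.map f) := by
  subst h; rfl

theorem ev_merge_cons (ψ : Raw F W z d) {w : C.Obj} {a b ab : ℤ} (f : C.Hom y z a)
    (g : C.Hom w y b) {d' : ℤ} (hd : a + d = d') (c : Chain C x w e) {e' e'' : ℤ}
    (he : b - 1 + e = e') (h : e' + d' = r) (hab : a + b = ab) (he' : ab - 1 + e = e'') :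
    (merge ψ f hd).ev h (.cons g c he) =
      sgn k a • ψ.ev (by omega) (.cons (C.comp hab f g) c he') := by
  subst h hab he'; rfl

theorem ev_merge_cons' (ψ : Raw F W z d) {w : C.Obj} {a b : ℤ} (f : C.Hom y z a)
    (g : C.Hom w y b) {d' : ℤ} (hd : a + d = d') (c : Chain C x w e) {e' : ℤ}
    (he : b - 1 + e = e') (h : e' + d' = r) :
    (merge ψ f hd).ev h (.cons g c he) =
      sgn k a • ψ.ev (by omega) (.cons (C.comp rfl f g) c rfl) := by
  subst h; rfl

theorem ev_pcomp {V : D.Obj} {p : ℤ} (u : D.Hom V W p) (ψ : Raw F V y d) {d' : ℤ}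
    (hd : p + d = d') (h : e + d' = r) (c : Chain C x y e) {s : ℤ} (hs : e + d = s) :
    (pcomp u ψ hd).ev h c = D.comp (by omega) u (ψ.ev hs c) := by
  subst h hs; rfl

end

theorem d_ev (ψ : Raw F W y d) {x : C.Obj} {e e' r r' s : ℤ} (he : e = e') (h : e + d = r)
    (h' : e' + d = r') (hs : r + 1 = s) (hs' : r' + 1 = s) (c : Chain C x y e) :
    D.d hs (ψ.ev h c) = D.d hs' (ψ.ev h' (c.cast he)) := by
  subst he h h'; rfl

theorem ev_cons (ψ : Raw F W z d) {x : C.Obj} {a e e₁ e₂ r : ℤ} (f : C.Hom y z a)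
    (c : Chain C x y e) (h₁ : a - 1 + e = e₁) (h₂ : a - 1 + e = e₂) (k₁ : e₁ + d = r)
    (k₂ : e₂ + d = r) : ψ.ev k₁ (.cons f c h₁) = ψ.ev k₂ (.cons f c h₂) := by
  subst h₁ h₂; rfl

theorem d_ev_cons (ψ : Raw F W z d) {x : C.Obj} {a e e₁ e₂ r₁ r₂ s : ℤ} (f : C.Hom y z a)
    (c : Chain C x y e) (h₁ : a - 1 + e = e₁) (h₂ : a - 1 + e = e₂) (k₁ : e₁ + d = r₁)
    (k₂ : e₂ + d = r₂) (l₁ : r₁ + 1 = s) (l₂ : r₂ + 1 = s) :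
    D.d l₁ (ψ.ev k₁ (.cons f c h₁)) = D.d l₂ (ψ.ev k₂ (.cons f c h₂)) := by
  subst h₁ h₂ k₁ k₂; rfl

theorem comp_ev_cons (ψ : Raw F W z d) {x w : C.Obj} {a b e e₁ e₂ r₁ r₂ s : ℤ}
    (f : C.Hom y z a) (c : Chain C x y e) (h₁ : a - 1 + e = e₁) (h₂ : a - 1 + e = e₂)
    (k₁ : e₁ + d = r₁) (k₂ : e₂ + d = r₂) (l₁ : r₁ + b = s) (l₂ : r₂ + b = s)
    (u : D.Hom (F.obj w) (F.obj x) b) :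
    D.comp l₁ (ψ.ev k₁ (.cons f c h₁)) u = D.comp l₂ (ψ.ev k₂ (.cons f c h₂)) u := by
  subst h₁ h₂ k₁ k₂; rfl

theorem comp_ev (ψ : Raw F W y d) {x w : C.Obj} {b e r₁ r₂ s : ℤ}
    (c : Chain C x y e)
    (k₁ : e + d = r₁) (k₂ : e + d = r₂) (l₁ : r₁ + b = s) (l₂ : r₂ + b = s)
    (u : D.Hom (F.obj w) (F.obj x) b) :
    D.comp l₁ (ψ.ev k₁ c) u = D.comp l₂ (ψ.ev k₂ c) u := by
  subst k₁ k₂; rfl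

theorem dSum_cons (ψ : Raw F W z d) {x : C.Obj} {a e e' r : ℤ}
    (f : C.Hom y z a) (c : Chain C x y e) (h' : a - 1 + e = e') (h : e' + 1 + d = r) :
    ((Chain.cons f c h').dTerms.map fun t => t.1 • ψ.ev h t.2).sum =
      (freeze (d' := a + d) ψ (C.d (q := a + 1) rfl f) (by omega)).ev (by omega) c +
      sgn k (a - 1) •
        (c.dTerms.map fun t => t.1 • (freeze ψ f rfl).ev (r := r) (by omega) t.2).sum := by
  simp only [Chain.dTerms, List.map_cons, List.sum_cons, one_smul, List.map_map, List.smul_sum]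
  congr 1
  · rw [ev_freeze]
  · congr 1
    apply List.map_congr_left
    intro t _
    simp only [Function.comp, mul_smul]
    rw [ev_freeze]

theorem mSum_cons (ψ : Raw F W z d) {x : C.Obj} {a e e' r : ℤ}
    (f : C.Hom y z a) (c : Chain C x y e) (h' : a - 1 + e = e') (h : e' + 1 + d = r) :
    ((Chain.cons f c h').mTerms.map fun t => t.1 • ψ.ev h t.2).sum
      - ((Chain.cons f c h').lasts.map fun s =>
        sgn k s.e₁ • D.comp (by have := s.h; omega) (ψ.ev rfl s.init) (F.map s.f)).sum =
      sgn k (a - 1) • ((c.mTerms.map fun t =>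
          t.1 • (freeze ψ f rfl).ev (r := r) (by omega) t.2).sum
        - (c.lasts.map fun s => sgn k s.e₁ • D.comp (by have := s.h; omega)
            ((freeze ψ f rfl).ev rfl s.init) (F.map s.f)).sum)
      - (merge ψ f rfl).ev (by omega) c := by
  cases c with
  | nil =>
    simp only [Chain.mTerms, Chain.lasts, List.map_nil, List.sum_nil, List.map_cons, List.sum_cons,
      sgn_zero, one_smul, ev_merge_nil, sub_zero, smul_zero, zero_sub, add_zero]
    congr 1
    exact comp_ev ..
  | cons g c h'' =>
    have e1 : (((Chain.cons g c h'').mTerms.map fun t =>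
          ((sgn k (a - 1) * t.1, Chain.cons f t.2 (by omega)) : k × Chain C x z (e' + 1))).map
          fun t => t.1 • ψ.ev h t.2).sum = sgn k (a - 1) • ((Chain.cons g c h'').mTerms.map fun t =>
          t.1 • (freeze ψ f rfl).ev (r := r) (by omega) t.2).sum := by
      rw [List.smul_sum, List.map_map, List.map_map]
      congr 1
      apply List.map_congr_left
      intro t _
      simp only [Function.comp, mul_smul]
      rw [ev_freeze]
    have e2 : (((Chain.cons g c h'').lasts.map fun s =>
          (⟨Chain.cons f s.init rfl, s.f, by have := s.h; omega⟩ : Chain.Last C x z e')).map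
          fun s => sgn k s.e₁ • D.comp (r := r) (by have := s.h; omega) (ψ.ev rfl s.init)
            (F.map s.f)).sum = sgn k (a - 1) • ((Chain.cons g c h'').lasts.map fun s =>
          sgn k s.e₁ • D.comp (by have := s.h; omega)
            ((freeze ψ f rfl).ev rfl s.init) (F.map s.f)).sum := by
      rw [List.smul_sum, List.map_map, List.map_map]
      congr 1
      apply List.map_congr_left
      intro s _
      simp only [Function.comp, sgn_add, mul_smul]
      rw [ev_freeze (he := rfl), comp_ev]
    rw [Chain.mTerms, Chain.lasts, List.map_cons, List.sum_cons, e1, e2,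
      ev_merge_cons (hab := rfl) (he' := rfl),
      ev_cons ψ (C.comp rfl f g) c (by omega) rfl h (by omega)]
    simp only [sgn_sub, sgn_one]
    module

theorem diff_nil (ψ : Raw F W y d) {d' r : ℤ} (hd : d + 1 = d') (h : 0 + d' = r) :
    (diff ψ hd).ev h (.nil y) = D.d (by omega) (ψ.ev (zero_add d) (.nil y)) := by
  simp only [ev_diff, Chain.dTerms, Chain.mTerms, Chain.lasts, List.map_nil, List.sum_nil,
    smul_zero, add_zero, sub_zero]
  exact d_ev _ rfl ..

theorem diff_cons (ψ : Raw F W z d) {d' : ℤ} (hd : d + 1 = d') {x : C.Obj} {a e e' r : ℤ}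
    (f : C.Hom y z a) (c : Chain C x y e) (h' : a - 1 + e = e') (h : e' + d' = r) :
    (diff ψ hd).ev h (.cons f c h') = (diff (freeze ψ f rfl) rfl).ev (by omega) c
      + sgn k d • (freeze (d' := a + d) ψ (C.d (q := a + 1) rfl f) (by omega)).ev (by omega) c
      - sgn k d • (merge ψ f rfl).ev (by omega) c := by
  have h1 := dSum_cons ψ f c h' (r := r) (by omega)
  have h2 := mSum_cons ψ f c h' (r := r) (by omega)
  have h3 : D.d (q := r) (by omega) (ψ.ev rfl (.cons f c h')) =
    D.d (by omega) ((freeze ψ f rfl).ev rfl c) := d_ev_cons ..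
  simp only [ev_diff, add_sub_assoc, ← smul_sub]
  rw [h1, h2, h3, sgn_add]
  module


theorem comp_ev' {F' G' : DGFunctor C D} {W : D.Obj} {d₁ d₂ : ℤ} (ψ : Raw G' W y d₂)
    {x w : C.Obj} (φ : Raw F' (G'.obj x) x d₁) {e e' r₁ r₂ r₁' r₂' s : ℤ}
    (c : Chain C x y e) (c' : Chain C w x e') (k₁ : e + d₂ = r₁) (k₂ : e + d₂ = r₂)
    (k₁' : e' + d₁ = r₁') (k₂' : e' + d₁ = r₂') (l₁ : r₁ + r₁' = s) (l₂ : r₂ + r₂' = s) :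
    D.comp l₁ (ψ.ev k₁ c) (φ.ev k₁' c') = D.comp l₂ (ψ.ev k₂ c) (φ.ev k₂' c') := by
  subst k₁ k₂ k₁' k₂'; rfl

theorem ev_pcomp' {V : D.Obj} {p : ℤ} (u : D.Hom V W p) (ψ : Raw F V y d) {d' : ℤ}
    (hd : p + d = d') {x : C.Obj} {e r : ℤ} (h : e + d' = r) (c : Chain C x y e) :
    (pcomp u ψ hd).ev h c = D.comp (by omega) u (ψ.ev rfl c) :=
  ev_pcomp ..
theorem diff_cons' (ψ : Raw F W z d) {d' s₀ s a' : ℤ} (hd : d + 1 = d') {x : C.Obj}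
    {a e e' r : ℤ} (f : C.Hom y z a) (c : Chain C x y e) (h' : a - 1 + e = e') (h : e' + d' = r)
    (h₀ : a - 1 + d = s₀) (h₂ : s₀ + 1 = s) (h₃ : a + 1 = a') (h₄ : a' - 1 + d = s)
    (h₅ : a + d = s) :
    (diff ψ hd).ev h (.cons f c h') = (diff (freeze ψ f h₀) h₂).ev (by omega) c
      + sgn k d • (freeze ψ (C.d h₃ f) h₄).ev (by omega) c
      - sgn k d • (merge ψ f h₅).ev (by omega) c := by
  subst h₀ h₃
  rw [diff_cons]
  obtain rfl : s = a - 1 + d + 1 := by omega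
  congr 2
  · congr 1
    rw [ev_freeze', ev_freeze']
  · have : ∀ {s : ℤ} (h : a + d = s) (h₁ : e + s = r),
      (merge ψ f rfl).ev (by omega) c = (merge ψ f h).ev h₁ c := by
      intro s h h₁; subst h; rfl
    exact this ..

theorem freeze_diff (ψ : Raw F W z d) {d' a a' s₀ s : ℤ} (hd : d + 1 = d') (f : C.Hom y z a)
    (h₁ : a - 1 + d' = s) (h₀ : a - 1 + d = s₀) (h₂ : s₀ + 1 = s) (h₃ : a + 1 = a')
    (h₄ : a' - 1 + d = s) (h₅ : a + d = s) :
    freeze (diff ψ hd) f h₁ = diff (freeze ψ f h₀) h₂ + sgn k d • freeze ψ (C.d h₃ f) h₄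
      - sgn k d • merge ψ f h₅ := by
  refine ext_ev fun h c => ?_
  rw [ev_freeze', diff_cons' (h₀ := h₀) (h₂ := h₂) (h₃ := h₃) (h₄ := h₄) (h₅ := h₅),
    ev_sub, ev_add, ev_smul, ev_smul]

theorem diff_lin {x : C.Obj} {e : ℤ} (c : Chain C x y e) : ∀ {W : D.Obj} {d d' r : ℤ}
    (ψ φ : Raw F W y d) (t : k) (hd : d + 1 = d') (h : e + d' = r),
    (diff (t • ψ + φ) hd).ev h c = t • (diff ψ hd).ev h c + (diff φ hd).ev h c := by
  induction c with
  | nil => intros; simp [diff_nil, ev_add, ev_smul]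
  | @cons y z a e e' f c h' ih =>
    intro W d d' r ψ φ t hd h
    have e1 : ∀ {a d' : ℤ} (f : C.Hom y z a) (hd : a - 1 + d = d'),
        freeze (t • ψ + φ) f hd = t • freeze ψ f hd + freeze φ f hd := by
      intro a d' f hd
      refine ext_ev fun h c => ?_
      simp only [ev_freeze', ev_add, ev_smul]
    have e2 : merge (t • ψ + φ) f rfl = t • merge ψ f rfl + merge φ f rfl := by
      refine ext_ev fun h c => ?_
      cases c
      · simp [ev_merge_nil, ev_add, ev_smul]
      · simp only [ev_merge_cons', ev_add, ev_smul]
        module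
    simp only [diff_cons, e1, e2, ih, ev_add, ev_smul]
    module

theorem diff_lin' {d' : ℤ} (ψ φ : Raw F W y d) (t : k) (hd : d + 1 = d') :
    diff (t • ψ + φ) hd = t • diff ψ hd + diff φ hd := by
  refine ext_ev fun h c => ?_
  rw [diff_lin, ev_add, ev_smul]

theorem diff_zero {d' : ℤ} (hd : d + 1 = d') : diff (0 : Raw F W y d) hd = 0 := by
  have := diff_lin' (0 : Raw F W y d) 0 1 hd
  simpa using this

theorem diff_add {d' : ℤ} (ψ φ : Raw F W y d) (hd : d + 1 = d') :
    diff (ψ + φ) hd = diff ψ hd + diff φ hd := by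
  simpa using diff_lin' ψ φ 1 hd

theorem diff_smul {d' : ℤ} (ψ : Raw F W y d) (t : k) (hd : d + 1 = d') :
    diff (t • ψ) hd = t • diff ψ hd := by
  simpa [diff_zero] using diff_lin' ψ 0 t hd

theorem diff_sub {d' : ℤ} (ψ φ : Raw F W y d) (hd : d + 1 = d') :
    diff (ψ - φ) hd = diff ψ hd - diff φ hd := by
  have := diff_lin' φ ψ (-1) hd
  rw [neg_one_smul, neg_one_smul, neg_add_eq_sub, neg_add_eq_sub] at this
  exact this

theorem Multilinear.freeze {ψ : Raw F W z d} (hψ : Multilinear ψ) {a d' : ℤ} (f : C.Hom y z a)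
    (hd : a - 1 + d = d') : Multilinear (freeze ψ f hd) := by
  intro x e r h t c₁ c₂ c₃ H
  simp only [ev_freeze']
  exact hψ _ (.tail f _ H)

theorem Multilinear.freeze_lin {ψ : Raw F W z d} (hψ : Multilinear ψ) {a d' : ℤ}
    (f g : C.Hom y z a) (t : k) (hd : a - 1 + d = d') :
    Raw.freeze ψ (t • f + g) hd = t • Raw.freeze ψ f hd + Raw.freeze ψ g hd := by
  refine ext_ev fun h c => ?_
  simp only [ev_freeze', ev_add, ev_smul]
  exact hψ _ (.head f g c _)

theorem Multilinear.freeze_zero {ψ : Raw F W z d} (hψ : Multilinear ψ) {a d' : ℤ}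
    (hd : a - 1 + d = d') : Raw.freeze ψ (0 : C.Hom y z a) hd = 0 := by
  simpa using hψ.freeze_lin 0 0 1 hd

theorem Multilinear.freeze_smul {ψ : Raw F W z d} (hψ : Multilinear ψ) {a d' : ℤ}
    (f : C.Hom y z a) (t : k) (hd : a - 1 + d = d') :
    Raw.freeze ψ (t • f) hd = t • Raw.freeze ψ f hd := by
  simpa [hψ.freeze_zero] using hψ.freeze_lin f 0 t hd

theorem Multilinear.freeze_add {ψ : Raw F W z d} (hψ : Multilinear ψ) {a d' : ℤ}
    (f g : C.Hom y z a) (hd : a - 1 + d = d') :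
    Raw.freeze ψ (f + g) hd = Raw.freeze ψ f hd + Raw.freeze ψ g hd := by
  simpa using hψ.freeze_lin f g 1 hd

theorem freeze_merge (ψ : Raw F W z d) {w : C.Obj} {a b ab d' s : ℤ} (f : C.Hom y z a)
    (g : C.Hom w y b) (hd : a + d = d') (hs : b - 1 + d' = s) (hab : a + b = ab)
    (hs' : ab - 1 + d = s) :
    freeze (merge ψ f hd) g hs = sgn k a • freeze ψ (C.comp hab f g) hs' := by
  refine ext_ev fun h c => ?_
  rw [ev_freeze', ev_smul, ev_freeze', ev_merge_cons (hab := hab) (he' := rfl)]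

theorem merge_merge (ψ : Raw F W z d) {w : C.Obj} {a b ab d' s : ℤ} (f : C.Hom y z a)
    (g : C.Hom w y b) (hd : a + d = d') (hs : b + d' = s) (hab : a + b = ab)
    (hs' : ab + d = s) :
    merge (merge ψ f hd) g hs = merge ψ (C.comp hab f g) hs' := by
  refine ext_ev fun h c => ?_
  cases c with
  | nil =>
    simp only [ev_merge_nil, DGFunctor.map, F.toMaps.map_comp]
    exact D.assoc ..
  | @cons v _ p q _ u c h' =>
    have e : C.comp (rfl : a + (b + p) = a + (b + p)) f (C.comp rfl g u) =
      C.comp (by omega) (C.comp hab f g) u := (C.assoc ..).symm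
    subst hab
    rw [ev_merge_cons', ev_merge_cons', e,
      ev_merge_cons (hab := _) (he' := rfl), smul_smul, ← sgn_add, add_comm b a]

theorem freeze_zero_raw {a d' : ℤ} (f : C.Hom y z a) (hd : a - 1 + d = d') :
    freeze (0 : Raw F W z d) f hd = 0 := by
  refine ext_ev fun h c => ?_
  simp only [ev_freeze', ev_zero]

theorem merge_lin (ψ φ : Raw F W z d) {a d' : ℤ} (t : k) (f : C.Hom y z a) (hd : a + d = d') :
    merge (t • ψ + φ) f hd = t • merge ψ f hd + merge φ f hd := by
  refine ext_ev fun h c => ?_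
  cases c
  · simp [ev_merge_nil, ev_add, ev_smul]
  · simp only [ev_merge_cons', ev_add, ev_smul]
    module

theorem Multilinear.merge_lin {ψ : Raw F W z d} (hψ : Multilinear ψ) {a d' : ℤ}
    (f g : C.Hom y z a) (t : k) (hd : a + d = d') :
    merge ψ (t • f + g) hd = t • merge ψ f hd + merge ψ g hd := by
  refine ext_ev fun h c => ?_
  cases c
  · simp [ev_merge_nil, ev_add, ev_smul]
  · simp only [ev_merge_cons', ev_add, ev_smul, map_add, map_smul,
      LinearMap.add_apply, LinearMap.smul_apply]
    rw [hψ _ (.head _ _ _ _)]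
    module

theorem Multilinear.merge {ψ : Raw F W z d} (hψ : Multilinear ψ) {a d' : ℤ}
    (f : C.Hom y z a) (hd : a + d = d') : Multilinear (merge ψ f hd) := by
  intro x e r h t c₁ c₂ c₃ H
  cases H with
  | head g g' c h' =>
    simp only [ev_merge_cons', map_add, map_smul]
    rw [hψ _ (.head _ _ _ _)]
    module
  | tail g h' H =>
    simp only [ev_merge_cons']
    rw [hψ _ (.tail _ _ H)]
    module

theorem diff_merge {ψ : Raw F W z d} (hψ : Multilinear ψ) {a a' d₁ d₂ d' : ℤ} (f : C.Hom y z a)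
    (hd₁ : a + d = d₁) (hd₂ : d₁ + 1 = d₂) (hd : d + 1 = d') (hd' : a + d' = d₂)
    (ha : a + 1 = a') (h₃ : a' + d = d₂) :
    diff (merge ψ f hd₁) hd₂ = merge (diff ψ hd) f hd' + sgn k d • merge ψ (C.d ha f) h₃ := by
  subst hd₁ ha
  refine ext_ev fun h c => ?_
  cases c with
  | nil =>
    rw [diff_nil, ev_add, ev_smul, ev_merge_nil, ev_merge_nil, ev_merge_nil, diff_nil,
      D.leibniz (hp := hd) (hq := rfl) (h₁ := by omega) (h₂ := by omega)]
    simp only [DGFunctor.map, F.toMaps.map_d]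
  | @cons v _ b q _ g c h' =>
    subst h'
    have e : C.d rfl (C.comp (rfl : a + b = a + b) f g) =
      C.comp (by omega) (C.d rfl f) g + sgn k a • C.comp (by omega) f (C.d rfl g) := C.leibniz ..
    rw [diff_cons' (s := b - 1 + d₂) (h₀ := rfl) (h₂ := by omega) (h₃ := rfl) (h₄ := by omega)
        (h₅ := by omega), freeze_merge (hab := rfl) (hs' := by omega),
      freeze_merge (hab := (by omega : a + (b + 1) = a + b + 1)) (hs' := by omega),
      merge_merge (hab := rfl) (hs' := by omega),
      ev_add, ev_smul, ev_smul, ev_merge_cons',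
      ev_merge_cons (hab := (by omega : a + 1 + b = a + b + 1)) (he' := rfl),
      diff_cons' (s := b - 1 + d₂) (s₀ := b - 1 + (a + d)) (h₀ := by omega) (h₂ := by omega)
        (h₃ := rfl) (h₄ := by omega) (h₅ := by omega),
      diff_smul, e, hψ.freeze_add, hψ.freeze_smul]
    simp only [ev_smul, ev_add, ev_freeze', sgn_add, sgn_one]
    module

theorem Multilinear.diff_diff {x : C.Obj} {e : ℤ} (c : Chain C x y e) : ∀ {W : D.Obj}
    {d d' d'' r : ℤ} {ψ : Raw F W y d} (_ : Multilinear ψ) (hd : d + 1 = d') (hd' : d' + 1 = d'')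
    (h : e + d'' = r), (diff (diff ψ hd) hd').ev h c = 0 := by
  induction c with
  | nil => intros; rw [diff_nil, diff_nil, D.d_d]
  | @cons y z a e e' f c h' ih =>
    intro W d d' d'' r ψ hψ hd hd' h
    subst hd hd'
    rw [diff_cons' (s := a + (d + 1)) (s₀ := a + d) (h₀ := by omega) (h₂ := by omega) (h₃ := rfl) (h₄ := by omega)
        (h₅ := by omega),
      freeze_diff (h₀ := rfl) (h₂ := by omega) (h₃ := rfl) (h₄ := by omega) (h₅ := by omega),
      freeze_diff (s₀ := a + d) (h₀ := by omega) (h₂ := by omega) (h₃ := rfl) (h₄ := by omega)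
        (h₅ := by omega), C.d_d, hψ.freeze_zero, diff_sub, diff_add, diff_smul, diff_smul,
      diff_merge hψ (hd := rfl) (hd' := by omega) (ha := rfl) (h₃ := by omega)]
    simp only [ev_sub, ev_add, ev_smul, ih (hψ.freeze _ _), ev_zero, sgn_add, sgn_one]
    rcases sgn_cases k d with h | h <;> rw [h] <;> module

theorem Multilinear.diff {x : C.Obj} {e : ℤ} {t : k} {c₁ c₂ c₃ : Chain C x y e}
    (H : Chain.SlotLin t c₁ c₂ c₃) : ∀ {W : D.Obj}
    {d d' r : ℤ} {ψ : Raw F W y d} (_ : Multilinear ψ) (hd : d + 1 = d')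
    (h : e + d' = r), (diff ψ hd).ev h c₃ = t • (diff ψ hd).ev h c₁ + (diff ψ hd).ev h c₂ := by
  induction H with
  | head f g c h' =>
    intro W d d' r ψ hψ hd h
    simp only [diff_cons, map_add, map_smul, hψ.freeze_lin, hψ.merge_lin, diff_lin', ev_add,
      ev_smul]
    module
  | tail f h' H ih =>
    intro W d d' r ψ hψ hd h
    simp only [diff_cons, ih (hψ.freeze _ _), hψ.freeze _ _ _ H, hψ.merge _ _ _ H]
    module

theorem freeze_pcomp {V : D.Obj} {p : ℤ} (u : D.Hom V W p) (ψ : Raw F V z d) {a d₁ d₂ d₃ : ℤ}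
    (f : C.Hom y z a) (hd₁ : p + d = d₁) (h₂ : a - 1 + d₁ = d₂) (h₃ : a - 1 + d = d₃)
    (h₄ : p + d₃ = d₂) :
    freeze (pcomp u ψ hd₁) f h₂ = pcomp u (freeze ψ f h₃) h₄ := by
  refine ext_ev fun {x e r} h c => ?_
  rw [ev_freeze', ev_pcomp (s := e + d₃) (hs := by omega), ev_pcomp (hs := rfl), ev_freeze']

theorem merge_pcomp {V : D.Obj} {p : ℤ} (u : D.Hom V W p) (ψ : Raw F V z d) {a d₁ d₂ d₃ : ℤ}
    (f : C.Hom y z a) (hd₁ : p + d = d₁) (h₂ : a + d₁ = d₂) (h₃ : a + d = d₃)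
    (h₄ : p + d₃ = d₂) :
    merge (pcomp u ψ hd₁) f h₂ = pcomp u (merge ψ f h₃) h₄ := by
  refine ext_ev fun {x e r} h c => ?_
  cases c with
  | nil =>
    rw [ev_merge_nil, ev_pcomp (hs := zero_add d), ev_pcomp (hs := rfl), ev_merge_nil]
    exact D.assoc ..
  | cons g c =>
    rw [ev_merge_cons', ev_pcomp (s := e + d₃) (hs := by omega), ev_pcomp (hs := rfl),
      ev_merge_cons', map_smul]

theorem diff_pcomp' {V : D.Obj} {x : C.Obj} {e : ℤ}
    (c : Chain C x y e) : ∀ {p p' d d' d₁ d₂ r : ℤ} (u : D.Hom V W p) (ψ : Raw F V y d)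
    (hd₁ : p + d = d₁)
    (hd₂ : d₁ + 1 = d₂) (hp : p + 1 = p') (h₁ : p' + d = d₂) (hd : d + 1 = d')
    (h₂ : p + d' = d₂) (h : e + d₂ = r),
    (diff (pcomp u ψ hd₁) hd₂).ev h c =
      (pcomp (D.d hp u) ψ h₁).ev h c + sgn k p • (pcomp u (diff ψ hd) h₂).ev h c := by
  induction c with
  | nil =>
    intro p p' d d' d₁ d₂ r u ψ hd₁ hd₂ hp h₁ hd h₂ h
    rw [diff_nil, ev_pcomp (hs := zero_add d), ev_pcomp (hs := zero_add d),
      ev_pcomp (hs := zero_add d'), diff_nil]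
    exact D.leibniz ..
  | @cons y z a e e' f c h' ih =>
    intro p p' d d' d₁ d₂ r u ψ hd₁ hd₂ hp h₁ hd h₂ h
    subst h'
    rw [diff_cons' (s := a + d₁) (s₀ := a - 1 + d₁) (h₀ := rfl) (h₂ := by omega) (h₃ := rfl)
      (h₄ := by omega) (h₅ := rfl), freeze_pcomp (h₃ := rfl) (h₄ := by omega),
      freeze_pcomp (d₃ := a + d) (h₃ := by omega) (h₄ := by omega),
      merge_pcomp (h₃ := rfl) (h₄ := by omega),
      ih _ _ _ _ hp (by omega) (d' := a + d) (by omega) (by omega),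
      ev_pcomp (s := e + (a - 1 + d)) (hs := by omega), 
      ev_pcomp (s := e + (a - 1 + d)) (c := Chain.cons f c rfl) (hs := by omega),
      ev_pcomp (s := e + (a + d)) (hs := by omega),
      ev_pcomp (s := e + (a + d)) (hs := by omega),
      ev_pcomp (s := e + (a + d)) (hs := by omega),
      ev_pcomp (s := e + (a + d)) (c := Chain.cons f c rfl) (hs := by omega),
      diff_cons' (s := a + d) (s₀ := a - 1 + d) (h₀ := rfl) (h₂ := by omega) (h₃ := rfl)
        (h₄ := by omega) (h₅ := rfl), map_sub, map_add, map_smul, map_smul, ev_freeze']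
    have : sgn k d₁ = sgn k p * sgn k d := by rw [← hd₁, sgn_add]
    rw [this]
    module

theorem diff_pcomp {V : D.Obj} {p p' d d' d₁ d₂ : ℤ} (u : D.Hom V W p) (ψ : Raw F V y d)
    (hd₁ : p + d = d₁)
    (hd₂ : d₁ + 1 = d₂) (hp : p + 1 = p') (h₁ : p' + d = d₂) (hd : d + 1 = d')
    (h₂ : p + d' = d₂) : diff (pcomp u ψ hd₁) hd₂ =
      pcomp (D.d hp u) ψ h₁ + sgn k p • pcomp u (diff ψ hd) h₂ := by
  refine ext_ev fun {x e r} h c => ?_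
  rw [diff_pcomp' (hp := hp) (h₁ := h₁) (hd := hd) (h₂ := h₂), ev_add, ev_smul]

theorem lact_nil (ψ : ∀ y, Raw F (G.obj y) y d) {d' r : ℤ} (hd : d + 1 = d') (h : 0 + d' = r) :
    (lact ψ hd).ev h (.nil y) = 0 := by
  simp [ev_lact, Chain.heads]

theorem lact_cons (ψ : ∀ y, Raw F (G.obj y) y d) {d' s : ℤ} (hd : d + 1 = d') {x : C.Obj}
    {a e e' r : ℤ} (f : C.Hom y z a) (c : Chain C x y e) (h' : a - 1 + e = e')
    (h : e' + d' = r) (hs : a + d = s) :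
    (lact ψ hd).ev h (.cons f c h') =
      sgn k (d * (a - 1)) • (pcomp (G.map f) (ψ y) hs).ev (by omega) c := by
  simp only [ev_lact, Chain.heads, List.map_cons, List.map_nil, List.sum_cons, List.sum_nil,
    add_zero]
  rw [ev_pcomp (hs := rfl)]

theorem freeze_lact (ψ : ∀ y, Raw F (G.obj y) y d) {d' s : ℤ} (hd : d + 1 = d')
    {a : ℤ} (f : C.Hom y z a) (h : a - 1 + d' = s) (hs : a + d = s) :
    freeze (lact ψ hd) f h = sgn k (d * (a - 1)) • pcomp (G.map f) (ψ y) hs := by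
  refine ext_ev fun {x e r} h c => ?_
  rw [ev_freeze', lact_cons (hs := hs), ev_smul]

/-- The total differential: the value of `delta ψ` on `(fₙ, …, f₁)` is
`d(Ψ(fₙ, …, f₁)) + (-1)^|Ψ| ∑ᵢ (-1)^(∑_{j>i} (|fⱼ|+1)) Ψ(fₙ, …, dfᵢ, …, f₁)
+ (-1)^(|Ψ|(|fₙ|+1)) G(fₙ) ∘ Ψ(fₙ₋₁, …, f₁)
+ (-1)^|Ψ| ∑ᵢ (-1)^(∑_{j>i} (|fⱼ|+1)) Ψ(fₙ, …, fᵢ₊₁ ∘ fᵢ, …, f₁)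
- (-1)^|Ψ| (-1)^(∑_{j>1} (|fⱼ|+1)) Ψ(fₙ, …, f₂) ∘ F(f₁)`. -/
def delta (ψ : ∀ y, Raw F (G.obj y) y d) {d' : ℤ} (hd : d + 1 = d') :
    ∀ y, Raw F (G.obj y) y d' := fun y => diff (ψ y) hd + lact ψ hd

theorem delta_delta {ψ : ∀ y, Raw F (G.obj y) y d} (hψ : ∀ y, Multilinear (ψ y)) {d' d'' : ℤ}
    (hd : d + 1 = d') (hd' : d' + 1 = d'') : delta (delta ψ hd) hd' = 0 := by
  funext y
  refine ext_ev fun {x e r} h c => ?_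
  have key : (diff (lact ψ hd) hd' + lact (delta ψ hd) hd').ev h c = 0 := by
    cases c with
    | nil => rw [ev_add, diff_nil, lact_nil, lact_nil, map_zero, add_zero]
    | @cons y z a e e' f c h' =>
      subst hd hd'
      rw [ev_add, diff_cons' (s := a + (d + 1)) (s₀ := a + d) (h₀ := by omega) (h₂ := by omega)
          (h₃ := rfl) (h₄ := by omega) (h₅ := by omega), freeze_lact (hs := rfl),
        freeze_lact (hs := by omega),
        diff_smul, diff_pcomp (hp := rfl) (h₁ := by omega) (hd := rfl) (h₂ := by omega),
        lact_cons (hs := rfl), ev_smul, ev_smul, ev_add, ev_smul,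
        ev_pcomp (ψ := delta ψ rfl y) (hs := rfl), delta, ev_add, map_add,
        ev_pcomp (ψ := diff (ψ y) rfl) (hs := rfl)]
      cases c with
      | nil =>
        rw [ev_merge_nil, lact_nil, lact_nil, map_zero, map_zero, LinearMap.zero_apply]
        simp only [DGFunctor.map, G.toMaps.map_d, mul_add, mul_sub, add_mul, mul_one,
          one_mul, sgn_add, sgn_sub, sgn_one]
        rcases sgn_cases k d with h | h <;> rcases sgn_cases k a with h' | h' <;> rw [h, h'] <;>
        module
      | @cons w _ b _ _ g c h'' =>
        rw [ev_merge_cons', lact_cons (hs := rfl), lact_cons (hs := rfl), ev_pcomp (hs := rfl),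
          ev_pcomp (ψ := ψ w) (hs := rfl), map_smul]
        simp only [DGFunctor.map, G.toMaps.map_d, G.toMaps.map_comp, mul_add, mul_sub, add_mul,
          mul_one, one_mul, sgn_add, sgn_sub, sgn_one]
        rw [ev_pcomp (c := Chain.cons g c h'') (hs := rfl),
          ev_pcomp (ψ := ψ w) (hs := rfl),
          D.assoc (qr := e + (d + 1)) (hqr := by omega) (h' := by omega)]
        rcases sgn_cases k d with h | h <;> rcases sgn_cases k a with h' | h' <;> rw [h, h'] <;>
        module
  simp only [delta] at key ⊢
  rw [diff_add, add_assoc, ev_add, key, (hψ y).diff_diff]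
  simp [ev_zero]


theorem lact_multilinear {ψ : ∀ y, Raw F (G.obj y) y d} (hψ : ∀ y, Multilinear (ψ y)) {d' : ℤ}
    (hd : d + 1 = d') : Multilinear (lact ψ hd : Raw F (G.obj y) y d') := by
  intro x e r h t c₁ c₂ c₃ H
  cases H with
  | head f g c h' =>
    rw [lact_cons (hs := rfl), lact_cons (hs := rfl), lact_cons (hs := rfl),
      ev_pcomp (hs := rfl), ev_pcomp (hs := rfl), ev_pcomp (hs := rfl)]
    simp only [map_add, map_smul, LinearMap.add_apply, LinearMap.smul_apply]
    module
  | tail f h' H =>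
    rw [lact_cons (hs := rfl), lact_cons (hs := rfl), lact_cons (hs := rfl),
      ev_pcomp (hs := rfl), ev_pcomp (hs := rfl), ev_pcomp (hs := rfl), hψ _ _ H]
    simp only [map_add, map_smul]
    module

theorem add_multilinear {ψ φ : Raw F W y d} (hψ : Multilinear ψ) (hφ : Multilinear φ) :
    Multilinear (ψ + φ) := by
  intro x e r h t c₁ c₂ c₃ H
  rw [ev_add, ev_add, ev_add, hψ _ H, hφ _ H]
  module

theorem smul_multilinear {ψ : Raw F W y d} (hψ : Multilinear ψ) (t : k) :
    Multilinear (t • ψ) := by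
  intro x e r h t c₁ c₂ c₃ H
  rw [ev_smul, ev_smul, ev_smul, hψ _ H]
  module

theorem zero_multilinear : Multilinear (0 : Raw F W y d) := by
  intro x e r h t c₁ c₂ c₃ H
  simp [ev_zero]

theorem delta_multilinear {ψ : ∀ y, Raw F (G.obj y) y d} (hψ : ∀ y, Multilinear (ψ y)) {d' : ℤ}
    (hd : d + 1 = d') (y : C.Obj) : Multilinear (delta ψ hd y) :=
  add_multilinear (fun _ _ _ _ _ _ _ _ H => Multilinear.diff H (hψ y) _ _)
    (lact_multilinear hψ hd)

theorem add_normalized {ψ φ : Raw F W y d} (hψ : Normalized ψ) (hφ : Normalized φ) :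
    Normalized (ψ + φ) := by
  intro x e r h c H
  rw [ev_add, hψ _ H, hφ _ H, add_zero]

theorem smul_normalized {ψ : Raw F W y d} (hψ : Normalized ψ) (t : k) :
    Normalized (t • ψ) := by
  intro x e r h c H
  rw [ev_smul, hψ _ H, smul_zero]

theorem zero_normalized : Normalized (0 : Raw F W y d) := by
  intro x e r h c H
  rw [ev_zero]

theorem Normalized.freeze {ψ : Raw F W z d} (hψ : Normalized ψ) {a d' : ℤ} (f : C.Hom y z a)
    (hd : a - 1 + d = d') : Normalized (freeze ψ f hd) := by
  intro x e r h c H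
  rw [ev_freeze']
  exact hψ _ (.tail f _ H)

theorem Normalized.freeze_id {ψ : Raw F W z d} (hψ : Normalized ψ) {d' : ℤ}
    (hd : 0 - 1 + d = d') : Raw.freeze ψ (C.id z) hd = 0 := by
  refine ext_ev fun {x e r} h c => ?_
  rw [ev_freeze', ev_zero]
  exact hψ _ (.head _ _)

theorem merge_id (ψ : Raw F W z d) {d' : ℤ} (hd : 0 + d = d') {x : C.Obj} {e r : ℤ}
    (h : e + d' = r) (h' : e + d = r) (c : Chain C x z e) :
    (merge ψ (C.id z) hd).ev h c = ψ.ev h' c := by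
  subst h'
  cases c with
  | nil =>
    rw [ev_merge_nil, DGFunctor.map, F.toMaps.map_id]
    have : ∀ {r s : ℤ} (h : 0 + d = r) (h' : 0 + d = s) (h'' : r + 0 = s),
      D.comp h'' (ψ.ev h (.nil z)) (D.id (F.obj z)) = ψ.ev h' (.nil z) := by
      intro r s h h' h''
      obtain rfl : r = s := by omega
      exact D.comp_id _
    exact this ..
  | cons g c h'' =>
    rw [ev_merge_cons (hab := zero_add _) (he' := h''), C.id_comp, sgn_zero, one_smul]

theorem diff_freeze_sub {x : C.Obj} {e : ℤ} {c : Chain C x y e} (H : Chain.HasId c) :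
    ∀ {z : C.Obj} {W : D.Obj} {d d' d'' a r : ℤ} {ψ : Raw F W z d} (_ : Multilinear ψ)
    (_ : Normalized ψ)
    (f : C.Hom y z a) (hd : a - 1 + d = d') (hd' : d' + 1 = d'') (hd'' : a + d = d'')
    (h : e + d'' = r),
    (diff (freeze ψ f hd) hd').ev h c - sgn k d • (merge ψ f hd'').ev h c = 0 := by
  induction H with
  | @head y e e' c h' =>
    intro z W d d' d'' a r ψ hψ hψ' f hd hd' hd'' h
    have e0 : freeze (freeze ψ f hd) (C.id y) rfl = 0 := (hψ'.freeze f hd).freeze_id rfl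
    rw [diff_cons' (s := 0 + d') (h₀ := rfl) (h₂ := by omega) (h₃ := rfl) (h₄ := by omega)
      (h₅ := by omega), e0, diff_zero, C.d_id, (hψ.freeze f hd).freeze_zero, ev_zero, merge_id (h' := by omega), ev_merge_cons (hab := add_zero a) (he' := rfl), C.comp_id,
      ev_freeze']
    have : sgn k d' = sgn k a * -1 * sgn k d := by rw [← hd, sgn_add, sgn_sub, sgn_one]
    rw [this]
    module
  | @tail y y' b e e' g c h' H ih =>
    intro z W d d' d'' a r ψ hψ hψ' f hd hd' hd'' h
    have := ih (hψ.freeze f hd) (hψ'.freeze f hd) g (d'' := b + d') rfl (by omega) rfl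
      (r := r) (by omega)
    rw [diff_cons' (s := b + d') (h₀ := rfl) (h₂ := by omega) (h₃ := rfl) (h₄ := by omega)
      (h₅ := by omega), (hψ'.freeze f hd).freeze _ _ _ H,
      ev_merge_cons', hψ' _ (.tail _ _ H), smul_zero, smul_zero, smul_zero, add_zero,
      sub_zero, this]

theorem delta_normalized {ψ : ∀ y, Raw F (G.obj y) y d} (hψ : ∀ y, Multilinear (ψ y))
    (hψ' : ∀ y, Normalized (ψ y)) {d' : ℤ}
    (hd : d + 1 = d') (y : C.Obj) : Normalized (delta ψ hd y) := by
  intro x e r h c H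
  rw [delta, ev_add]
  cases H with
  | @head y e e' c h' =>
    rw [diff_cons' (s := 0 + d) (h₀ := rfl) (h₂ := by omega) (h₃ := rfl) (h₄ := by omega)
      (h₅ := by omega), (hψ' y).freeze_id, diff_zero, C.d_id, (hψ y).freeze_zero, ev_zero, merge_id (h' := by omega), lact_cons (hs := rfl), ev_pcomp (hs := rfl), DGFunctor.map,
      G.toMaps.map_id]
    have : ∀ {r s : ℤ} (h : e + d = r) (h' : e + d = s) (h'' : 0 + r = s),
      D.comp h'' (D.id (G.obj y)) ((ψ y).ev h c) = (ψ y).ev h' c := by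
      intro r s h h' h''
      obtain rfl : s = r := by omega
      exact D.id_comp _
    rw [this (h' := by omega)]
    have : sgn k (d * (0 - 1)) = sgn k d := by rw [← sgn_neg]; congr 1; ring
    rw [this]
    module
  | @tail y _ a e e' f c h' H =>
    have := diff_freeze_sub H (hψ _) (hψ' _) f (d'' := a + d) rfl (by omega) rfl
      (r := r) (by omega)
    rw [diff_cons' (s := a + d) (h₀ := rfl) (h₂ := by omega) (h₃ := rfl) (h₄ := by omega)
      (h₅ := by omega), (hψ' _).freeze _ _ _ H, lact_cons (hs := rfl), ev_pcomp (hs := rfl),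
      hψ' _ _ H, map_zero, smul_zero, smul_zero, add_zero, add_zero, this]

section cup
variable {d₁ d₂ : ℤ}

theorem cup_nil (ψ : Raw G W z d₂) (φ : ∀ y, Raw F (G.obj y) y d₁) (hd : d₂ + d₁ = d) {r : ℤ}
    (h : 0 + d = r) : (cup ψ φ hd).ev h (.nil z) =
      (pcomp (ψ.ev (zero_add d₂) (.nil z)) (φ z) hd).ev h (.nil z) := by
  subst h
  rw [ev_cup, ev_pcomp (hs := rfl)]
  simp only [Chain.splits, List.map_cons, List.map_nil, List.sum_cons, List.sum_nil, mul_zero,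
    sgn_zero, one_smul, add_zero]
  exact comp_ev' ..

theorem cup_cons (ψ : Raw G W z d₂) (φ : ∀ y, Raw F (G.obj y) y d₁) (hd : d₂ + d₁ = d)
    {x : C.Obj} {a e e' r s t : ℤ} (f : C.Hom y z a) (c : Chain C x y e) (h' : a - 1 + e = e')
    (h : e' + d = r) (hs : a - 1 + d₂ = s) (ht : s + d₁ = t) :
    (cup ψ φ hd).ev h (.cons f c h') =
      (pcomp (ψ.ev (zero_add d₂) (.nil z)) (φ z) hd).ev h (.cons f c h')
        + sgn k (d₁ * (a - 1)) • (cup (freeze ψ f hs) φ ht).ev (by omega) c := by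
  rw [ev_cup, ev_pcomp (hs := rfl), ev_cup]
  simp only [Chain.splits, List.map_cons, List.sum_cons, mul_zero,
    sgn_zero, one_smul, List.map_map, List.smul_sum]
  congr 1
  · exact comp_ev' ..
  · congr 1
    apply List.map_congr_left
    intro w _
    simp only [Function.comp, mul_add, sgn_add, mul_smul]
    rw [ev_freeze', comp_ev']

theorem freeze_cup (ψ : Raw G W z d₂) (φ : ∀ y, Raw F (G.obj y) y d₁) (hd : d₂ + d₁ = d)
    {a s s' t : ℤ} (f : C.Hom y z a) (h : a - 1 + d = t) (hs : a - 1 + d₂ = s)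
    (ht : s + d₁ = t) (hs' : a - 1 + d₁ = s') (ht' : d₂ + s' = t) :
    freeze (cup ψ φ hd) f h = pcomp (ψ.ev (zero_add d₂) (.nil z)) (freeze (φ z) f hs') ht'
      + sgn k (d₁ * (a - 1)) • cup (freeze ψ f hs) φ ht := by
  refine ext_ev fun {x e r} h c => ?_
  rw [ev_freeze', ev_add, ev_smul, cup_cons (hs := hs) (ht := ht), ← freeze_pcomp (hd₁ := hd)
    (h₂ := by omega), ev_freeze']

theorem cup_lin {x : C.Obj} {e : ℤ} (c : Chain C x y e) : ∀ {W : D.Obj} {d₂ d r : ℤ}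
    (ψ ψ' : Raw G W y d₂) (φ : ∀ y, Raw F (G.obj y) y d₁) (t : k) (hd : d₂ + d₁ = d)
    (h : e + d = r),
    (cup (t • ψ + ψ') φ hd).ev h c = t • (cup ψ φ hd).ev h c + (cup ψ' φ hd).ev h c := by
  induction c with
  | nil =>
    intros
    simp only [cup_nil, ev_pcomp', ev_add, ev_smul, map_add, map_smul,
      LinearMap.add_apply, LinearMap.smul_apply]
  | @cons y z a e e' f c h' ih =>
    intro W d₂ d r ψ ψ' φ t hd h
    have e1 : freeze (t • ψ + ψ') f rfl = t • freeze ψ f rfl + freeze ψ' f rfl := by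
      refine ext_ev fun h c => ?_
      simp only [ev_freeze', ev_add, ev_smul]
    rw [cup_cons (hs := rfl) (ht := rfl), cup_cons (hs := rfl) (ht := rfl),
      cup_cons (hs := rfl) (ht := rfl), e1, ih]
    simp only [ev_pcomp', ev_add, ev_smul, map_add, map_smul, LinearMap.add_apply, LinearMap.smul_apply]
    module

theorem cup_lin' (ψ ψ' : Raw G W y d₂) (φ : ∀ y, Raw F (G.obj y) y d₁) (t : k)
    (hd : d₂ + d₁ = d) : cup (t • ψ + ψ') φ hd = t • cup ψ φ hd + cup ψ' φ hd := by
  refine ext_ev fun {x e r} h c => ?_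
  rw [cup_lin, ev_add, ev_smul]

theorem cup_zero_left (φ : ∀ y, Raw F (G.obj y) y d₁)
    (hd : d₂ + d₁ = d) : cup (0 : Raw G W y d₂) φ hd = 0 := by
  simpa using cup_lin' (0 : Raw G W y d₂) 0 φ 1 hd

theorem cup_add_left (ψ ψ' : Raw G W y d₂) (φ : ∀ y, Raw F (G.obj y) y d₁)
    (hd : d₂ + d₁ = d) : cup (ψ + ψ') φ hd = cup ψ φ hd + cup ψ' φ hd := by
  simpa using cup_lin' ψ ψ' φ 1 hd

theorem cup_smul_left (ψ : Raw G W y d₂) (φ : ∀ y, Raw F (G.obj y) y d₁) (t : k)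
    (hd : d₂ + d₁ = d) : cup (t • ψ) φ hd = t • cup ψ φ hd := by
  simpa [cup_zero_left] using cup_lin' ψ 0 φ t hd

theorem cup_sub_left (ψ ψ' : Raw G W y d₂) (φ : ∀ y, Raw F (G.obj y) y d₁)
    (hd : d₂ + d₁ = d) : cup (ψ - ψ') φ hd = cup ψ φ hd - cup ψ' φ hd := by
  have := cup_lin' ψ' ψ φ (-1) hd
  rw [neg_one_smul, neg_one_smul, neg_add_eq_sub, neg_add_eq_sub] at this
  exact this

theorem cup_lin_right {x : C.Obj} {e : ℤ} (c : Chain C x y e) : ∀ {W : D.Obj} {d₂ d r : ℤ}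
    (ψ : Raw G W y d₂) (φ φ' : ∀ y, Raw F (G.obj y) y d₁) (t : k) (hd : d₂ + d₁ = d)
    (h : e + d = r),
    (cup ψ (t • φ + φ') hd).ev h c = t • (cup ψ φ hd).ev h c + (cup ψ φ' hd).ev h c := by
  induction c with
  | nil =>
    intros
    simp only [cup_nil, ev_pcomp', Pi.add_apply, Pi.smul_apply]
    rw [ev_add, ev_smul, map_add, map_smul]
  | @cons y z a e e' f c h' ih =>
    intro W d₂ d r ψ φ φ' t hd h
    rw [cup_cons (hs := rfl) (ht := rfl), cup_cons (hs := rfl) (ht := rfl),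
      cup_cons (hs := rfl) (ht := rfl), ih]
    simp only [ev_pcomp', Pi.add_apply, Pi.smul_apply]
    rw [ev_add, ev_smul, map_add, map_smul]
    module

theorem cup_pcomp {V : D.Obj} {x : C.Obj} {e : ℤ} (c : Chain C x y e) :
    ∀ {p d₂ d r s t : ℤ} (u : D.Hom V W p)
    (ψ : Raw G V y d₂) (φ : ∀ y, Raw F (G.obj y) y d₁) (hs : p + d₂ = s) (ht : s + d₁ = t)
    (hd : d₂ + d₁ = d) (ht' : p + d = t) (h : e + t = r),
    (cup (pcomp u ψ hs) φ ht).ev h c = (pcomp u (cup ψ φ hd) ht').ev h c := by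
  induction c with
  | nil =>
    intro p d₂ d r s t u ψ φ hs ht hd ht' h
    rw [cup_nil, ev_pcomp (hs := rfl), ev_pcomp (hs := zero_add _), ev_pcomp (hs := rfl), cup_nil,
      ev_pcomp (hs := rfl)]
    exact D.assoc ..
  | @cons y z a e e' f c h' ih =>
    intro p d₂ d r s t u ψ φ hs ht hd ht' h
    rw [cup_cons (s := a - 1 + s) (t := a - 1 + t) (hs := rfl) (ht := by omega),
      freeze_pcomp (h₃ := rfl) (h₄ := by omega),
      ih u _ φ _ _ (d := a - 1 + d) (by omega) (by omega), ev_pcomp (hs := rfl),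
      ev_pcomp (hs := zero_add _), ev_pcomp (c := c) (s := e' + d) (hs := by omega),
      ev_pcomp (ψ := cup ψ φ hd) (hs := rfl),
      cup_cons (s := a - 1 + d₂) (t := a - 1 + d) (hs := rfl) (ht := by omega), map_add, map_smul,
      ev_pcomp (hs := rfl)]
    congr 1
    exact D.assoc ..

theorem cup_pcomp' {V : D.Obj} {p s t : ℤ} (u : D.Hom V W p)
    (ψ : Raw G V y d₂) (φ : ∀ y, Raw F (G.obj y) y d₁) (hs : p + d₂ = s) (ht : s + d₁ = t)
    (hd : d₂ + d₁ = d) (ht' : p + d = t) :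
    cup (pcomp u ψ hs) φ ht = pcomp u (cup ψ φ hd) ht' :=
  ext_ev fun h c => cup_pcomp c u ψ φ hs ht hd ht' h

theorem cup_assoc {x : C.Obj} {e : ℤ} (c : Chain C x y e) : ∀ {W : D.Obj}
    {d₃ d₂₁ d₃₂ d r : ℤ} (ψ : Raw H W y d₃) (χ : ∀ y, Raw G (H.obj y) y d₂)
    (φ : ∀ y, Raw F (G.obj y) y d₁) (h₁ : d₃ + d₂ = d₃₂) (h₂ : d₃₂ + d₁ = d) (h₃ : d₂ + d₁ = d₂₁)
    (h₄ : d₃ + d₂₁ = d) (h : e + d = r),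
    (cup (cup ψ χ h₁) φ h₂).ev h c = (cup ψ (fun y => cup (χ y) φ h₃) h₄).ev h c := by
  induction c with
  | nil =>
    intro W d₃ d₂₁ d₃₂ d r ψ χ φ h₁ h₂ h₃ h₄ h
    rw [cup_nil, cup_nil, cup_nil, ev_pcomp (hs := rfl), ev_pcomp (hs := zero_add _),
      ev_pcomp (hs := rfl), cup_nil, ev_pcomp (hs := rfl)]
    exact D.assoc ..
  | @cons y z a e e' f c h' ih =>
    intro W d₃ d₂₁ d₃₂ d r ψ χ φ h₁ h₂ h₃ h₄ h
    rw [cup_cons (s := a - 1 + d₃₂) (t := a - 1 + d) (hs := rfl) (ht := by omega),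
      freeze_cup (s := a - 1 + d₃) (s' := a - 1 + d₂) (hs := rfl) (ht := by omega) (hs' := rfl)
        (ht' := by omega), cup_add_left, cup_smul_left, ev_add, ev_smul,
      ih _ _ _ _ _ h₃ (by omega),
      cup_pcomp' (d := a - 1 + d₂₁) (hd := by omega) (ht' := by omega),
      cup_nil, ev_pcomp (hs := rfl), ev_pcomp (hs := zero_add _),
      ev_pcomp (c := c) (s := e' + d₂₁) (hs := by omega),
      cup_cons (s := a - 1 + d₃) (t := a - 1 + d) (hs := rfl) (ht := by omega),
      ev_pcomp (s := e' + d₂₁) (hs := rfl),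
      cup_cons (s := a - 1 + d₂) (t := a - 1 + d₂₁) (hs := rfl) (ht := by omega),
      ev_pcomp (hs := rfl), map_add, map_smul]
    have : sgn k (d₂₁ * (a - 1)) = sgn k (d₂ * (a - 1)) * sgn k (d₁ * (a - 1)) := by
      rw [← h₃, add_mul, sgn_add]
    rw [this, D.assoc (qr := e' + d₂₁) (hqr := by omega) (h' := by omega)]
    module

theorem merge_cup (ψ : Raw G W z d₂) (φ : ∀ y, Raw F (G.obj y) y d₁) (hd : d₂ + d₁ = d)
    {a s s' t p : ℤ} (f : C.Hom y z a) (h : a + d = t) (hs : a + d₂ = s)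
    (ht : s + d₁ = t) (hs' : a + d₁ = s') (ht' : d₂ + s' = t) (hp : d₂ + a = p)
    (ht'' : p + d₁ = t) :
    merge (cup ψ φ hd) f h = pcomp (ψ.ev (zero_add d₂) (.nil z)) (merge (φ z) f hs') ht'
      + sgn k (d₁ * a) • (cup (merge ψ f hs) φ ht
        - pcomp (D.comp hp (ψ.ev (zero_add d₂) (.nil z)) (G.map f)) (φ y) ht'') := by
  refine ext_ev fun {x e r} h c => ?_
  rw [ev_add, ev_smul, ev_sub]
  cases c with
  | nil =>
    rw [ev_merge_nil, cup_nil, cup_nil, ev_pcomp (hs := zero_add _), ev_pcomp (hs := zero_add _),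
      ev_pcomp (hs := zero_add _), ev_pcomp (hs := zero_add _), ev_merge_nil, ev_merge_nil]
    have : ∀ {p s : ℤ} (hp : d₂ + a = p) (hs : d₂ + a = s) (ht'' : p + d₁ = r) (hs'' : s + d₁ = r),
      D.comp hs'' (D.comp hs (ψ.ev (zero_add d₂) (.nil z)) (G.map f))
        ((φ y).ev (zero_add d₁) (.nil y)) =
      D.comp ht'' (D.comp hp (ψ.ev (zero_add d₂) (.nil z)) (G.map f))
        ((φ y).ev (zero_add d₁) (.nil y)) := by
      intro p s hp hs _ _
      subst hp hs
      rfl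
    rw [this (hp := hp) (ht'' := by omega), sub_self, smul_zero, add_zero]
    exact D.assoc ..
  | @cons w _ b e₀ _ g c h' =>
    rw [ev_merge_cons', cup_cons (s := a + b - 1 + d₂) (t := a + b - 1 + d) (hs := rfl)
        (ht := by omega), cup_cons (s := b - 1 + s) (t := b - 1 + t) (hs := rfl) (ht := by omega),
      freeze_merge (hab := rfl) (hs' := by omega), cup_smul_left, ev_smul, ev_pcomp',
      ev_pcomp', ev_pcomp', ev_pcomp', ev_merge_cons', map_smul, ev_merge_nil]
    have : ∀ {p s : ℤ} (hp : d₂ + a = p) (hs : d₂ + a = s) (ht'' : p + (e + d₁) = r)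
      (hs'' : s + (e + d₁) = r),
      D.comp hs'' (D.comp hs (ψ.ev (zero_add d₂) (.nil z)) (G.map f))
        ((φ y).ev rfl (.cons g c h')) =
      D.comp ht'' (D.comp hp (ψ.ev (zero_add d₂) (.nil z)) (G.map f))
        ((φ y).ev rfl (.cons g c h')) := by
      intro p s hp hs _ _
      subst hp hs
      rfl
    rw [this (hp := hp) (ht'' := by omega)]
    have : ∀ {s t : ℤ} (hs : a + b - 1 + d₂ = s) (ht : s + d₁ = t) (h : e₀ + t = r)
      {s' t' : ℤ} (hs' : a + b - 1 + d₂ = s') (ht' : s' + d₁ = t') (h' : e₀ + t' = r),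
      (cup (freeze ψ (C.comp rfl f g) hs) φ ht).ev h c =
        (cup (freeze ψ (C.comp rfl f g) hs') φ ht').ev h' c := by
      intros
      subst_vars
      rfl
    rw [this (s' := b - 1 + s) (t' := b - 1 + t) (hs' := by omega) (ht' := by omega)
        (h' := by omega),
      comp_ev' ψ (φ z) (r₁' := a + b - 1 + e₀ + d₁) (k₂ := zero_add d₂) (r₂' := e + s')
        (k₂' := by omega) (l₂ := by omega)]
    simp only [mul_add, mul_sub, mul_one, sgn_add, sgn_sub]
    module


theorem comp_ev_pcomp {V : D.Obj} {p : ℤ} (u : D.Hom V W p) (ψ : Raw F V y d) {x : C.Obj}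
    {e r s : ℤ} (h : e + d = r) (l : p + r = s) (c : Chain C x y e) :
    D.comp l u (ψ.ev h c) = (pcomp u ψ rfl).ev (by omega) c := by
  subst h
  exact (ev_pcomp' ..).symm

theorem pcomp_pcomp {V U : D.Obj} {p q pq s t : ℤ} (u : D.Hom V W p) (v : D.Hom U V q)
    (ψ : Raw F U y d) (h : q + d = s) (h' : p + s = t) (hpq : p + q = pq) (h'' : pq + d = t) :
    pcomp u (pcomp v ψ h) h' = pcomp (D.comp hpq u v) ψ h'' := by
  refine ext_ev fun {x e r} l c => ?_
  rw [ev_pcomp (hs := rfl), ev_pcomp (hs := rfl), ev_pcomp (hs := rfl)]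
  exact (D.assoc ..).symm

theorem ev_delta (ψ : ∀ y, Raw F (G.obj y) y d) {d' : ℤ} (hd : d + 1 = d') {x : C.Obj}
    {e r : ℤ} (h : e + d' = r) (c : Chain C x y e) :
    (delta ψ hd y).ev h c = (diff (ψ y) hd).ev h c + (lact ψ hd).ev h c := ev_add ..

theorem diff_cup {x : C.Obj} {e : ℤ} (c : Chain C x y e) : ∀ {W : D.Obj}
    {d₂ d₂' d₁' d d' r : ℤ} (ψ : Raw G W y d₂) (φ : ∀ y, Raw F (G.obj y) y d₁) (hd : d₂ + d₁ = d)
    (hd' : d + 1 = d') (h₂ : d₂ + 1 = d₂') (h₃ : d₂' + d₁ = d') (h₁ : d₁ + 1 = d₁')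
    (h₄ : d₂ + d₁' = d') (h : e + d' = r),
    (diff (cup ψ φ hd) hd').ev h c =
      (cup (diff ψ h₂) φ h₃).ev h c + sgn k d₂ • (cup ψ (delta φ h₁) h₄).ev h c := by
  induction c with
  | nil =>
    intro W d₂ d₂' d₁' d d' r ψ φ hd hd' h₂ h₃ h₁ h₄ h
    rw [diff_nil, cup_nil, cup_nil, cup_nil, ev_pcomp (hs := zero_add _),
      ev_pcomp (hs := zero_add _), ev_pcomp (hs := zero_add _), diff_nil, ev_delta, lact_nil,
      add_zero, diff_nil]
    exact D.leibniz ..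
  | @cons y z a e e' f c h' ih =>
    intro W d₂ d₂' d₁' d d' r ψ φ hd hd' h₂ h₃ h₁ h₄ h
    rw [diff_cons' (s := a + d) (s₀ := a - 1 + d) (h₀ := rfl) (h₂ := by omega) (h₃ := rfl)
        (h₄ := by omega) (h₅ := rfl),
      freeze_cup (s := a - 1 + d₂) (s' := a - 1 + d₁) (hs := rfl) (ht := by omega) (hs' := rfl)
        (ht' := by omega),
      freeze_cup (s := a + d₂) (s' := a + d₁) (hs := by omega) (ht := by omega) (hs' := by omega)
        (ht' := by omega),
      merge_cup (s := a + d₂) (s' := a + d₁) (p := d₂ + a) (hs := by omega) (ht := by omega)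
        (hs' := by omega) (ht' := by omega) (hp := rfl) (ht'' := by omega),
      diff_add, diff_smul,
      diff_pcomp (p' := d₂') (d' := a + d₁) (hp := h₂) (h₁ := by omega) (hd := by omega)
        (h₂ := by omega)]
    simp only [ev_add, ev_smul, ev_sub]
    rw [ih (d₂' := a + d₂) (d₁' := d₁') (h₂ := by omega) (h₃ := by omega) (h₁ := h₁)
        (h₄ := by omega),
      cup_cons (s := a + d₂) (t := a + d) (hs := by omega) (ht := by omega),
      cup_cons (s := a - 1 + d₂) (t := a + d) (hs := by omega) (ht := by omega),
      freeze_diff (s₀ := a - 1 + d₂) (a' := a + 1) (h₀ := rfl) (h₂ := by omega) (h₃ := rfl)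
        (h₄ := by omega) (h₅ := by omega),
      cup_sub_left, cup_add_left, cup_smul_left, cup_smul_left, ev_sub, ev_add, ev_smul, ev_smul,
      diff_nil]
    simp only [ev_pcomp']
    rw [ev_delta, lact_cons (s := a + d₁) (hs := rfl),
      diff_cons' (s := a + d₁) (s₀ := a - 1 + d₁) (h₀ := rfl) (h₂ := by omega) (h₃ := rfl)
        (h₄ := by omega) (h₅ := rfl)]
    rw [← ev_freeze (φ z) f rfl (by omega) c h']
    simp only [map_add, map_sub, map_smul, comp_ev_pcomp]
    rw [pcomp_pcomp (pq := d₂ + a) (hpq := rfl) (h'' := by omega)]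
    have e1 : ∀ {s : ℤ} (h : e + s = r) (hs : d₂ + a + d₁ = s),
      (pcomp (D.comp rfl (ψ.ev (zero_add d₂) (.nil z)) (G.map f)) (φ y) hs).ev h c =
      (pcomp (D.comp rfl (ψ.ev (zero_add d₂) (.nil z)) (G.map f)) (φ y) rfl).ev (by omega) c := by
      intro s h hs; subst hs; rfl
    have e2 : sgn k d = sgn k d₂ * sgn k d₁ := by rw [← hd, sgn_add]
    have e3 : sgn k (d₁' * (a - 1)) = sgn k (d₁ * a) * sgn k d₁ * (sgn k a * -1) := by
      rw [← h₁, ← sgn_one, ← sgn_sub, ← sgn_sub, ← sgn_add]; congr 1; ring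
    rw [e1 (s := d₂ + (a + d₁)) (hs := by omega), e2, e3]
    simp only [mul_sub, add_sub_cancel_right, mul_one, sgn_sub, sgn_add, sgn_one]
    rcases sgn_cases k d₁ with h | h <;> rcases sgn_cases k d₂ with h' | h' <;> rw [h, h'] <;>
        module

theorem cup_add_right (ψ : Raw G W y d₂) (φ φ' : ∀ y, Raw F (G.obj y) y d₁)
    (hd : d₂ + d₁ = d) : cup ψ (φ + φ') hd = cup ψ φ hd + cup ψ φ' hd := by
  refine ext_ev fun {x e r} h c => ?_
  simpa [ev_add] using cup_lin_right c ψ φ φ' 1 hd h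

theorem cup_smul_right (ψ : Raw G W y d₂) (φ : ∀ y, Raw F (G.obj y) y d₁) (t : k)
    (hd : d₂ + d₁ = d) : cup ψ (t • φ) hd = t • cup ψ φ hd := by
  refine ext_ev fun {x e r} h c => ?_
  have h0 := cup_lin_right c ψ (0 : ∀ y, Raw F (G.obj y) y d₁) 0 1 hd h
  have h1 := cup_lin_right c ψ φ 0 t hd h
  simp only [smul_zero, add_zero, one_smul, left_eq_add] at h0
  rw [h0, add_zero, add_zero] at h1
  rw [h1, ev_smul]

theorem lact_cup (ψ : ∀ y, Raw G (H.obj y) y d₂) (φ : ∀ y, Raw F (G.obj y) y d₁)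
    (hd : d₂ + d₁ = d) {d' d₂' : ℤ} (hd' : d + 1 = d') (h₂ : d₂ + 1 = d₂') (h₃ : d₂' + d₁ = d')
    {x : C.Obj} {e r : ℤ} (h : e + d' = r) (c : Chain C x y e) :
    (lact (fun y => cup (ψ y) φ hd) hd').ev h c = (cup (lact ψ h₂) φ h₃).ev h c := by
  cases c with
  | nil => rw [lact_nil, cup_nil, ev_pcomp (hs := zero_add _), lact_nil, map_zero,
      LinearMap.zero_apply]
  | @cons y _ a e e' f c h' =>
    rw [lact_cons (hs := rfl), cup_cons (s := a + d₂) (t := a + d) (hs := by omega)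
      (ht := by omega), freeze_lact (hs := rfl), cup_smul_left, ev_smul,
      cup_pcomp' (hd := hd) (ht' := by omega), ev_pcomp (c := Chain.cons f c h') (hs := rfl), lact_nil, map_zero,
      LinearMap.zero_apply, zero_add, smul_smul, ← sgn_add]
    congr 2
    rw [← hd]
    ring

theorem delta_cup (ψ : ∀ y, Raw G (H.obj y) y d₂) (φ : ∀ y, Raw F (G.obj y) y d₁)
    (hd : d₂ + d₁ = d) {d' d₂' d₁' : ℤ} (hd' : d + 1 = d') (h₂ : d₂ + 1 = d₂')
    (h₃ : d₂' + d₁ = d') (h₁ : d₁ + 1 = d₁') (h₄ : d₂ + d₁' = d') :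
    delta (fun y => cup (ψ y) φ hd) hd' = (fun y => cup (delta ψ h₂ y) φ h₃) +
      sgn k d₂ • fun y => cup (ψ y) (delta φ h₁) h₄ := by
  funext y
  refine ext_ev fun {x e r} h c => ?_
  rw [ev_delta, diff_cup (h₂ := h₂) (h₃ := h₃) (h₁ := h₁) (h₄ := h₄), lact_cup (h₂ := h₂) (h₃ := h₃),
    Pi.add_apply, Pi.smul_apply, ev_add, ev_smul]
  have : cup (delta ψ h₂ y) φ h₃ = cup (diff (ψ y) h₂) φ h₃ + cup (lact ψ h₂) φ h₃ :=
    cup_add_left ..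
  rw [this, ev_add]
  abel

theorem cup_multilinear {x : C.Obj} {e : ℤ} {t : k} {c₁ c₂ c₃ : Chain C x y e}
    (S : Chain.SlotLin t c₁ c₂ c₃) : ∀ {W : D.Obj} {d₂ d r : ℤ} {ψ : Raw G W y d₂}
    {φ : ∀ y, Raw F (G.obj y) y d₁} (_ : Multilinear ψ) (_ : ∀ y, Multilinear (φ y))
    (hd : d₂ + d₁ = d) (h : e + d = r),
    (cup ψ φ hd).ev h c₃ = t • (cup ψ φ hd).ev h c₁ + (cup ψ φ hd).ev h c₂ := by
  induction S with
  | @head y z a e e' f g c h' =>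
    intro W d₂ d r ψ φ hψ hφ hd h
    rw [cup_cons (hs := rfl) (ht := rfl), cup_cons (hs := rfl) (ht := rfl),
      cup_cons (hs := rfl) (ht := rfl), ev_pcomp', ev_pcomp', ev_pcomp',
      hφ _ _ (.head _ _ _ _), hψ.freeze_lin, cup_lin, map_add, map_smul]
    module
  | @tail y z a e e' f c₁ c₂ c₃ h' S ih =>
    intro W d₂ d r ψ φ hψ hφ hd h
    rw [cup_cons (hs := rfl) (ht := rfl), cup_cons (hs := rfl) (ht := rfl),
      cup_cons (hs := rfl) (ht := rfl), ev_pcomp', ev_pcomp', ev_pcomp',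
      hφ _ _ (.tail _ _ S), ih (hψ.freeze _ _) hφ, map_add, map_smul]
    module

theorem cup_normalized {x : C.Obj} {e : ℤ} {c : Chain C x y e}
    (S : Chain.HasId c) : ∀ {W : D.Obj} {d₂ d r : ℤ} {ψ : Raw G W y d₂}
    {φ : ∀ y, Raw F (G.obj y) y d₁} (_ : Normalized ψ) (_ : ∀ y, Normalized (φ y))
    (hd : d₂ + d₁ = d) (h : e + d = r), (cup ψ φ hd).ev h c = 0 := by
  induction S with
  | @head y e e' c h' =>
    intro W d₂ d r ψ φ hψ hφ hd h
    rw [cup_cons (hs := rfl) (ht := rfl), ev_pcomp', hφ _ _ (.head _ _), hψ.freeze_id,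
      cup_zero_left, ev_zero, map_zero, smul_zero, add_zero]
  | @tail y z a e e' f c h' S ih =>
    intro W d₂ d r ψ φ hψ hφ hd h
    rw [cup_cons (hs := rfl) (ht := rfl), ev_pcomp', hφ _ _ (.tail _ _ S),
      ih (hψ.freeze _ _) hφ, map_zero, smul_zero, add_zero]

end cup

/-- The family with `id_{F X}` in arity `0` and zero in all other arities. -/
def one (F : DGFunctor C D) (y : C.Obj) : Raw F (F.obj y) y 0 := fun _ _ c =>
  match c with
  | .nil _ => D.id _
  | .cons _ _ _ => 0

theorem ev_one_nil {r : ℤ} (h : 0 + 0 = r) (h' : 0 = r) :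
    (one F y).ev h (.nil y) = h' ▸ D.id (F.obj y) := by
  subst h; rfl

theorem ev_one_cons {x : C.Obj} {a e e' r : ℤ} (f : C.Hom y z a) (c : Chain C x y e)
    (h' : a - 1 + e = e') (h : e' + 0 = r) : (one F z).ev h (.cons f c h') = 0 := by
  subst h; rfl

theorem freeze_one {a s : ℤ} (f : C.Hom y z a) (h : a - 1 + 0 = s) :
    freeze (one F z) f h = 0 := by
  refine ext_ev fun {x e r} h c => ?_
  rw [ev_freeze', ev_one_cons, ev_zero]

theorem one_multilinear : Multilinear (one F y) := by
  intro x e r h t c₁ c₂ c₃ S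
  cases S <;> simp [ev_one_cons]

theorem one_normalized : Normalized (one F y) := by
  intro x e r h c S
  cases S <;> simp [ev_one_cons]

theorem one_cup (φ : ∀ y, Raw F (G.obj y) y d) (hd : 0 + d = d) : cup (one G y) φ hd = φ y := by
  refine ext_ev fun {x e r} h c => ?_
  subst h
  cases c with
  | nil =>
    rw [cup_nil, ev_pcomp', ev_one_nil _ rfl]
    exact D.id_comp _
  | cons f c h' =>
    rw [cup_cons (hs := rfl) (ht := rfl), ev_pcomp', ev_one_nil _ rfl, freeze_one, cup_zero_left,
      ev_zero, smul_zero, add_zero]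
    exact D.id_comp _

theorem cup_one {x : C.Obj} {e : ℤ} (c : Chain C x y e) : ∀ {W : D.Obj} {d r : ℤ}
    (ψ : Raw F W y d) (hd : d + 0 = d) (h : e + d = r), (cup ψ (one F) hd).ev h c = ψ.ev h c := by
  induction c with
  | nil =>
    intro W d r ψ hd h
    obtain rfl : d = r := by omega
    rw [cup_nil, ev_pcomp (hs := rfl), ev_one_nil _ rfl]
    exact D.comp_id _
  | @cons y z a e e' f c h' ih =>
    intro W d r ψ hd h
    rw [cup_cons (s := a - 1 + d) (t := a - 1 + d) (hs := rfl) (ht := by omega), ih, ev_pcomp',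
      ev_one_cons, map_zero, zero_add, zero_mul, sgn_zero, one_smul, ev_freeze]

end Raw
theorem Raw.lact_lin {F G : DGFunctor C D} {d d' : ℤ} (ψ φ : ∀ y, Raw F (G.obj y) y d) (t : k)
    (hd : d + 1 = d') (y : C.Obj) : (Raw.lact (t • ψ + φ) hd : Raw F (G.obj y) y d') =
      t • Raw.lact ψ hd + Raw.lact φ hd := by
  refine Raw.ext_ev fun {x e r} h c => ?_
  rw [Raw.ev_add, Raw.ev_smul]
  cases c with
  | nil => simp [Raw.lact_nil]
  | cons f c h' =>
    rw [Raw.lact_cons (hs := rfl), Raw.lact_cons (hs := rfl), Raw.lact_cons (hs := rfl),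
      Raw.ev_pcomp', Raw.ev_pcomp', Raw.ev_pcomp', Pi.add_apply, Pi.smul_apply, Raw.ev_add,
      Raw.ev_smul, map_add, map_smul]
    module

theorem Raw.delta_lin {F G : DGFunctor C D} {d d' : ℤ} (ψ φ : ∀ y, Raw F (G.obj y) y d) (t : k)
    (hd : d + 1 = d') : Raw.delta (t • ψ + φ) hd = t • Raw.delta ψ hd + Raw.delta φ hd := by
  funext y
  have h₁ : Raw.diff (t • ψ y + φ y) hd = t • Raw.diff (ψ y) hd + Raw.diff (φ y) hd :=
    Raw.diff_lin' ..
  have h₂ := Raw.lact_lin ψ φ t hd y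
  change Raw.diff (t • ψ y + φ y) hd + Raw.lact (t • ψ + φ) hd =
    t • (Raw.diff (ψ y) hd + Raw.lact ψ hd) + (Raw.diff (φ y) hd + Raw.lact φ hd)
  rw [h₁, h₂]
  module

theorem Raw.delta_add {F G : DGFunctor C D} {d d' : ℤ} (ψ φ : ∀ y, Raw F (G.obj y) y d)
    (hd : d + 1 = d') : Raw.delta (ψ + φ) hd = Raw.delta ψ hd + Raw.delta φ hd := by
  simpa using Raw.delta_lin ψ φ 1 hd

theorem Raw.delta_smul {F G : DGFunctor C D} {d d' : ℤ} (ψ : ∀ y, Raw F (G.obj y) y d) (t : k)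
    (hd : d + 1 = d') : Raw.delta (t • ψ) hd = t • Raw.delta ψ hd := by
  have h0 := Raw.delta_lin (0 : ∀ y, Raw F (G.obj y) y d) 0 1 hd
  have h1 := Raw.delta_lin ψ 0 t hd
  simp only [smul_zero, add_zero, one_smul, left_eq_add] at h0
  rw [h0, add_zero, add_zero] at h1
  exact h1

/-- The cochains `Ψ : F ⟶ G` of total degree `n`: the families
`Ψ(fₘ, …, f₁) ∈ D(F X₀, G Xₘ)`, `m ≥ 0`, linear in every argument, which vanish whenever some
`fᵢ` is an identity morphism. -/
def cochains (F G : DGFunctor C D) (n : ℤ) : Submodule k (∀ y, Raw F (G.obj y) y n) where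
  carrier := {ψ | ∀ y, (ψ y).Multilinear ∧ (ψ y).Normalized}
  add_mem' := fun h h' y => ⟨Raw.add_multilinear (h y).1 (h' y).1,
    Raw.add_normalized (h y).2 (h' y).2⟩
  zero_mem' := fun _ => ⟨Raw.zero_multilinear, Raw.zero_normalized⟩
  smul_mem' := fun t _ h y => ⟨Raw.smul_multilinear (h y).1 t, Raw.smul_normalized (h y).2 t⟩

namespace Coh

/-- The total differential on cochains. -/
def d {F G : DGFunctor C D} {p q : ℤ} (h : p + 1 = q) : cochains F G p →ₗ[k] cochains F G q where
  toFun := fun ψ => ⟨Raw.delta ψ.1 h, fun y =>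
    ⟨Raw.delta_multilinear (fun y => (ψ.2 y).1) h y,
      Raw.delta_normalized (fun y => (ψ.2 y).1) (fun y => (ψ.2 y).2) h y⟩⟩
  map_add' := fun ψ φ => Subtype.ext (Raw.delta_add ψ.1 φ.1 h)
  map_smul' := fun t ψ => Subtype.ext (Raw.delta_smul ψ.1 t h)

/-- The cup product of cochains. -/
def cup {F G H : DGFunctor C D} {p q r : ℤ} (h : p + q = r) :
    cochains G H p →ₗ[k] cochains F G q →ₗ[k] cochains F H r :=
  LinearMap.mk₂ k
    (fun ψ φ => ⟨fun y => Raw.cup (ψ.1 y) φ.1 h, fun y =>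
      ⟨fun _ _ _ _ _ _ _ _ S =>
        Raw.cup_multilinear S (ψ.2 y).1 (fun y => (φ.2 y).1) h _,
      fun _ _ _ _ _ S => Raw.cup_normalized S (ψ.2 y).2 (fun y => (φ.2 y).2) h _⟩⟩)
    (fun ψ ψ' φ => Subtype.ext (funext fun y => Raw.cup_add_left (ψ.1 y) (ψ'.1 y) φ.1 h))
    (fun t ψ φ => Subtype.ext (funext fun y => Raw.cup_smul_left (ψ.1 y) φ.1 t h))
    (fun ψ φ φ' => Subtype.ext (funext fun y => Raw.cup_add_right (ψ.1 y) φ.1 φ'.1 h))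
    (fun t ψ φ => Subtype.ext (funext fun y => Raw.cup_smul_right (ψ.1 y) φ.1 t h))

end Coh

/-- The dg category of dg functors `C ⟶ D` and cochains (coherent natural transformations); the
composition is the cup product. -/
def Coh (C D : DGCat k) : DGCat k where
  Obj := DGFunctor C D
  Hom F G n := cochains F G n
  id F := ⟨Raw.one F, fun _ => ⟨Raw.one_multilinear, Raw.one_normalized⟩⟩
  comp h := Coh.cup h
  d h := Coh.d h
  id_comp f := Subtype.ext (funext fun _ => Raw.one_cup f.1 (zero_add _))
  comp_id f := Subtype.ext (funext fun y => Raw.ext_ev fun h c =>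
    Raw.cup_one c (f.1 y) (add_zero _) h)
  assoc hpq hqr h h' f₃ f₂ f₁ := Subtype.ext (funext fun y => Raw.ext_ev fun l c =>
    Raw.cup_assoc c (f₃.1 y) f₂.1 f₁.1 hpq h hqr h' l)
  d_d h h' f := Subtype.ext (Raw.delta_delta (fun y => (f.2 y).1) h h')
  leibniz h hp hq hr h₁ h₂ g f := Subtype.ext (Raw.delta_cup g.1 f.1 h hr hp h₁ hq h₂)

/-- The value `Ψ(fₙ, …, f₁)` of a cochain. -/
def Coh.ap {F G : DGFunctor C D} {n : ℤ} (ψ : (Coh C D).Hom F G n) {x y : C.Obj} {e r : ℤ}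
    (c : Chain C x y e) (h : e + n = r) : D.Hom (F.obj x) (G.obj y) r :=
  (ψ.1 y).ev h c
namespace Raw

/-- The family `(fₙ, …, f₁) ↦ G(Ψ(fₙ, …, f₁))`. -/
def push (G : DGFunctor D E) {F : DGFunctor C D} {W : D.Obj} {y : C.Obj} {d : ℤ}
    (ψ : Raw F W y d) : Raw (G.comp F) (G.obj W) y d := fun x e c => G.map (ψ x e c)

section push
variable {F F' F'' : DGFunctor C D} {W : D.Obj} {y z : C.Obj} {d : ℤ} (G : DGFunctor D E)

theorem ev_push (ψ : Raw F W y d) {x : C.Obj} {e r : ℤ} (h : e + d = r) (c : Chain C x y e) :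
    (push G ψ).ev h c = G.map (ψ.ev h c) := by
  subst h; rfl

theorem push_multilinear {ψ : Raw F W y d} (hψ : Multilinear ψ) : Multilinear (push G ψ) := by
  intro x e r h t c₁ c₂ c₃ S
  rw [ev_push, ev_push, ev_push, hψ h S, map_add, map_smul]

theorem push_normalized {ψ : Raw F W y d} (hψ : Normalized ψ) : Normalized (push G ψ) := by
  intro x e r h c S
  rw [ev_push, hψ h S, map_zero]

theorem push_delta (ψ : ∀ y, Raw F (F'.obj y) y d) {d' : ℤ} (hd : d + 1 = d') (y : C.Obj) :
    push G (delta ψ hd y) = delta (G := G.comp F') (fun y => push G (ψ y)) hd y := by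
  refine ext_ev fun {x e r} h c => ?_
  have e₁ : ∀ {p q : ℤ} (h : p + 1 = q) {x y : D.Obj} (f : D.Hom x y p),
      G.map (D.d h f) = E.d h (G.map f) := fun h _ _ f =>
    G.toMaps.map_d h f
  have e₂ : ∀ {p q r : ℤ} (h : p + q = r) {x y z : D.Obj} (g : D.Hom y z p) (f : D.Hom x y q),
      G.map (D.comp h g f) = E.comp h (G.map g) (G.map f) := fun h _ _ _ g f =>
    G.toMaps.map_comp h g f
  rw [ev_push, ev_delta, ev_delta, ev_diff, ev_diff, ev_lact, ev_lact]
  simp only [map_add, map_sub, map_smul, map_list_sum, List.map_map, e₁, ev_push]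
  congr! <;> simp [e₂] <;> rfl

theorem push_cup {d₁ d₂ : ℤ} (ψ : Raw F' W y d₂) (φ : ∀ y, Raw F (F'.obj y) y d₁)
    (hd : d₂ + d₁ = d) :
    push G (cup ψ φ hd) = cup (G := G.comp F') (push G ψ) (fun y => push G (φ y)) hd := by
  refine ext_ev fun {x e r} h c => ?_
  have e₂ : ∀ {p q r : ℤ} (h : p + q = r) {x y z : D.Obj} (g : D.Hom y z p) (f : D.Hom x y q),
      G.map (D.comp h g f) = E.comp h (G.map g) (G.map f) := fun h _ _ _ g f =>
    G.toMaps.map_comp h g f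
  rw [ev_push, ev_cup, ev_cup]
  simp only [map_list_sum, List.map_map]
  congr! 2
  simp [Function.comp_def, e₂, ev_push]

theorem push_one (y : C.Obj) : push G (one F y) = one (G.comp F) y := by
  funext x e c
  cases c with
  | nil => exact G.toMaps.map_id _
  | cons f c h => exact map_zero _

end push
end Raw

/-- The linear map `Ψ ↦ ((fₙ, …, f₁) ↦ G(Ψ(fₙ, …, f₁)))` on cochains. -/
def Coh.push (G : DGFunctor D E) {F F' : DGFunctor C D} {n : ℤ} :
    cochains F F' n →ₗ[k] cochains (G.comp F) (G.comp F') n where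
  toFun := fun ψ => ⟨fun y => Raw.push G (ψ.1 y), fun y => ⟨Raw.push_multilinear G (ψ.2 y).1,
    Raw.push_normalized G (ψ.2 y).2⟩⟩
  map_add' := fun ψ φ => Subtype.ext (by funext y x e c; exact map_add G.map _ _)
  map_smul' := fun t ψ => Subtype.ext (by funext y x e c; exact map_smul G.map _ _)

/-- Composition with a dg functor `G : C ⟶ D`: `F ↦ G ∘ F` on objects and
`Ψ ↦ ((fₙ, …, f₁) ↦ G(Ψ(fₙ, …, f₁)))` on cochains. -/
def post (B : DGCat k) (G : DGFunctor C D) : DGFunctor (Coh B C) (Coh B D) where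
  obj F := G.comp F
  toMaps :=
    { map := Coh.push G
      map_id := fun _ => Subtype.ext (by funext y; exact Raw.push_one G y)
      map_comp := fun h g f => Subtype.ext (by funext y; exact Raw.push_cup G (g.1 y) f.1 h)
      map_d := fun h f => Subtype.ext (by funext y; exact Raw.push_delta G f.1 h y) }
/-- The list of all signed chains
`(F_k(f_N), …, Ψ_k(…), …, F₁(…), …, Ψ₁(…), F₀(…), …, F₀(f₁))`
obtained from `P = (Ψ_k, …, Ψ₁)`, `Ψ_s : F_{s-1} ⟶ F_s`, and `c = (f_N, …, f₁)` by choosing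
disjoint, possibly empty, blocks of consecutive arguments (in the given order), applying `Ψ_s` to
the `s`-th block, and applying the dg functors `F_s` to every argument between the blocks `s`
and `s + 1`.  The sign is `(-1)^(∑ₛ (|Ψₛ| - 1) ∑ⱼ (|fⱼ| + 1))`, where `j` runs through the
arguments to the left of the `s`-th block. -/
def braceTerms {A B : DGCat k} {F : DGFunctor A B} :
    ∀ {F' : DGFunctor A B} {p : ℤ}, Chain (Coh A B) F F' p →
    ∀ {x y : A.Obj} {e : ℤ}, Chain A x y e → List (k × Chain B (F.obj x) (F'.obj y) (e + p))
  | _, _, .nil _, _, _, e, c => [(1, (c.map F).cast (add_zero e).symm)]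
  | F', _, .cons (a := a) (e := p) Ψ P _, _, _, _, c =>
    c.splits.flatMap fun s => s.right.splits.flatMap fun t =>
      (braceTerms P t.right).map fun w =>
        (sgn k ((a - 1) * s.e₁) * sgn k (p * (s.e₁ + t.e₁)) * w.1,
          (Chain.cons (Coh.ap Ψ t.left rfl) w.2 rfl).append (s.left.map F')
            (by have := s.h; have := t.h; omega))

/-- The value `Θ{Ψ_k, …, Ψ₁}(f_N, …, f₁)` of the brace operation. -/
def brace {A B C : DGCat k} {G G' : DGFunctor B C} {F F' : DGFunctor A B} {n p : ℤ}
    (Θ : (Coh B C).Hom G G' n) (P : Chain (Coh A B) F F' p) {x y : A.Obj} {e r : ℤ}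
    (c : Chain A x y e) (h : e + (n + p) = r) : C.Hom (G.obj (F.obj x)) (G'.obj (F'.obj y)) r :=
  ((braceTerms P c).map fun w => w.1 • Coh.ap Θ w.2 (by omega)).sum
namespace Twist

/-- The expressions for morphisms of the twisted tensor product: built from the generators
`ε(f; g₁, …, gₙ)` (where `(gₙ, …, g₁)` is the given chain; for `n = 0` this is `f ⊗ id`) and
`id ⊗ g` by means of the operations of a dg category. -/
inductive Pre (C D : DGCat k) : C.Obj × D.Obj → C.Obj × D.Obj → ℤ → Type u
  | eps {x x' : C.Obj} {y y' : D.Obj} {a e n : ℤ} (f : C.Hom x x' a) (c : Chain D y y' e)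
      (h : a + e = n) : Pre C D (x, y) (x', y') n
  | right (x : C.Obj) {y y' : D.Obj} {n : ℤ} (g : D.Hom y y' n) : Pre C D (x, y) (x, y') n
  | id (X : C.Obj × D.Obj) : Pre C D X X 0
  | comp {X Y Z : C.Obj × D.Obj} {p q r : ℤ} (h : p + q = r) (g : Pre C D Y Z p)
      (f : Pre C D X Y q) : Pre C D X Z r
  | zero (X Y : C.Obj × D.Obj) (n : ℤ) : Pre C D X Y n
  | add {X Y : C.Obj × D.Obj} {n : ℤ} (f g : Pre C D X Y n) : Pre C D X Y n
  | smul {X Y : C.Obj × D.Obj} {n : ℤ} (t : k) (f : Pre C D X Y n) : Pre C D X Y n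
  | d {X Y : C.Obj × D.Obj} {p q : ℤ} (h : p + 1 = q) (f : Pre C D X Y p) : Pre C D X Y q

namespace Pre
variable {C D : DGCat k}

/-- The sum of a list of expressions. -/
def sum {X Y : C.Obj × D.Obj} {n : ℤ} : List (Pre C D X Y n) → Pre C D X Y n
  | [] => zero X Y n
  | f :: l => add f (sum l)

/-- The linear combination `∑ tᵢ ε(f; cᵢ)`. -/
def epsSum {x x' : C.Obj} {y y' : D.Obj} {a e n : ℤ} (f : C.Hom x x' a)
    (l : List (k × Chain D y y' e)) (h : a + e = n) : Pre C D (x, y) (x', y') n :=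
  sum (l.map fun t => smul t.1 (eps f t.2 h))

/-- The relations of the twisted tensor product. -/
inductive Rel : ∀ {X Y : C.Obj × D.Obj} {n : ℤ}, Pre C D X Y n → Pre C D X Y n → Prop
  -- `Rel` is an equivalence relation, compatible with all the operations
  | refl {X Y : C.Obj × D.Obj} {n : ℤ} (f : Pre C D X Y n) : Rel f f
  | symm {X Y : C.Obj × D.Obj} {n : ℤ} {f g : Pre C D X Y n} (H : Rel f g) : Rel g f
  | trans {X Y : C.Obj × D.Obj} {n : ℤ} {f g h : Pre C D X Y n} (H : Rel f g) (H' : Rel g h) :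
      Rel f h
  | comp_congr {X Y Z : C.Obj × D.Obj} {p q r : ℤ} (h : p + q = r) {g g' : Pre C D Y Z p}
      {f f' : Pre C D X Y q} (H : Rel g g') (H' : Rel f f') : Rel (comp h g f) (comp h g' f')
  | add_congr {X Y : C.Obj × D.Obj} {n : ℤ} {f f' g g' : Pre C D X Y n} (H : Rel f f')
      (H' : Rel g g') : Rel (add f g) (add f' g')
  | smul_congr {X Y : C.Obj × D.Obj} {n : ℤ} (t : k) {f f' : Pre C D X Y n} (H : Rel f f') :
      Rel (smul t f) (smul t f')
  | d_congr {X Y : C.Obj × D.Obj} {p q : ℤ} (h : p + 1 = q) {f f' : Pre C D X Y p}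
      (H : Rel f f') : Rel (d h f) (d h f')
  -- the axioms of a dg category
  | add_assoc {X Y : C.Obj × D.Obj} {n : ℤ} (f g h : Pre C D X Y n) :
      Rel (add (add f g) h) (add f (add g h))
  | add_comm {X Y : C.Obj × D.Obj} {n : ℤ} (f g : Pre C D X Y n) : Rel (add f g) (add g f)
  | zero_add {X Y : C.Obj × D.Obj} {n : ℤ} (f : Pre C D X Y n) : Rel (add (zero X Y n) f) f
  | neg_add {X Y : C.Obj × D.Obj} {n : ℤ} (f : Pre C D X Y n) :
      Rel (add (smul (-1) f) f) (zero X Y n)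
  | smul_add {X Y : C.Obj × D.Obj} {n : ℤ} (t : k) (f g : Pre C D X Y n) :
      Rel (smul t (add f g)) (add (smul t f) (smul t g))
  | add_smul {X Y : C.Obj × D.Obj} {n : ℤ} (t s : k) (f : Pre C D X Y n) :
      Rel (smul (t + s) f) (add (smul t f) (smul s f))
  | mul_smul {X Y : C.Obj × D.Obj} {n : ℤ} (t s : k) (f : Pre C D X Y n) :
      Rel (smul (t * s) f) (smul t (smul s f))
  | one_smul {X Y : C.Obj × D.Obj} {n : ℤ} (f : Pre C D X Y n) : Rel (smul 1 f) f
  | add_comp {X Y Z : C.Obj × D.Obj} {p q r : ℤ} (h : p + q = r) (g g' : Pre C D Y Z p)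
      (f : Pre C D X Y q) : Rel (comp h (add g g') f) (add (comp h g f) (comp h g' f))
  | smul_comp {X Y Z : C.Obj × D.Obj} {p q r : ℤ} (h : p + q = r) (t : k) (g : Pre C D Y Z p)
      (f : Pre C D X Y q) : Rel (comp h (smul t g) f) (smul t (comp h g f))
  | comp_add {X Y Z : C.Obj × D.Obj} {p q r : ℤ} (h : p + q = r) (g : Pre C D Y Z p)
      (f f' : Pre C D X Y q) : Rel (comp h g (add f f')) (add (comp h g f) (comp h g f'))
  | comp_smul {X Y Z : C.Obj × D.Obj} {p q r : ℤ} (h : p + q = r) (t : k) (g : Pre C D Y Z p)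
      (f : Pre C D X Y q) : Rel (comp h g (smul t f)) (smul t (comp h g f))
  | id_comp {X Y : C.Obj × D.Obj} {p : ℤ} (f : Pre C D X Y p) :
      Rel (comp (_root_.zero_add p) (id Y) f) f
  | comp_id {X Y : C.Obj × D.Obj} {p : ℤ} (f : Pre C D X Y p) :
      Rel (comp (add_zero p) f (id X)) f
  | assoc {W X Y Z : C.Obj × D.Obj} {p q r pq qr s : ℤ} (hpq : p + q = pq) (hqr : q + r = qr)
      (h : pq + r = s) (h' : p + qr = s) (f₃ : Pre C D Y Z p) (f₂ : Pre C D X Y q)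
      (f₁ : Pre C D W X r) : Rel (comp h (comp hpq f₃ f₂) f₁) (comp h' f₃ (comp hqr f₂ f₁))
  | d_add {X Y : C.Obj × D.Obj} {p q : ℤ} (h : p + 1 = q) (f g : Pre C D X Y p) :
      Rel (d h (add f g)) (add (d h f) (d h g))
  | d_smul {X Y : C.Obj × D.Obj} {p q : ℤ} (h : p + 1 = q) (t : k) (f : Pre C D X Y p) :
      Rel (d h (smul t f)) (smul t (d h f))
  | d_d {X Y : C.Obj × D.Obj} {p q r : ℤ} (h : p + 1 = q) (h' : q + 1 = r)
      (f : Pre C D X Y p) : Rel (d h' (d h f)) (zero X Y r)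
  | leibniz {X Y Z : C.Obj × D.Obj} {p q r p' q' r' : ℤ} (h : p + q = r) (hp : p + 1 = p')
      (hq : q + 1 = q') (hr : r + 1 = r') (h₁ : p' + q = r') (h₂ : p + q' = r')
      (g : Pre C D Y Z p) (f : Pre C D X Y q) :
      Rel (d hr (comp h g f)) (add (comp h₁ (d hp g) f) (smul (sgn k p) (comp h₂ g (d hq f))))
  -- `g ↦ id ⊗ g` is a dg functor for every object of `C`
  | right_lin (x : C.Obj) {y y' : D.Obj} {n : ℤ} (t : k) (g g' : D.Hom y y' n) :
      Rel (right x (t • g + g')) (add (smul t (right x g)) (right x g'))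
  | right_id (x : C.Obj) (y : D.Obj) : Rel (right x (D.id y)) (id (x, y))
  | right_comp (x : C.Obj) {y y' y'' : D.Obj} {p q r : ℤ} (h : p + q = r) (g' : D.Hom y' y'' p)
      (g : D.Hom y y' q) : Rel (right x (D.comp h g' g)) (comp h (right x g') (right x g))
  | right_d (x : C.Obj) {y y' : D.Obj} {p q : ℤ} (h : p + 1 = q) (g : D.Hom y y' p) :
      Rel (d h (right x g)) (right x (D.d h g))
  -- `ε(f; g₁, …, gₙ)` is linear in each argument
  | eps_lin {x x' : C.Obj} {y y' : D.Obj} {a e n : ℤ} (t : k) (f f' : C.Hom x x' a)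
      (c : Chain D y y' e) (h : a + e = n) :
      Rel (eps (t • f + f') c h) (add (smul t (eps f c h)) (eps f' c h))
  | eps_slotLin {x x' : C.Obj} {y y' : D.Obj} {a e n : ℤ} (f : C.Hom x x' a) {t : k}
      {c₁ c₂ c₃ : Chain D y y' e} (H : Chain.SlotLin t c₁ c₂ c₃) (h : a + e = n) :
      Rel (eps f c₃ h) (add (smul t (eps f c₁ h)) (eps f c₂ h))
  -- identity morphisms as arguments
  | eps_id_nil (x : C.Obj) (y : D.Obj) (h : 0 + 0 = (0 : ℤ)) :
      Rel (eps (C.id x) (Chain.nil y) h) (id (x, y))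
  | eps_id_cons (x : C.Obj) {y y' y'' : D.Obj} {b e e' n : ℤ} (g : D.Hom y' y'' b)
      (c : Chain D y y' e) (h' : b - 1 + e = e') (h : 0 + e' = n) :
      Rel (eps (C.id x) (Chain.cons g c h') h) (zero (x, y) (x, y'') n)
  | eps_hasId {x x' : C.Obj} {y y' : D.Obj} {a e n : ℤ} (f : C.Hom x x' a) {c : Chain D y y' e}
      (H : Chain.HasId c) (h : a + e = n) : Rel (eps f c h) (zero (x, y) (x', y') n)
  -- `ε(f₂ ∘ f₁; g₁, …, gₙ)
  --   = ∑ₘ (-1)^(|f₁| ∑_{j>m} (|gⱼ|+1)) ε(f₂; gₘ₊₁, …, gₙ) ∘ ε(f₁; g₁, …, gₘ)`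
  | eps_comp {x x' x'' : C.Obj} {y y' : D.Obj} {a₂ a₁ a e n : ℤ} (f₂ : C.Hom x' x'' a₂)
      (f₁ : C.Hom x x' a₁) (c : Chain D y y' e) (ha : a₂ + a₁ = a) (h : a + e = n) :
      Rel (eps (C.comp ha f₂ f₁) c h)
        (sum (c.splits.map fun s => smul (sgn k (a₁ * s.e₁))
          (comp (by have := s.h; omega) (eps f₂ s.left rfl) (eps f₁ s.right rfl))))
  -- `dε(f; g₁, …, gₙ) = ε(df; g₁, …, gₙ)
  --   - (-1)^|f| ∑ᵢ (-1)^(∑_{j>i} (|gⱼ|+1)) ε(f; g₁, …, dgᵢ, …, gₙ)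
  --   - (-1)^|f| ∑ᵢ (-1)^(∑_{j>i} (|gⱼ|+1)) ε(f; g₁, …, gᵢ₊₁ ∘ gᵢ, …, gₙ)
  --   + (-1)^|f| (-1)^(∑_{j>1} (|gⱼ|+1)) ε(f; g₂, …, gₙ) ∘ (id ⊗ g₁)
  --   - (-1)^(|f|(|gₙ|+1)) (id ⊗ gₙ) ∘ ε(f; g₁, …, gₙ₋₁)`
  | d_eps {x x' : C.Obj} {y y' : D.Obj} {a a' e n n' : ℤ} (f : C.Hom x x' a) (c : Chain D y y' e)
      (h : a + e = n) (hn : n + 1 = n') (ha : a + 1 = a') :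
      Rel (d hn (eps f c h))
        (sum [eps (C.d ha f) c (by omega),
          smul (-sgn k a) (epsSum f c.dTerms (by omega)),
          smul (-sgn k a) (epsSum f c.mTerms (by omega)),
          smul (sgn k a) (sum (c.lasts.map fun s => smul (sgn k s.e₁)
            (comp (by have := s.h; omega) (eps f s.init rfl) (right x s.f)))),
          smul (-1) (sum (c.heads.map fun s => smul (sgn k (a * (s.a - 1)))
            (comp (by have := s.h; omega) (right x' s.f) (eps f s.tail rfl))))])

end Pre

/-- The morphisms of the twisted tensor product. -/
def Hom (C D : DGCat k) (X Y : C.Obj × D.Obj) (n : ℤ) : Type u :=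
  Quot (Pre.Rel : Pre C D X Y n → Pre C D X Y n → Prop)

namespace Hom
variable {C D : DGCat k} {X Y Z : C.Obj × D.Obj} {n p q r : ℤ}

instance : Zero (Hom C D X Y n) := ⟨Quot.mk _ (.zero X Y n)⟩
instance : Add (Hom C D X Y n) :=
  ⟨Quot.map₂ .add (fun _ _ _ H => .add_congr (.refl _) H) fun _ _ _ H => .add_congr H (.refl _)⟩
instance : SMul k (Hom C D X Y n) := ⟨fun t => Quot.map (.smul t) fun _ _ H => .smul_congr t H⟩
instance : Neg (Hom C D X Y n) := ⟨fun f => (-1 : k) • f⟩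

instance : AddCommGroup (Hom C D X Y n) :=
  { AddGroup.ofLeftAxioms
      (by rintro ⟨f⟩ ⟨g⟩ ⟨h⟩; exact Quot.sound (.add_assoc f g h))
      (by rintro ⟨f⟩; exact Quot.sound (.zero_add f))
      (by rintro ⟨f⟩; exact Quot.sound (.neg_add f)) with
    add_comm := by rintro ⟨f⟩ ⟨g⟩; exact Quot.sound (.add_comm f g) }

instance : Module k (Hom C D X Y n) :=
  Module.ofMinimalAxioms
    (by rintro t ⟨f⟩ ⟨g⟩; exact Quot.sound (.smul_add t f g))
    (by rintro t s ⟨f⟩; exact Quot.sound (.add_smul t s f))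
    (by rintro t s ⟨f⟩; exact Quot.sound (.mul_smul t s f))
    (by rintro ⟨f⟩; exact Quot.sound (.one_smul f))

/-- The composition. -/
def comp (h : p + q = r) : Hom C D Y Z p →ₗ[k] Hom C D X Y q →ₗ[k] Hom C D X Z r :=
  LinearMap.mk₂ k
    (Quot.map₂ (.comp h) (fun _ _ _ H => .comp_congr h (.refl _) H)
      fun _ _ _ H => .comp_congr h H (.refl _))
    (by rintro ⟨g⟩ ⟨g'⟩ ⟨f⟩; exact Quot.sound (.add_comp h g g' f))
    (by rintro t ⟨g⟩ ⟨f⟩; exact Quot.sound (.smul_comp h t g f))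
    (by rintro ⟨g⟩ ⟨f⟩ ⟨f'⟩; exact Quot.sound (.comp_add h g f f'))
    (by rintro t ⟨g⟩ ⟨f⟩; exact Quot.sound (.comp_smul h t g f))

/-- The differential. -/
def d (h : p + 1 = q) : Hom C D X Y p →ₗ[k] Hom C D X Y q where
  toFun := Quot.map (.d h) fun _ _ H => .d_congr h H
  map_add' := by rintro ⟨f⟩ ⟨g⟩; exact Quot.sound (.d_add h f g)
  map_smul' := by rintro t ⟨f⟩; exact Quot.sound (.d_smul h t f)

end Hom
end Twist

/-- The twisted tensor product of `C` and `D`: the dg category with objects `Ob C × Ob D`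
presented by the generators and relations above. -/
def Twist (C D : DGCat k) : DGCat k where
  Obj := C.Obj × D.Obj
  Hom := Twist.Hom C D
  id X := Quot.mk _ (.id X)
  comp h := Twist.Hom.comp h
  d h := Twist.Hom.d h
  id_comp := by rintro X Y p ⟨f⟩; exact Quot.sound (.id_comp f)
  comp_id := by rintro X Y p ⟨f⟩; exact Quot.sound (.comp_id f)
  assoc := by
    rintro W X Y Z p q r pq qr s hpq hqr h h' ⟨f₃⟩ ⟨f₂⟩ ⟨f₁⟩
    exact Quot.sound (.assoc hpq hqr h h' f₃ f₂ f₁)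
  d_d := by rintro X Y p q r h h' ⟨f⟩; exact Quot.sound (.d_d h h' f)
  leibniz := by
    rintro X Y Z p q r p' q' r' h hp hq hr h₁ h₂ ⟨g⟩ ⟨f⟩
    exact Quot.sound (.leibniz h hp hq hr h₁ h₂ g f)

/-- The morphism `ε(f; g₁, …, gₙ)`, where `(gₙ, …, g₁)` is the given chain. -/
def Twist.eps {C D : DGCat k} {x x' : C.Obj} {y y' : D.Obj} {a e n : ℤ} (f : C.Hom x x' a)
    (c : Chain D y y' e) (h : a + e = n) : (Twist C D).Hom (x, y) (x', y') n :=
  Quot.mk _ (.eps f c h)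

/-- The morphism `id ⊗ g`. -/
def Twist.right {C D : DGCat k} (x : C.Obj) {y y' : D.Obj} {n : ℤ} (g : D.Hom y y' n) :
    (Twist C D).Hom (x, y) (x, y') n :=
  Quot.mk _ (.right x g)



/-- The composite `G ∘ F`, as an object of `Coh(A, C)`. -/
def compObj {A B C : DGCat k} (G : (Coh B C).Obj) (F : (Coh A B).Obj) : (Coh A C).Obj :=
  DGFunctor.comp G F

/-- The dg functors `Coh(B, C) ⊗̃ Coh(A, B) ⟶ Coh(A, C)` given by `(G, F) ↦ G ∘ F` on objects. -/
abbrev TwistMaps (A B C : DGCat k) : Type u :=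
  DGMaps (Twist (Coh B C) (Coh A B)) (Coh A C) fun X => compObj X.1 X.2

namespace TwistMaps
variable {A B C : DGCat k} (m : TwistMaps A B C)

/-- The image `m(ε(Θ; Ψ₁, …, Ψ_k))`, where `P = (Ψ_k, …, Ψ₁)`; for `k = 0` this is
`m(Θ ⊗ id_F)`. -/
def eps {G G' : (Coh B C).Obj} {F F' : (Coh A B).Obj} {n p q : ℤ} (Θ : (Coh B C).Hom G G' n)
    (P : Chain (Coh A B) F F' p) (h : n + p = q) : (Coh A C).Hom (compObj G F) (compObj G' F') q :=
  m.map (Twist.eps Θ P h)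

/-- The image `m(id_G ⊗ Ψ)`. -/
def right (G : (Coh B C).Obj) {F F' : (Coh A B).Obj} {n : ℤ} (Ψ : (Coh A B).Hom F F' n) :
    (Coh A C).Hom (compObj G F) (compObj G F') n :=
  m.map (Twist.right (C := Coh B C) G Ψ)

end TwistMaps

/-- The conditions on the values of a dg functor
`m : Coh(B, C) ⊗̃ Coh(A, B) ⟶ Coh(A, C)`, `(G, F) ↦ G ∘ F`, on the generators. -/
structure IsTwistedComposition {A B C : DGCat k} (m : TwistMaps A B C) : Prop where
  /-- `m(Θ ⊗ id_F)(f_N, …, f₁) = Θ(F(f_N), …, F(f₁))` -/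
  left : ∀ {G G' : DGFunctor B C} {n : ℤ} (Θ : (Coh B C).Hom G G' n) (F : DGFunctor A B)
    {x y : A.Obj} {e r : ℤ} (c : Chain A x y e) (h : e + n = r),
    Coh.ap (m.eps Θ (.nil F) (add_zero n)) c h = Coh.ap Θ (c.map F) h
  /-- `m(id_G ⊗ Ψ)(f_N, …, f₁) = G(Ψ(f_N, …, f₁))` -/
  right : ∀ (G : DGFunctor B C) {F F' : DGFunctor A B} {n : ℤ} (Ψ : (Coh A B).Hom F F' n)
    {x y : A.Obj} {e r : ℤ} (c : Chain A x y e) (h : e + n = r),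
    Coh.ap (m.right G Ψ) c h = G.map (Coh.ap Ψ c h)
  /-- `m(ε(Θ; Ψ₁, …, Ψ_k)) = Θ{Ψ_k, …, Ψ₁}` -/
  eps : ∀ {G G' : DGFunctor B C} {F F' : DGFunctor A B} {n p q : ℤ} (Θ : (Coh B C).Hom G G' n)
    (P : Chain (Coh A B) F F' p) (hq : n + p = q) {x y : A.Obj} {e r : ℤ} (c : Chain A x y e)
    (h : e + q = r),
    Coh.ap (m.eps Θ P hq) c h = brace Θ P c (by omega)

end DG

/-! The twisted tensor product is presented by generators and relations. A dg functor out of it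
therefore amounts to values on the generators `ε(Θ; Ψ₁, …, Ψ_k)` and `id ⊗ Ψ` which satisfy the
relations in the target (`Twist.Generators.lift`), and it is determined by these values
(`Twist.maps_ext`). For `Ψ ↦ G(Ψ)` the relations say that `post` is a dg functor. For the braces,
apart from linearity and the vanishing on identities, two relations have content: the formula for
`(Θ₂ ∪ Θ₁){P}` and the formula for `d(Θ{P})`, where `P = (Ψ_k, …, Ψ₁)`.

Both have a combinatorial reason. A term of the brace feeds a chain with entries `F_s(f)` and
`Ψ_s(…)` into the outer cochain. Cutting this chain in two, as a cup product does, cuts the chain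
`P` and the chain of arguments at compatible places; this is `cupFormula`. For the differential one
looks at the products of neighbouring entries in `(dΘ){P}`. A product `F_s(f) F_s(g) = F_s(fg)`
comes from composing two arguments of `Θ{P}`; the products `F_s(f) Ψ_s(…)` and `Ψ_s(…) F_{s-1}(f)`
are the outer terms of `dΨ_s`; a product `Ψ_{s+1}(…) Ψ_s(…)` belongs to `Ψ_{s+1} ∪ Ψ_s`. At the two
ends of the chain, an entry `F_k(f_N)` or `F_0(f_1)` gives an outer term of the differential of
`Θ{P}`, whereas an entry `Ψ_k(…)` or `Ψ_1(…)` gives one of the two products with `id ⊗ Ψ` in the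
relation.

The signs are controlled by recursion on the leftmost argument instead of sums over positions. For a
family `ψ` with fixed endpoint, `freeze` fixes the first argument and `merge` absorbs a morphism
into it; the differential without left action, `diff`, is expressed through these two by
`diff_cons`. The brace `br` splits according to whether the first argument lies to the left of the
block of `Ψ_k` (`br_cons_cons`); the part `ins` with nothing to the left of that block splits
according to whether the block is empty (`ins_cons`). Each identity is then proved by induction on
`P` and, inside, on the arguments: the identity for `P` gives one for `ins` (`diff_ins`, `ins_cup`),
and this gives the identity for the chain with one more cochain (`diffFormula_cons`,
`cupFormula_cons`). The left action is treated apart (`br_nil_lact`, `br_cons_lact`) and added in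
`d_braceHom`.

The Tsygan map uses the same identities: `d_braceHom`, solved for the brace of `dΘ`, is the formula
for the differential of the cochain `P ↦ Θ{P}`, and `braceHom_comp` is the formula for the cup
product of two such cochains. -/

namespace DG
-- Braces of families and their recursion on the leftmost argument
namespace Raw
variable {k : Type u} [Field k] {A B C : DGCat k} {F F' F'' : DGFunctor A B}
  {G G' : DGFunctor B C} {W : C.Obj} {V : B.Obj} {x y z : A.Obj} {d p m e r : ℤ}

/-- The family `(f_N, …, f₁) ↦ ψ{Ψ_k, …, Ψ₁}(f_N, …, f₁)`, where `P = (Ψ_k, …, Ψ₁)`. -/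
def br (P : Chain (Coh A B) F F' p) (ψ : Raw G W (F'.obj y) d) {d' : ℤ} (hd : d + p = d') :
    Raw (G.comp F) W y d' := fun _ _ c =>
  ((braceTerms P c).map fun w => w.1 • ψ.ev (by omega) w.2).sum

/-- The part of `ψ{Ψ, Ψ_k, …, Ψ₁}` in which no argument lies to the left of the block of `Ψ`. -/
def ins (Ψ : Raw F' V y m) (P : Chain (Coh A B) F F' p) (ψ : Raw G W V d) {d' : ℤ}
    (hd : m - 1 + d + p = d') : Raw (G.comp F) W y d' := fun _ _ c =>
  (c.splits.map fun t => sgn k (p * t.e₁) •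
    (br P (freeze ψ (Ψ.ev rfl t.left) rfl) rfl).ev (by have := t.h; omega) t.right).sum

theorem ev_br (P : Chain (Coh A B) F F' p) (ψ : Raw G W (F'.obj y) d) {d' : ℤ}
    (hd : d + p = d') (h : e + d' = r) (c : Chain A x y e) :
    (br P ψ hd).ev h c = ((braceTerms P c).map fun w => w.1 • ψ.ev (by omega) w.2).sum := by
  subst h; rfl

theorem ev_ins (Ψ : Raw F' V y m) (P : Chain (Coh A B) F F' p) (ψ : Raw G W V d) {d' : ℤ}
    (hd : m - 1 + d + p = d') (h : e + d' = r) (c : Chain A x y e) :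
    (ins Ψ P ψ hd).ev h c = (c.splits.map fun t => sgn k (p * t.e₁) •
    (br P (freeze ψ (Ψ.ev rfl t.left) rfl) rfl).ev (by have := t.h; omega) t.right).sum := by
  subst h; rfl

theorem ev_cast (ψ : Raw G W V d) {x : B.Obj} {e e' : ℤ} (he : e = e') (h : e' + d = r)
    (c : Chain B x V e) : ψ.ev h (c.cast he) = ψ.ev (by omega) c := by
  subst he; rfl

theorem br_nil_nil (ψ : Raw G W (F.obj y) d) {d' : ℤ} (hd : d + 0 = d') (h : 0 + d' = r) :
    (br (.nil F) ψ hd).ev h (.nil y) = ψ.ev (by omega) (.nil (F.obj y)) := by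
  rw [ev_br]
  simp only [braceTerms, List.map_cons, List.map_nil, List.sum_cons, List.sum_nil, one_smul,
    add_zero, Chain.map]
  exact ev_cast ..

theorem br_nil_cons (ψ : Raw G W (F.obj z) d) {a e' d' : ℤ} (f : A.Hom y z a)
    (c : Chain A x y e) (h' : a - 1 + e = e') (hd : d + 0 = d') (h : e' + d' = r) :
    (br (.nil F) ψ hd).ev h (.cons f c h') =
      (br (.nil F) (freeze ψ (F.map f) rfl) rfl).ev (by omega) c := by
  rw [ev_br, ev_br]
  simp only [braceTerms, List.map_cons, List.map_nil, List.sum_cons, List.sum_nil, one_smul,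
    add_zero, Chain.map]
  rw [ev_cast, ev_cast, ev_freeze]

theorem ins_nil (Ψ : Raw F' V y m) (P : Chain (Coh A B) F F' p) (ψ : Raw G W V d) {d' : ℤ}
    (hd : m - 1 + d + p = d') (h : 0 + d' = r) :
    (ins Ψ P ψ hd).ev h (.nil y) =
      (br P (freeze ψ (Ψ.ev (zero_add m) (.nil y)) rfl) rfl).ev (by omega) (.nil y) := by
  rw [ev_ins]
  simp only [Chain.splits, List.map_cons, List.map_nil, List.sum_cons, List.sum_nil, mul_zero,
    sgn_zero, one_smul, add_zero]
  -- The degree `0 + m` produced by the empty block equals `m` only propositionally, and the type of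
  -- `freeze` depends on it; with a variable `s` in its place the equation can be substituted.
  have : ∀ {s : ℤ} (h : 0 + m = s) (h' : 0 + (s - 1 + d + p) = r),
      (br P (freeze ψ (Ψ.ev h (.nil y)) rfl) rfl).ev h' (.nil y) =
      (br P (freeze ψ (Ψ.ev (zero_add m) (.nil y)) rfl) rfl).ev (by omega) (.nil y) := by
    intro s h h'
    obtain rfl : s = m := by omega
    rfl
  exact this ..

/-- Either the block of `Ψ` is empty, and its value in arity zero becomes the first entry of `ψ`, or
the block begins with `f`. In the second case `f` lies to the left of all blocks of `P`, whence the
sign. -/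
theorem ins_cons (Ψ : Raw F' V z m) (P : Chain (Coh A B) F F' p) (ψ : Raw G W V d) {a e' d' : ℤ}
    (hd : m - 1 + d + p = d') (f : A.Hom y z a) (c : Chain A x y e) (h' : a - 1 + e = e')
    (h : e' + d' = r) :
    (ins Ψ P ψ hd).ev h (.cons f c h') =
      (br P (freeze ψ (Ψ.ev (zero_add m) (.nil z)) rfl) rfl).ev (by omega) (.cons f c h')
      + sgn k (p * (a - 1)) • (ins (freeze Ψ f rfl) P ψ rfl).ev (by omega) c := by
  rw [ev_ins, ev_ins]
  simp only [Chain.splits, List.map_cons, List.sum_cons, mul_zero,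
    sgn_zero, one_smul, List.map_map, List.smul_sum]
  congr 1
  · have : ∀ {s : ℤ} (h : 0 + m = s) (h'' : e' + (s - 1 + d + p) = r),
      (br P (freeze ψ (Ψ.ev h (.nil z)) rfl) rfl).ev h'' (.cons f c h') =
      (br P (freeze ψ (Ψ.ev (zero_add m) (.nil z)) rfl) rfl).ev (by omega) (.cons f c h') := by
      intro s h h'
      obtain rfl : s = m := by omega
      rfl
    exact this ..
  · congr 1
    apply List.map_congr_left
    intro t _
    simp only [Function.comp, mul_add, sgn_add, mul_smul]
    congr 2
    have : ∀ {s s' : ℤ} (h : a - 1 + t.e₁ + m = s) (h₂ : t.e₁ + (a - 1 + m) = s')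
        (h₁ : t.e₂ + (s - 1 + d + p) = r) (h₃ : t.e₂ + (s' - 1 + d + p) = r),
      (br P (freeze ψ (Ψ.ev h (.cons f t.left rfl)) rfl) rfl).ev h₁ t.right =
      (br P (freeze ψ ((freeze Ψ f rfl).ev h₂ t.left) rfl) rfl).ev h₃ t.right := by
      intro s s' h h₂ h₁ h₃
      obtain rfl : s = s' := by omega
      rw [ev_freeze']
    exact this ..

theorem ev_append_nil (ψ : Raw G W V d) {x : B.Obj} {e₁ e₂ : ℤ} (c : Chain B x V e₁)
    (he : 0 + e₁ = e₂) (h : e₂ + d = r) :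
    ψ.ev h (c.append (.nil V) he) = ψ.ev (by omega) c := by
  rw [Chain.append, ev_cast]

theorem br_cons_nil {Ψ : (Coh A B).Hom F' F'' m} {P : Chain (Coh A B) F F' p} {q : ℤ}
    (hq : m - 1 + p = q)
    (ψ : Raw G W (F''.obj y) d) {d' : ℤ} (hd : d + q = d') (h : 0 + d' = r) :
    (br (.cons Ψ P hq) ψ hd).ev h (.nil y) = (ins (Ψ.1 y) P ψ rfl).ev (by omega) (.nil y) := by
  subst hq
  rw [ev_br, ins_nil, ev_br]
  simp only [braceTerms, Chain.splits, List.flatMap_cons, List.flatMap_nil, List.append_nil,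
    List.map_map]
  congr 1
  apply List.map_congr_left
  intro w _
  simp only [Function.comp, Chain.map, mul_zero, sgn_zero, one_mul, add_zero]
  congr 1
  rw [ev_append_nil, ev_freeze']
  have : ∀ {s t : ℤ} (h : 0 + m = s) (h' : s - 1 + (0 + p) = t) (h'' : t + d = r),
    ψ.ev h'' (.cons ((Ψ.1 y).ev h (.nil y)) w.2 h') =
      ψ.ev (by omega) (.cons ((Ψ.1 y).ev (zero_add m) (.nil y)) w.2 rfl) := by
    intro s t h h' h''
    obtain rfl : s = m := by omega
    subst h'
    rfl
  exact this ..

theorem sum_map_flatMap {α β M : Type*} [AddCommMonoid M] (l : List α) (g : α → List β)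
    (φ : β → M) : ((l.flatMap g).map φ).sum = (l.map fun t => ((g t).map φ).sum).sum := by
  induction l with
  | nil => rfl
  | cons a l ih => simp [ih]

/-- The three nested sums choose the arguments to the left of the block of `Ψ`, the block itself,
and a brace term of `P` on what remains. -/
theorem ev_br_cons {Ψ : (Coh A B).Hom F' F'' m} {P : Chain (Coh A B) F F' p} {q : ℤ}
    (hq : m - 1 + p = q) (ψ : Raw G W (F''.obj y) d) {d' : ℤ} (hd : d + q = d') (h : e + d' = r)
    (c : Chain A x y e) :
    (br (.cons Ψ P hq) ψ hd).ev h c = (c.splits.map fun s => (s.right.splits.map fun t =>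
      ((braceTerms P t.right).map fun w =>
        (sgn k ((m - 1) * s.e₁) * sgn k (p * (s.e₁ + t.e₁)) * w.1) •
        ψ.ev (by have := s.h; have := t.h; omega)
          ((Chain.cons (Coh.ap Ψ t.left rfl) w.2 rfl).append (s.left.map F'') rfl)).sum).sum).sum
    := by
  rw [ev_br]
  simp only [braceTerms]
  rw [sum_map_flatMap]
  congr 1
  apply List.map_congr_left
  intro s _
  rw [sum_map_flatMap]
  congr 1
  apply List.map_congr_left
  intro t _
  rw [List.map_map]
  congr 1
  apply List.map_congr_left
  intro w _
  simp only [Function.comp]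
  congr 1
  have : ∀ {e₁ e₂ s s' : ℤ} {x y z : B.Obj} {W : C.Obj} {ψ : Raw G W z d} (c : Chain B x y e₁)
    (c' : Chain B y z e₂)
      (h : e₂ + e₁ = s) (h' : e₂ + e₁ = s') (h₁ : s + d = r) (h₂ : s' + d = r),
      ψ.ev h₁ (c.append c' h) = ψ.ev h₂ (c.append c' h') := by
    intros; subst_vars; rfl
  exact this ..

/-- The argument `f` may lie to the left of the block of `Ψ`; then it enters `ψ` as `F''(f)` and
passes all the cochains, of total shifted degree `q`. The other terms are those of `ins`. -/
theorem br_cons_cons {Ψ : (Coh A B).Hom F' F'' m} {P : Chain (Coh A B) F F' p} {q : ℤ}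
    (hq : m - 1 + p = q) (ψ : Raw G W (F''.obj z) d) {a e' d' : ℤ} (hd : d + q = d')
    (f : A.Hom y z a) (c : Chain A x y e) (h' : a - 1 + e = e') (h : e' + d' = r) :
    (br (.cons Ψ P hq) ψ hd).ev h (.cons f c h') =
      (ins (Ψ.1 z) P ψ rfl).ev (by omega) (.cons f c h') + sgn k (q * (a - 1)) •
        (br (.cons Ψ P hq) (freeze ψ (F''.map f) rfl) rfl).ev (by omega) c := by
  rw [ev_br_cons, ev_br_cons, Chain.splits, List.map_cons, List.sum_cons, ev_ins]
  congr 1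
  · congr 1
    apply List.map_congr_left
    intro t _
    rw [ev_br, List.smul_sum, List.map_map]
    congr 1
    apply List.map_congr_left
    intro w _
    simp only [Function.comp, Chain.map, mul_zero, sgn_zero, one_mul, zero_add, mul_smul]
    rw [ev_append_nil, ev_freeze', ← Coh.ap]
  · rw [List.smul_sum, List.map_map, List.map_map]
    congr 1
    apply List.map_congr_left
    intro s _
    simp only [Function.comp]
    rw [List.smul_sum, List.map_map]
    congr 1
    apply List.map_congr_left
    intro t _
    simp only [Function.comp]
    rw [List.smul_sum, List.map_map]
    congr 1
    apply List.map_congr_left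
    intro w _
    simp only [Function.comp, Chain.map, Chain.append]
    rw [smul_smul, ev_freeze']
    -- Adding `f` to the arguments on the left raises `s.e₁` by `a - 1` in both sign exponents;
    -- together this is `(m - 1 + p) * (a - 1)`.
    subst hq
    congr 1
    · simp only [mul_add, add_mul, sgn_add]
      ring
    · exact ev_cons ..

end Raw

/-! ### Linearity of braces in the outer family and in the first inserted one -/

namespace Raw
variable {k : Type u} [Field k] {A B C : DGCat k} {F F' F'' : DGFunctor A B}
  {G G' : DGFunctor B C} {W : C.Obj} {V V' : B.Obj} {x y z : A.Obj} {d p m e r : ℤ}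

theorem sum_map_lin {α M : Type*} [AddCommGroup M] [Module k M] {l : List α}
    {φ φ₁ φ₂ : α → M} {s : k} (H : ∀ t ∈ l, φ t = φ₁ t + s • φ₂ t) :
    (l.map φ).sum = (l.map φ₁).sum + s • (l.map φ₂).sum := by
  induction l with
  | nil => simp
  | cons a l ih =>
    simp only [List.map_cons, List.sum_cons]
    rw [H a (by simp), ih fun t ht => H t (by simp [ht])]
    module

theorem sum_map_lin' {α M : Type*} [AddCommGroup M] [Module k M] {l : List α}
    {φ φ₁ φ₂ : α → M} {s : k} (H : ∀ t ∈ l, φ t = s • φ₁ t + φ₂ t) :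
    (l.map φ).sum = s • (l.map φ₁).sum + (l.map φ₂).sum := by
  rw [add_comm, sum_map_lin fun t ht => (H t ht).trans (add_comm ..)]

theorem br_lin (P : Chain (Coh A B) F F' p) (ψ φ : Raw G W (F'.obj y) d) (t : k) {d' : ℤ}
    (hd : d + p = d') : br P (t • ψ + φ) hd = t • br P ψ hd + br P φ hd := by
  refine ext_ev fun {x e r} h c => ?_
  rw [ev_add, ev_smul, ev_br, ev_br, ev_br]
  refine sum_map_lin' fun w _ => ?_
  rw [ev_add, ev_smul, smul_add, smul_comm]

theorem br_zero (P : Chain (Coh A B) F F' p) {d' : ℤ} (hd : d + p = d') :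
    br P (0 : Raw G W (F'.obj y) d) hd = 0 := by
  simpa using br_lin P (0 : Raw G W (F'.obj y) d) 0 1 hd

theorem br_add (P : Chain (Coh A B) F F' p) (ψ φ : Raw G W (F'.obj y) d) {d' : ℤ}
    (hd : d + p = d') : br P (ψ + φ) hd = br P ψ hd + br P φ hd := by
  simpa using br_lin P ψ φ 1 hd

theorem br_smul (P : Chain (Coh A B) F F' p) (ψ : Raw G W (F'.obj y) d) (t : k) {d' : ℤ}
    (hd : d + p = d') : br P (t • ψ) hd = t • br P ψ hd := by
  simpa [br_zero] using br_lin P ψ 0 t hd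

theorem br_sub (P : Chain (Coh A B) F F' p) (ψ φ : Raw G W (F'.obj y) d) {d' : ℤ}
    (hd : d + p = d') : br P (ψ - φ) hd = br P ψ hd - br P φ hd := by
  rw [sub_eq_neg_add, sub_eq_neg_add, ← neg_one_smul k φ, br_lin, neg_one_smul]

/-- The values of `Ψ` are arguments of `ψ`, so that linearity in `Ψ` rests on the multilinearity of
`ψ`, whereas linearity in `ψ` itself is free. -/
theorem ins_lin_left (Ψ Φ : Raw F' V y m) (P : Chain (Coh A B) F F' p) {ψ : Raw G W V d}
    (hψ : Multilinear ψ) (t : k) {d' : ℤ} (hd : m - 1 + d + p = d') :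
    ins (t • Ψ + Φ) P ψ hd = t • ins Ψ P ψ hd + ins Φ P ψ hd := by
  refine ext_ev fun {x e r} h c => ?_
  rw [ev_add, ev_smul, ev_ins, ev_ins, ev_ins]
  refine sum_map_lin' fun w _ => ?_
  rw [ev_add, ev_smul, hψ.freeze_lin, br_lin, ev_add, ev_smul, smul_add, smul_comm]

theorem ins_zero_left (P : Chain (Coh A B) F F' p) {ψ : Raw G W V d}
    (hψ : Multilinear ψ) {d' : ℤ} (hd : m - 1 + d + p = d') :
    ins (0 : Raw F' V y m) P ψ hd = 0 := by
  simpa using ins_lin_left 0 0 P hψ 1 hd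

theorem ins_add_left (Ψ Φ : Raw F' V y m) (P : Chain (Coh A B) F F' p) {ψ : Raw G W V d}
    (hψ : Multilinear ψ) {d' : ℤ} (hd : m - 1 + d + p = d') :
    ins (Ψ + Φ) P ψ hd = ins Ψ P ψ hd + ins Φ P ψ hd := by
  simpa using ins_lin_left Ψ Φ P hψ 1 hd

theorem ins_smul_left (Ψ : Raw F' V y m) (P : Chain (Coh A B) F F' p) {ψ : Raw G W V d}
    (hψ : Multilinear ψ) (t : k) {d' : ℤ} (hd : m - 1 + d + p = d') :
    ins (t • Ψ) P ψ hd = t • ins Ψ P ψ hd := by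
  simpa [ins_zero_left P hψ] using ins_lin_left Ψ 0 P hψ t hd

theorem ins_sub_left (Ψ Φ : Raw F' V y m) (P : Chain (Coh A B) F F' p) {ψ : Raw G W V d}
    (hψ : Multilinear ψ) {d' : ℤ} (hd : m - 1 + d + p = d') :
    ins (Ψ - Φ) P ψ hd = ins Ψ P ψ hd - ins Φ P ψ hd := by
  rw [sub_eq_neg_add, sub_eq_neg_add, ← neg_one_smul k Φ, ins_lin_left _ _ _ hψ, neg_one_smul]

/-- The part of `(Ψ merged into ψ){Ψ_k, …, Ψ₁}` which involves no dg functor applied to an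
argument next to `Ψ`. -/
def mid : ∀ {F' : DGFunctor A B} {p : ℤ}, Chain (Coh A B) F F' p → ∀ {V : B.Obj} {m d d' : ℤ},
    Raw F' V y m → Raw G W V d → m + d + p = d' → Raw (G.comp F) W y d'
  | _, _, .nil _, V, _, d, _, Ψ, ψ, h =>
      pcomp (ψ.ev (zero_add d) (.nil V)) (push G Ψ) (by omega)
  | _, _, .cons Ψ' P _, _, m, _, _, Ψ, ψ, h =>
      sgn k m • ins (cup Ψ Ψ'.1 rfl) P ψ (by omega)

/-- In `ins` the first entry of the outer family is always the value of `Ψ`; absorbing `u` into that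
entry composes `Ψ` with `u`. The sign is the one built into `merge`. -/
theorem ins_merge (Ψ : Raw F' V y m) (P : Chain (Coh A B) F F' p) {a : ℤ} (u : B.Hom V V' a)
    (ψ : Raw G W V' d) {s d' : ℤ} (hs : a + d = s) (hd : m - 1 + s + p = d') (h : e + d' = r)
    (c : Chain A x y e) : (ins Ψ P (merge ψ u hs) hd).ev h c =
      sgn k a • (ins (pcomp u Ψ rfl) P ψ rfl).ev (by omega) c := by
  rw [ev_ins, ev_ins, List.smul_sum, List.map_map]
  congr 1
  apply List.map_congr_left
  intro t _
  simp only [Function.comp]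
  rw [smul_comm]
  congr 1
  subst hs hd
  rw [freeze_merge (hab := rfl) (hs' := by omega), br_smul, ev_smul]
  congr 1
  have : ∀ {q s : ℤ} (v : B.Hom (F'.obj t.y) V q) (q' : ℤ) (hq : a + q = q')
      (h₁ : q' - 1 + d = s) (h₂ : t.e₂ + (s + p) = r),
      (br P (freeze ψ (B.comp rfl u v) (by omega)) rfl).ev h₂ t.right =
      (br P (freeze ψ (B.comp hq u v) rfl) rfl).ev (by omega) t.right := by
    intros; subst_vars; rfl
  rw [ev_pcomp (hs := rfl)]
  exact this _ _ _ (by omega) _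

end Raw

section
variable {k : Type u} [Field k] {A B : DGCat k} (F : DGFunctor A B) {x y z : A.Obj} {p q r : ℤ}

theorem DGFunctor.map_id : F.map (A.id x) = B.id (F.obj x) := F.toMaps.map_id x

theorem DGFunctor.map_comp (h : p + q = r) (g : A.Hom y z p) (f : A.Hom x y q) :
    F.map (A.comp h g f) = B.comp h (F.map g) (F.map f) := F.toMaps.map_comp h g f

theorem DGFunctor.map_d (h : p + 1 = q) (f : A.Hom x y p) :
    F.map (A.d h f) = B.d h (F.map f) := F.toMaps.map_d h f

end
-- Composing a morphism with the first argument of a brace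
namespace Raw
variable {k : Type u} [Field k] {A B C : DGCat k} {F F' F'' : DGFunctor A B}
  {G G' : DGFunctor B C} {W : C.Obj} {V V' : B.Obj} {x y z : A.Obj} {d p m e r : ℤ}

/-- Degrees are carried by equations, and one value occurs with several expressions for its degree.
This lemma and the later ones named `_congr`, as well as the local statements proved by
substitution, identify such copies. -/
theorem ev_br_freeze_congr (P : Chain (Coh A B) F F' p) {y : B.Obj} {V : A.Obj}
    (ψ : Raw G W y d) {a s s' d₁ d₂ : ℤ}
    (u : B.Hom (F'.obj V) y a) (hs : a - 1 + d = s) (h₁ : s + p = d₁) (hs' : a - 1 + d = s')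
    (h₂ : s' + p = d₂) (h : e + d₁ = r) (h' : e + d₂ = r) (c : Chain A x V e) :
    (br P (freeze ψ u hs) h₁).ev h c = (br P (freeze ψ u hs') h₂).ev h' c := by
  subst_vars; rfl

/-- If the block of `Ψ` is empty, `f` is absorbed by the brace with `P`; otherwise it is absorbed by
the first argument of `Ψ`. The family `merge Ψ f` also has a value on the empty block, namely the
composite of the arity zero value of `Ψ` with `F'(f)`; this is not part of the left side and has to
be subtracted. -/
theorem merge_ins (Ψ : Raw F' V z m) (P : Chain (Coh A B) F F' p) {ψ : Raw G W V d}
    (hψ : Multilinear ψ) {a d' s : ℤ} (hd : m - 1 + d + p = d') (f : A.Hom y z a) (hs : a + d' = s) (h : e + s = r)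
    (c : Chain A x y e) :
    (merge (ins Ψ P ψ hd) f hs).ev h c =
      (merge (br P (freeze ψ (Ψ.ev (zero_add m) (.nil z)) rfl) rfl) f rfl).ev (by omega) c
      + sgn k (p * a) • ((ins (merge Ψ f rfl) P ψ rfl).ev (by omega) c
        - (br P (freeze ψ (B.comp rfl (Ψ.ev (zero_add m) (.nil z)) (F'.map f)) rfl) rfl).ev
            (by omega) c) := by
  subst hd hs
  cases c with
  | nil =>
    rw [ev_merge_nil, ins_nil, ev_merge_nil, ins_nil, ev_merge_nil]
    have : ∀ {s : ℤ} (h' : m + a = s) (h₁ : 0 + (s - 1 + d + p) = r)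
      (h₂ : 0 + (a + m - 1 + d + p) = r),
        (br P (freeze ψ (B.comp (r := a + m) (by omega) (Ψ.ev (zero_add m) (.nil z)) (F'.map f))
          rfl) rfl).ev h₂ (.nil _) =
        (br P (freeze ψ (B.comp h' (Ψ.ev (zero_add m) (.nil z)) (F'.map f)) rfl) rfl).ev h₁
          (.nil _) := by
      intro s h' h₁ h₂
      obtain rfl : s = a + m := by omega
      rfl
    -- Without further arguments `merge Ψ f` has only the spurious value, so the correction cancels
    -- the whole second summand.
    rw [this rfl (by omega), sub_self, smul_zero, add_zero]
  | @cons w _ b e₀ _ g c hc =>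
    rw [ev_merge_cons', ev_merge_cons', ins_cons, ins_cons, ev_merge_nil]
    have : ∀ {s : ℤ} (h' : m + a = s) (h₁ : e + (s - 1 + d + p) = r)
      (h₂ : e + (a + m - 1 + d + p) = r),
        (br P (freeze ψ (B.comp (r := a + m) (by omega) (Ψ.ev (zero_add m) (.nil z)) (F'.map f))
          rfl) rfl).ev h₂ (.cons g c hc) =
        (br P (freeze ψ (B.comp h' (Ψ.ev (zero_add m) (.nil z)) (F'.map f)) rfl) rfl).ev h₁
          (.cons g c hc) := by
      intro s h' h₁ h₂
      obtain rfl : s = a + m := by omega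
      rfl
    rw [this rfl (by omega)]
    rw [freeze_merge (hab := rfl) (hs' := by omega), ins_smul_left _ _ hψ, ev_smul]
    have : ∀ {s t u v : ℤ} (h₁ : a + b - 1 + m = s) (h₂ : s - 1 + d + p = t) (h₃ : e₀ + t = r)
        (h₁' : a + b - 1 + m = u) (h₂' : u - 1 + d + p = v) (h₃' : e₀ + v = r),
        (ins (freeze Ψ (A.comp rfl f g) h₁) P ψ h₂).ev h₃ c =
        (ins (freeze Ψ (A.comp rfl f g) h₁') P ψ h₂').ev h₃' c := by
      intros; subst_vars; rfl
    rw [this (s := b - 1 + (a + m)) (u := a + b - 1 + m) (h₁ := by omega) (h₁' := rfl) (h₂' := rfl) (h₃' := by omega)]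
    simp only [mul_add, mul_sub, mul_one, sgn_add, sgn_sub]
    rcases sgn_cases k p with h | h <;> rw [h] <;> module

/-- When the first argument `g` lies to the left of the block of `Ψ`, functoriality of `F''` lets
`f` be absorbed as `F''(f)` by the first entry of `ψ`. The brace of `merge ψ (F''.map f)` also
contains terms in which that first entry is a value of `Ψ`; the subtracted `ins` removes them. They
come back in `diffFormula_cons` as the left action in the differential of `Ψ`. -/
theorem merge_br {Ψ : (Coh A B).Hom F' F'' m} {P : Chain (Coh A B) F F' p} {q : ℤ}
    (hq : m - 1 + p = q) (ψ : Raw G W (F''.obj z) d) {a d' s : ℤ} (hd : d + q = d')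
    (f : A.Hom y z a) (hs : a + d' = s) (h : e + s = r) (c : Chain A x y e) :
    (merge (br (.cons Ψ P hq) ψ hd) f hs).ev h c =
      (merge (ins (Ψ.1 z) P ψ rfl) f rfl).ev (by omega) c
      + sgn k (q * a) • ((br (.cons Ψ P hq) (merge ψ (F''.map f) rfl) rfl).ev (by omega) c
        - (ins (Ψ.1 y) P (merge ψ (F''.map f) rfl) rfl).ev (by omega) c) := by
  subst hd hs
  cases c with
  | nil =>
    rw [ev_merge_nil, br_cons_nil, ev_merge_nil, br_cons_nil, sub_self, smul_zero, add_zero]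
    exact comp_ev ..
  | @cons w _ b e₀ _ g c hc =>
    rw [ev_merge_cons', ev_merge_cons', br_cons_cons, br_cons_cons, add_sub_cancel_left,
      DGFunctor.map_comp]
    have : ∀ {s : ℤ} (h₁ : b - 1 + (a + d) = s) (h₃ : e₀ + (s + q) = r),
        (br (.cons Ψ P hq) (freeze (merge ψ (F''.map f) rfl) (F''.map g) h₁) rfl).ev h₃ c =
        sgn k a • (br (.cons Ψ P hq) (freeze ψ (B.comp rfl (F''.map f) (F''.map g)) rfl) rfl).ev
          (by omega) c := by
      intro s h₁ h₃
      rw [freeze_merge (hab := rfl) (hs' := by omega), br_smul, ev_smul,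
        ev_br_freeze_congr (hs' := rfl) (h₂ := rfl)]
    rw [this]
    simp only [mul_add, mul_sub, mul_one, sgn_add, sgn_sub]
    rcases sgn_cases k q with h | h <;> rw [h] <;> module

end Raw

/-! ### The bar differential on chains of cochains, and induction on such chains -/

namespace Chain
variable {k : Type u} [Field k] {C : DGCat k} {x y z : C.Obj} {e : ℤ}

/-- The signed chains which make up the differential of the bar construction. -/
def bdTerms (c : Chain C x z e) : List (k × Chain C x z (e + 1)) := c.dTerms ++ c.mTerms

/-- Induction on the chains of cochains. -/
theorem cohInduction {A B : DGCat k} {F : DGFunctor A B}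
    {motive : ∀ (F' : DGFunctor A B) (p : ℤ), Chain (Coh A B) F F' p → Prop}
    (nil : motive F 0 (Chain.nil (C := Coh A B) F))
    (cons : ∀ {F' F'' : DGFunctor A B} {m p q : ℤ} (Ψ : (Coh A B).Hom F' F'' m)
      (P : Chain (Coh A B) F F' p) (hq : m - 1 + p = q), motive F' p P →
      motive F'' q (.cons Ψ P hq)) :
    ∀ {F' : DGFunctor A B} {p : ℤ} (P : Chain (Coh A B) F F' p), motive F' p P
  | _, _, .nil _ => nil
  | _, _, .cons Ψ P hq => cons Ψ P hq (cohInduction nil cons P)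

end Chain
namespace Raw
variable {k : Type u} [Field k] {A B C : DGCat k} {F F' F'' : DGFunctor A B}
  {G G' : DGFunctor B C} {W : C.Obj} {V V' : B.Obj} {x y z : A.Obj} {d p m e r : ℤ}

/-- The family `ψ{∂P} - ± ψ{Ψ_k, …, Ψ₂} ∪ G(Ψ₁)`, where `P = (Ψ_k, …, Ψ₁)` and `∂` is the
differential of the bar construction. -/
def brBd (P : Chain (Coh A B) F F' p) (ψ : Raw G W (F'.obj y) d) {d' : ℤ} (hd : d + p + 1 = d') :
    Raw (G.comp F) W y d' := fun _ _ c =>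
  (P.bdTerms.map fun t => t.1 • (br t.2 ψ rfl).ev (by omega) c).sum
    - (P.lasts.map fun s => sgn k s.e₁ •
      (cup (br s.init ψ rfl) (fun y => push G (s.f.1 y)) rfl).ev (by have := s.h; omega) c).sum

/-- The analogue of `brBd` for `ins`. -/
def insBd (Ψ : Raw F' V y m) (P : Chain (Coh A B) F F' p) (ψ : Raw G W V d) {d' : ℤ}
    (hd : m - 1 + d + p + 1 = d') : Raw (G.comp F) W y d' := fun _ _ c =>
  (P.bdTerms.map fun t => t.1 • (ins Ψ t.2 ψ rfl).ev (by omega) c).sum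
    - (P.lasts.map fun s => sgn k s.e₁ •
      (cup (ins Ψ s.init ψ rfl) (fun y => push G (s.f.1 y)) rfl).ev
        (by have := s.h; omega) c).sum

theorem ev_brBd (P : Chain (Coh A B) F F' p) (ψ : Raw G W (F'.obj y) d) {d' : ℤ}
    (hd : d + p + 1 = d') (h : e + d' = r) (c : Chain A x y e) : (brBd P ψ hd).ev h c =
  (P.bdTerms.map fun t => t.1 • (br t.2 ψ rfl).ev (by omega) c).sum
    - (P.lasts.map fun s => sgn k s.e₁ •
      (cup (br s.init ψ rfl) (fun y => push G (s.f.1 y)) rfl).ev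
        (by have := s.h; omega) c).sum := by
  subst h; rfl

theorem ev_insBd (Ψ : Raw F' V y m) (P : Chain (Coh A B) F F' p) (ψ : Raw G W V d) {d' : ℤ}
    (hd : m - 1 + d + p + 1 = d') (h : e + d' = r) (c : Chain A x y e) :
    (insBd Ψ P ψ hd).ev h c =
  (P.bdTerms.map fun t => t.1 • (ins Ψ t.2 ψ rfl).ev (by omega) c).sum
    - (P.lasts.map fun s => sgn k s.e₁ •
      (cup (ins Ψ s.init ψ rfl) (fun y => push G (s.f.1 y)) rfl).ev
        (by have := s.h; omega) c).sum := by
  subst h; rfl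

/-! ### Cup product and differential of a family from which a frozen part splits off -/

section peel
variable {K K₁ L : DGFunctor A C} {a d₀ d₁ d₂ : ℤ} {f : A.Hom y z a}
  {φ : Raw K W z d} {φ₀ : Raw K W z d₀} {φ₁ : Raw K W y d₁} {s : k}

theorem cup_nil_congr {χ : ∀ y, Raw L (K.obj y) y d₂} {d' d'' : ℤ} {φ : Raw K W y d}
    {φ₀ : Raw K W y d₀} (h₀ : d₀ = d)
    (Hnil : ∀ {r} (h : 0 + d = r), φ.ev h (.nil y) = φ₀.ev (by omega) (.nil y))
    (hd : d + d₂ = d') (hd₀ : d₀ + d₂ = d'') (h : 0 + d' = r) :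
    (cup φ χ hd).ev h (.nil y) = (cup φ₀ χ hd₀).ev (by omega) (.nil y) := by
  subst h₀ hd₀ hd
  rw [cup_nil, cup_nil, Hnil]

/-- The hypotheses have the common shape of `ins_cons` and `br_cons_cons`. The arity zero values of
`φ` and `φ₀` agree, so only the frozen families differ; moving `f` past `χ` gives the additional
sign. -/
theorem cup_peel {χ : ∀ y, Raw L (K.obj y) y d₂} {d' d'' d₃ : ℤ}
    (h₀ : d₀ = d) (h₁ : d₁ = a - 1 + d)
    (Hnil : ∀ {r} (h : 0 + d = r), φ.ev h (.nil z) = φ₀.ev (by omega) (.nil z))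
    (Hcons : ∀ {x : A.Obj} {e r : ℤ} (c : Chain A x y e) (h : a - 1 + e + d = r),
      φ.ev h (.cons f c rfl) = φ₀.ev (by omega) (.cons f c rfl) + s • φ₁.ev (by omega) c)
    (hd : d + d₂ = d') (hd₀ : d₀ + d₂ = d'') (hd₁ : d₁ + d₂ = d₃) {x : A.Obj} {e e' r : ℤ}
    (c : Chain A x y e)
    (h' : a - 1 + e = e') (h : e' + d' = r) :
    (cup φ χ hd).ev h (.cons f c h') = (cup φ₀ χ hd₀).ev (by omega) (.cons f c h') +
      (sgn k (d₂ * (a - 1)) * s) • (cup φ₁ χ hd₁).ev (by omega) c := by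
  subst h₀ h₁ hd₀ hd₁ h'
  have : freeze φ f rfl = freeze φ₀ f rfl + s • φ₁ := by
    refine ext_ev fun {x e r} h c => ?_
    rw [ev_add, ev_smul, ev_freeze', ev_freeze', Hcons]
  rw [cup_cons (hs := rfl) (ht := rfl), cup_cons (hs := rfl) (ht := rfl), Hnil, this,
    cup_add_left, cup_smul_left, ev_add, ev_smul]
  subst hd
  module

/-- The splitting `Hcons` is available for the one morphism `f` only. The values at `df` and the
merged values therefore stay in the formula as differences, to be evaluated by `merge_ins` or
`merge_br` and the appropriate recursion. -/
theorem diff_peel {d' d₀' d₁' : ℤ} (h₀ : d₀ = d) (h₁ : d₁ = a - 1 + d)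
    (Hcons : ∀ {x : A.Obj} {e r : ℤ} (c : Chain A x y e) (h : a - 1 + e + d = r),
      φ.ev h (.cons f c rfl) = φ₀.ev (by omega) (.cons f c rfl) + s • φ₁.ev (by omega) c)
    (hd : d + 1 = d') (hd₀ : d₀ + 1 = d₀') (hd₁ : d₁ + 1 = d₁') {x : A.Obj} {e e' r s₁ s₂ : ℤ}
    (c : Chain A x y e) (h' : a - 1 + e = e') (h : e' + d' = r) (hs₁ : a + d = s₁)
    (hs₂ : a + d₀ = s₂) :
    (diff φ hd).ev h (.cons f c h') = (diff φ₀ hd₀).ev (by omega) (.cons f c h') +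
      s • (diff φ₁ hd₁).ev (by omega) c + sgn k d •
        (φ.ev (by omega) (.cons (A.d (q := a + 1) rfl f) c rfl)
          - φ₀.ev (by omega) (.cons (A.d (q := a + 1) rfl f) c rfl)
          - ((merge φ f hs₁).ev (by omega) c - (merge φ₀ f hs₂).ev (by omega) c)) := by
  subst h₀ h₁ hd₀ hd₁ h' hs₁ hs₂
  have : freeze φ f rfl = freeze φ₀ f rfl + s • φ₁ := by
    refine ext_ev fun {x e r} h c => ?_
    rw [ev_add, ev_smul, ev_freeze', ev_freeze', Hcons]
  rw [diff_cons, diff_cons, ev_freeze', ev_freeze', this, diff_add, diff_smul, ev_add, ev_smul]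
  module

end peel

end Raw

/-! ### Recursions for the boundary terms and for the products next to an inserted family -/

namespace Raw
variable {k : Type u} [Field k] {A B C : DGCat k} {F F' F'' : DGFunctor A B}
  {G G' : DGFunctor B C} {W : C.Obj} {V V' : B.Obj} {x y z : A.Obj} {d p m e r : ℤ}

theorem insBd_nil (Ψ : Raw F' V y m) (P : Chain (Coh A B) F F' p) (ψ : Raw G W V d) {d' : ℤ}
    (hd : m - 1 + d + p + 1 = d') (h : 0 + d' = r) :
    (insBd Ψ P ψ hd).ev h (.nil y) =
      (brBd P (freeze ψ (Ψ.ev (zero_add m) (.nil y)) rfl) rfl).ev (by omega) (.nil y) := by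
  rw [ev_insBd, ev_brBd]
  congr 2
  · refine List.map_congr_left fun t _ => ?_
    rw [ins_nil]
  · refine List.map_congr_left fun s _ => ?_
    congr 1
    exact cup_nil_congr rfl (fun h => ins_nil ..) ..

/-- This is `ins_cons` applied to every boundary term. The boundary raises the degree of `P` by one,
and accordingly `f` passes something of degree `p + 1`. -/
theorem insBd_cons (Ψ : Raw F' V z m) (P : Chain (Coh A B) F F' p) (ψ : Raw G W V d) {a e' d' : ℤ}
    (hd : m - 1 + d + p + 1 = d') (f : A.Hom y z a) (c : Chain A x y e) (h' : a - 1 + e = e')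
    (h : e' + d' = r) :
    (insBd Ψ P ψ hd).ev h (.cons f c h') =
      (brBd P (freeze ψ (Ψ.ev (zero_add m) (.nil z)) rfl) rfl).ev (by omega) (.cons f c h')
      + sgn k ((p + 1) * (a - 1)) • (insBd (freeze Ψ f rfl) P ψ rfl).ev (by omega) c := by
  have e1 := sum_map_lin (l := P.bdTerms)
    (φ := fun t => t.1 • (ins Ψ t.2 ψ rfl).ev (r := r) (by omega) (.cons f c h'))
    (φ₁ := fun t => t.1 • (br t.2 (freeze ψ (Ψ.ev (zero_add m) (.nil z)) rfl) rfl).ev (r := r)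
      (by omega) (.cons f c h'))
    (φ₂ := fun t => t.1 • (ins (freeze Ψ f rfl) t.2 ψ rfl).ev (r := r) (by omega) c)
    (s := sgn k ((p + 1) * (a - 1))) (fun t _ => by
      rw [ins_cons, smul_add, smul_comm])
  have e2 := sum_map_lin (l := P.lasts)
    (φ := fun s => sgn k s.e₁ • (cup (ins Ψ s.init ψ rfl) (fun y => push G (s.f.1 y)) rfl).ev
        (r := r) (by have := s.h; omega) (.cons f c h'))
    (φ₁ := fun s => sgn k s.e₁ • (cup (br s.init (freeze ψ (Ψ.ev (zero_add m) (.nil z)) rfl) rfl)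
      (fun y => push G (s.f.1 y)) rfl).ev (r := r) (by have := s.h; omega) (.cons f c h'))
    (φ₂ := fun s => sgn k s.e₁ • (cup (ins (freeze Ψ f rfl) s.init ψ rfl)
      (fun y => push G (s.f.1 y)) rfl).ev (r := r) (by have := s.h; omega) c)
    (s := sgn k ((p + 1) * (a - 1))) (fun s _ => by
      have := cup_peel (A := A) (φ := ins Ψ s.init ψ rfl) (φ₁ := ins (freeze Ψ f rfl) s.init ψ rfl)
        (φ₀ := br s.init (freeze ψ (Ψ.ev (zero_add m) (.nil z)) rfl) rfl)
        (hd := rfl) (hd₀ := rfl) (hd₁ := rfl) (r := r) rfl (by omega)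
        (fun h => ins_nil Ψ s.init ψ rfl h)
        (fun c h => ins_cons Ψ s.init ψ rfl f c rfl h) (χ := fun y => push G (s.f.1 y)) c h'
        (by have := s.h; omega)
      rw [this, smul_add, smul_comm, ← sgn_add]
      congr 4
      -- In the last boundary term `f` passes the shortened chain and the unshifted cochain `s.f`;
      -- by `s.h` their degrees add up to `p + 1` as well.
      linear_combination (a - 1) * s.h)
  rw [ev_insBd, ev_brBd, ev_insBd, e1, e2]
  module

theorem mid_empty (Ψ : Raw F V y m) (ψ : Raw G W V d) {d' : ℤ} (hd : m + d + 0 = d') :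
    mid (.nil F) Ψ ψ hd = pcomp (ψ.ev (zero_add d) (.nil V)) (push G Ψ) (by omega) := rfl

theorem ev_mid_insert {Ψ' : (Coh A B).Hom F' F'' m} {P : Chain (Coh A B) F F' p} {q m' : ℤ}
    (hq : m - 1 + p = q) (Ψ : Raw F'' V y m') (ψ : Raw G W V d) {d' : ℤ}
    (hd : m' + d + q = d') (h : e + d' = r) (c : Chain A x y e) :
    (mid (.cons Ψ' P hq) Ψ ψ hd).ev h c =
      sgn k m' • (ins (cup Ψ Ψ'.1 rfl) P ψ rfl).ev (by omega) c := by
  obtain rfl : d' = m' + m - 1 + d + p := by omega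
  exact ev_smul ..

/-- In the absence of arguments no dg functor is applied to any, so nothing is excluded from the
brace of the merged family. -/
theorem mid_nil (P : Chain (Coh A B) F F' p) (Ψ : Raw F' V y m) (ψ : Raw G W V d) {d' : ℤ}
    (hd : m + d + p = d') (h : 0 + d' = r) :
    (mid P Ψ ψ hd).ev h (.nil y) =
      (br P (merge ψ (Ψ.ev (zero_add m) (.nil y)) rfl) rfl).ev (by omega) (.nil y) := by
  subst hd
  induction P using Chain.cohInduction with
  | nil =>
    rw [mid_empty, br_nil_nil, ev_merge_nil, ev_pcomp (hs := zero_add _), ev_push]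
  | cons Ψ' P' hq _ =>
    rw [ev_mid_insert, br_cons_nil, ins_merge, ins_nil, ins_nil]
    congr 1
    rw [cup_nil]

/-- If `Ψ` has the empty block, its arity zero value is absorbed by the entry to its right. That
entry may be `F'(f)`, which `mid` excludes and the second summand removes. If the block of `Ψ` is
not empty, it begins with `f`; these terms form the last summand. -/
theorem mid_cons (P : Chain (Coh A B) F F' p) (Ψ : Raw F' V z m) {ψ : Raw G W V d}
    (hψ : Multilinear ψ) {a e' d' : ℤ}
    (hd : m + d + p = d') (f : A.Hom y z a) (c : Chain A x y e) (h' : a - 1 + e = e')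
    (h : e' + d' = r) :
    (mid P Ψ ψ hd).ev h (.cons f c h') =
      (br P (merge ψ (Ψ.ev (zero_add m) (.nil z)) rfl) rfl).ev (by omega) (.cons f c h')
      - sgn k (m + p * (a - 1)) •
        (br P (freeze ψ (B.comp rfl (Ψ.ev (zero_add m) (.nil z)) (F'.map f)) rfl) rfl).ev
          (by omega) c
      + sgn k (p * (a - 1)) • (mid P (freeze Ψ f rfl) ψ rfl).ev (by omega) c := by
  subst hd h'
  -- The excluded terms: those in which the arity zero value of `Ψ` is composed with `F'(f)`.
  have key : ∀ {u : ℤ} (hu : a - 1 + (m + d) = u) (hv : e + (u + p) = r),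
      (br P (freeze (merge ψ (Ψ.ev (zero_add m) (.nil z)) rfl) (F'.map f) hu) rfl).ev hv c =
      sgn k m • (br P (freeze ψ (B.comp rfl (Ψ.ev (zero_add m) (.nil z)) (F'.map f)) rfl) rfl).ev
          (by omega) c := by
    intro u hu hv
    rw [freeze_merge (hab := rfl) (hs' := by omega), br_smul, ev_smul,
      ev_br_freeze_congr (hs' := rfl) (h₂ := rfl)]
  induction P using Chain.cohInduction with
  | nil =>
    rw [mid_empty, mid_empty, br_nil_cons, key, ev_pcomp (hs := rfl), ev_pcomp (hs := rfl), ev_push, ev_push,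
      ev_freeze']
    simp only [zero_mul, add_zero, sgn_zero, one_smul, sub_self, zero_add]
    have : ∀ {s t s' t' : ℤ} (h₁ : a - 1 + e + m = s) (h₂ : a - 1 + e + m = s')
        (h₃ : 0 + d = t) (h₄ : 0 + d = t') (h₅ : t + s = r) (h₆ : t' + s' = r),
        C.comp h₅ (ψ.ev h₃ (.nil V)) (G.map (Ψ.ev h₁ (.cons f c rfl))) =
        C.comp h₆ (ψ.ev h₄ (.nil V)) (G.map (Ψ.ev h₂ (.cons f c rfl))) := by
      intros; subst_vars; rfl
    exact this ..
  | @cons F₁ _ m' p' _ Ψ' P' hq _ =>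
    rw [ev_mid_insert, ev_mid_insert, br_cons_cons, ins_merge, key, ins_cons, ins_cons]
    -- In the product of `Ψ` and `Ψ'` the argument `f` goes to `Ψ'`, with `Ψ` taken in arity zero,
    -- or to `Ψ`.
    have e₁ : ∀ {s t : ℤ} (hs : a - 1 + (m + m') = s) (ht : s - 1 + d + p' = t) (h₁ : e + t = r),
        (ins (freeze (cup Ψ Ψ'.1 rfl) f hs) P' ψ ht).ev h₁ c =
        (ins (freeze (pcomp (Ψ.ev (zero_add m) (.nil z)) (Ψ'.1 z) rfl) f rfl) P' ψ rfl).ev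
          (by omega) c +
        sgn k (m' * (a - 1)) • (ins (cup (freeze Ψ f rfl) Ψ'.1 rfl) P' ψ rfl).ev (by omega) c := by
      intro s t hs ht h₁
      subst hs ht
      rw [freeze_cup (hs := rfl) (ht := by omega) (hs' := rfl) (ht' := by omega),
        ins_add_left _ _ _ hψ, ins_smul_left _ _ hψ, ev_add, ev_smul,
        freeze_pcomp (h₃ := rfl) (h₄ := by omega)]
      congr 2
      have : ∀ {s t : ℤ} (hs : a - 1 + m + m' = s) (ht : s - 1 + d + p' = t) (h₁ : e + t = r),
        (ins (cup (freeze Ψ f rfl) Ψ'.1 hs) P' ψ ht).ev h₁ c =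
        (ins (cup (freeze Ψ f rfl) Ψ'.1 rfl) P' ψ rfl).ev (by omega) c := by
        intros; subst_vars; rfl
      exact this ..
    subst hq
    rw [e₁, cup_nil]
    simp only [add_mul, sub_mul, mul_sub, mul_one, one_mul, sgn_add, sgn_sub, sgn_one]
    rcases sgn_cases k m with h | h <;> rcases sgn_cases k a with h' | h' <;> rw [h, h'] <;> module

end Raw

/-! ### The differential of the part with nothing to the left of the first block -/

namespace Raw
variable {k : Type u} [Field k] {A B C : DGCat k} {F F' F'' : DGFunctor A B}
  {G G' : DGFunctor B C} {W : C.Obj} {V V' : B.Obj} {x y z : A.Obj} {d p m e r : ℤ}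

theorem br_freeze_diff (P : Chain (Coh A B) F F' p) (ψ : Raw G W V d) {a d' s t : ℤ}
    (u : B.Hom (F'.obj y) V a) (hd : d + 1 = d') (hs : a - 1 + d' = s) (ht : s + p = t)
    (h : e + t = r) (c : Chain A x y e) :
    (br P (freeze (diff ψ hd) u hs) ht).ev h c =
      (br P (diff (freeze ψ u rfl) rfl) rfl).ev (by omega) c
      + sgn k d • (br P (freeze ψ (B.d (q := a + 1) rfl u) rfl) rfl).ev (by omega) c
      - sgn k d • (br P (merge ψ u rfl) rfl).ev (by omega) c := by
  rw [freeze_diff (h₀ := rfl) (h₂ := by omega) (h₃ := rfl) (h₄ := by omega) (h₅ := by omega),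
    br_sub, br_add, br_smul, br_smul, ev_sub, ev_add, ev_smul, ev_smul]
  have e₁ : ∀ {s t : ℤ} (hs : a - 1 + d + 1 = s) (ht : s + p = t) (h : e + t = r),
      (br P (diff (freeze ψ u rfl) hs) ht).ev h c =
      (br P (diff (freeze ψ u rfl) rfl) rfl).ev (by omega) c := by
    intros; subst_vars; rfl
  have e₂ : ∀ {s t : ℤ} (hs : a + d = s) (ht : s + p = t) (h : e + t = r),
      (br P (merge ψ u hs) ht).ev h c = (br P (merge ψ u rfl) rfl).ev (by omega) c := by
    intros; subst_vars; rfl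
  rw [e₁, e₂ (s := s), ev_br_freeze_congr (hs := by omega) (hs' := rfl) (h₂ := rfl)]

theorem ins_freeze_diff (Ψ : Raw F' V z m) (P : Chain (Coh A B) F F' p) {ψ : Raw G W V d}
    (hψ : Multilinear ψ) {a m' s t : ℤ} (f : A.Hom y z a) (hm : m + 1 = m')
    (hs : a - 1 + m' = s) (ht : s - 1 + d + p = t) (h : e + t = r) (c : Chain A x y e) :
    (ins (freeze (diff Ψ hm) f hs) P ψ ht).ev h c =
      (ins (diff (freeze Ψ f rfl) rfl) P ψ rfl).ev (by omega) c
      + sgn k m • (ins (freeze Ψ (A.d (q := a + 1) rfl f) rfl) P ψ rfl).ev (by omega) c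
      - sgn k m • (ins (merge Ψ f rfl) P ψ rfl).ev (by omega) c := by
  rw [freeze_diff (h₀ := rfl) (h₂ := by omega) (h₃ := rfl) (h₄ := by omega) (h₅ := by omega),
    ins_sub_left _ _ _ hψ, ins_add_left _ _ _ hψ, ins_smul_left _ _ hψ, ins_smul_left _ _ hψ,
    ev_sub, ev_add, ev_smul, ev_smul]
  have e₁ : ∀ {s t : ℤ} (hs : a - 1 + m + 1 = s) (ht : s - 1 + d + p = t) (h : e + t = r),
      (ins (diff (freeze Ψ f rfl) hs) P ψ ht).ev h c =
      (ins (diff (freeze Ψ f rfl) rfl) P ψ rfl).ev (by omega) c := by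
    intros; subst_vars; rfl
  have e₂ : ∀ {s t : ℤ} (hs : a + m = s) (ht : s - 1 + d + p = t) (h : e + t = r),
      (ins (merge Ψ f hs) P ψ ht).ev h c = (ins (merge Ψ f rfl) P ψ rfl).ev (by omega) c := by
    intros; subst_vars; rfl
  have e₃ : ∀ {b s t : ℤ} (f : A.Hom y z b) (hs : b - 1 + m = s) (ht : s - 1 + d + p = t)
      (h : e + t = r), (ins (freeze Ψ f hs) P ψ ht).ev h c =
        (ins (freeze Ψ f rfl) P ψ rfl).ev (by omega) c := by
    intros; subst_vars; rfl
  rw [e₁, e₂ (s := s), e₃ _ (by omega)]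

/-- The formula for the differential of `ψ{Ψ_k, …, Ψ₁}`. -/
def DiffFormula (G : DGFunctor B C) (W : C.Obj) (P : Chain (Coh A B) F F' p) : Prop :=
  ∀ {x y : A.Obj} {e d d' d'' r : ℤ} {ψ : Raw G W (F'.obj y) d} (_ : Multilinear ψ)
    (hd : d + p = d') (hd' : d' + 1 = d'') (h : e + d'' = r) (c : Chain A x y e),
    (diff (br P ψ hd) hd').ev h c = (br P (diff ψ rfl) rfl).ev (by omega) c
      - sgn k d • (brBd P ψ rfl).ev (by omega) c

/-- By `ins_cons` the family is a brace with `P`, to which `HP` applies, plus an `ins` on the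
remaining arguments, covered by induction. Freezing `diff ψ` at a value `v` of `Ψ` yields a term
with `dv`, which belongs to `diff Ψ`, and a term in which `v` is merged into the next entry. If that
entry is `F'(f)`, the term is an outer term of `diff Ψ`; the others make up `mid`. The two
corrections, in `merge_ins` and in `mid_cons`, cancel. No left action on `Ψ` can arise, since no
entry stands to the left of its value. -/
theorem diff_ins {P : Chain (Coh A B) F F' p} (HP : DiffFormula G W P) (c : Chain A x y e) :
    ∀ {V : B.Obj} {m d d' d'' r : ℤ} (Ψ : Raw F' V y m) {ψ : Raw G W V d} (_ : Multilinear ψ)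
      (hd : m - 1 + d + p = d') (hd' : d' + 1 = d'') (h : e + d'' = r),
    (diff (ins Ψ P ψ hd) hd').ev h c = (ins Ψ P (diff ψ rfl) rfl).ev (by omega) c
      - sgn k d • (ins (diff Ψ rfl) P ψ rfl).ev (by omega) c
      + sgn k d • (mid P Ψ ψ rfl).ev (by omega) c
      - sgn k (m - 1 + d) • (insBd Ψ P ψ rfl).ev (by omega) c := by
  induction c with
  | nil =>
    intro V m d d' d'' r Ψ ψ hψ hd hd' h
    subst hd hd'
    -- On the empty chain `diff` depends only on the value there. It may hence be folded back around
    -- the brace with `P`, to which `HP` applies.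
    rw [diff_nil, ins_nil, ← diff_nil (hd := rfl) (h := h), HP (hψ.freeze _ _), ins_nil, ins_nil,
      mid_nil, insBd_nil, br_freeze_diff, diff_nil]
    module
  | @cons y z a e e' f c h' ih =>
    intro V m d d' d'' r Ψ ψ hψ hd hd' h
    subst hd hd' h'
    rw [diff_peel (φ := ins Ψ P ψ rfl) (φ₁ := ins (freeze Ψ f rfl) P ψ rfl)
      (φ₀ := br P (freeze ψ (Ψ.ev (zero_add m) (.nil z)) rfl) rfl)
      (hd₀ := rfl) (hd₁ := rfl) (hs₁ := rfl) (hs₂ := rfl) rfl (by omega)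
      (fun c h => ins_cons Ψ P ψ rfl f c rfl h), HP (hψ.freeze _ _), ih _ hψ,
      ins_cons, ins_cons, merge_ins _ _ hψ,
      ins_cons, mid_cons _ _ hψ, insBd_cons, br_freeze_diff, ins_freeze_diff _ _ hψ, diff_nil]
    simp only [add_mul, mul_sub, mul_one, one_mul, add_sub_cancel_right, sgn_add,
      sgn_sub, sgn_one]
    -- The two sides differ by squares of signs; for each choice of the values `±1` the identity
    -- becomes linear.
    rcases sgn_cases k p with h₁ | h₁ <;> rcases sgn_cases k a with h₂ | h₂ <;> rw [h₁, h₂] <;>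
      module

end Raw

/-! ### Recursions for sums over boundary terms of a chain -/

namespace Chain
variable {k : Type u} [Field k] {C : DGCat k} {x y z w : C.Obj} {a b e e' e'' : ℤ}
  {M : Type*} [AddCommGroup M]

theorem sum_bdTerms_cons_nil [Module k M] (f : C.Hom x z a) (h : a - 1 + 0 = e')
    (φ : Chain C x z (e' + 1) → M) :
    (((cons f (nil x) h).bdTerms).map fun t => t.1 • φ t.2).sum =
      φ (cons (C.d (q := a + 1) rfl f) (nil x) (by omega)) := by
  simp [bdTerms, dTerms, mTerms]

/-- Only two boundary terms touch `f`: its differential and its product with the neighbour `g`. In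
all others `f` is carried along, at the cost of its shifted sign. -/
theorem sum_bdTerms_cons_cons [Module k M] (f : C.Hom y z a) (g : C.Hom w y b) (c : Chain C x w e)
    (h : b - 1 + e = e') (h' : a - 1 + e' = e'') (φ : Chain C x z (e'' + 1) → M) :
    (((cons f (cons g c h) h').bdTerms).map fun t => t.1 • φ t.2).sum =
      φ (cons (C.d (q := a + 1) rfl f) (cons g c h) (by omega))
      + sgn k (a - 1) • φ (cons (C.comp (r := a + b) rfl f g) c (by omega))
      + sgn k (a - 1) • ((cons g c h).bdTerms.map fun t =>
          t.1 • φ (cons f t.2 (by omega))).sum := by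
  rw [bdTerms, dTerms, mTerms, bdTerms]
  simp only [List.map_append, List.map_cons, List.sum_append, List.sum_cons, List.map_map,
    Function.comp_def, mul_smul, one_smul]
  have : ∀ l : List (k × Chain C x y (e' + 1)),
      (l.map fun t => sgn k (a - 1) • t.1 • φ (cons f t.2 (by omega))).sum =
      sgn k (a - 1) • (l.map fun t => t.1 • φ (cons f t.2 (by omega))).sum := by
    intro l
    rw [List.smul_sum, List.map_map]
    rfl
  rw [this, this]
  module

theorem sum_bdTerms_nil (φ : k × Chain C x x (0 + 1) → M) :
    ((nil x).bdTerms.map φ).sum = 0 := by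
  simp [bdTerms, dTerms, mTerms]

theorem sum_lasts_nil (φ : Last C x x 0 → M) : ((nil x).lasts.map φ).sum = 0 := by
  simp [lasts]

theorem sum_lasts_cons_nil (f : C.Hom x z a) (h : a - 1 + 0 = e') (φ : Last C x z e' → M) :
    ((cons f (nil x) h).lasts.map φ).sum = φ ⟨nil z, f, by omega⟩ := by
  simp [lasts]

theorem sum_lasts_cons_cons (f : C.Hom y z a) (g : C.Hom w y b) (c : Chain C x w e)
    (h : b - 1 + e = e') (h' : a - 1 + e' = e'') (φ : Last C x z e'' → M) :
    ((cons f (cons g c h) h').lasts.map φ).sum = ((cons g c h).lasts.map fun s =>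
      φ ⟨cons f s.init rfl, s.f, by have := s.h; omega⟩).sum := by
  rw [lasts, List.map_map]
  rfl

end Chain
-- Boundary of a chain of cochains, sorted by its first member
namespace Raw
variable {k : Type u} [Field k] {A B C : DGCat k} {F F' F'' : DGFunctor A B}
  {G G' : DGFunctor B C} {W : C.Obj} {V V' : B.Obj} {x y z : A.Obj} {d p m e r : ℤ}

theorem ev_br_congr (P : Chain (Coh A B) F F' p) (ψ : Raw G W (F'.obj y) d) {d₁ d₂ : ℤ}
    (h₁ : d + p = d₁) (h₂ : d + p = d₂) (h : e + d₁ = r) (h' : e + d₂ = r) (c : Chain A x y e) :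
    (br P ψ h₁).ev h c = (br P ψ h₂).ev h' c := by
  subst h₁ h₂; rfl

theorem ev_br_cons_congr {Ψ : (Coh A B).Hom F' F'' m} {P : Chain (Coh A B) F F' p} {q : ℤ}
    (hq : m - 1 + p = q) (ψ : Raw G W (F''.obj y) d) {d' : ℤ} (hd : d + q = d') (h : e + d' = r)
    (c : Chain A x y e) : (br (.cons Ψ P hq) ψ hd).ev h c =
      (br (.cons Ψ P rfl) ψ rfl).ev (by omega) c := by
  subst hq hd; rfl

/-- The base of the induction on `P`: a brace without insertions is precomposition with `F`, which
preserves differentials and composites and therefore commutes with `diff`. -/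
theorem br_nil_diff (c : Chain A x y e) : ∀ {d d' d'' r : ℤ} (ψ : Raw G W (F.obj y) d)
    (hd : d + 0 = d') (hd' : d' + 1 = d'') (h : e + d'' = r),
    (diff (br (.nil F) ψ hd) hd').ev h c = (br (.nil F) (diff ψ rfl) rfl).ev (by omega) c := by
  induction c with
  | nil =>
    intro d d' d'' r ψ hd hd' h
    obtain rfl : d = d' := by omega
    subst hd'
    rw [diff_nil, br_nil_nil, br_nil_nil, diff_nil]
  | @cons y z a e e' f c h' ih =>
    intro d d' d'' r ψ hd hd' h
    obtain rfl : d = d' := by omega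
    subst hd' h'
    have e₀ : freeze (br (.nil F) ψ hd) f rfl = br (.nil F) (freeze ψ (F.map f) rfl)
        (add_zero _) := by
      refine ext_ev fun {x e r} h c => ?_
      rw [ev_freeze', br_nil_cons]
      exact ev_br_congr ..
    have e₁ : ∀ {s : ℤ} (hs : a + d = s) {r : ℤ} (h : e + s = r),
        (merge (br (.nil F) ψ hd) f hs).ev h c =
          (br (.nil F) (merge ψ (F.map f) rfl) rfl).ev (by omega) c := by
      intro s hs r h
      subst hs
      cases c with
      | nil =>
        rw [ev_merge_nil, br_nil_nil, br_nil_nil, ev_merge_nil]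
        rfl
      | cons g c h' =>
        rw [ev_merge_cons', br_nil_cons, br_nil_cons, DGFunctor.map_comp,
          freeze_merge (hab := rfl) (hs' := by omega), br_smul, ev_smul]
        exact congrArg _ (ev_br_freeze_congr ..)
    rw [diff_cons, e₀, ih, ev_freeze', br_nil_cons, br_nil_cons, br_freeze_diff, e₁,
      DGFunctor.map_d]

/-- The terms of `ψ{Ψ, Ψ_k, …, Ψ₁}` in which `Ψ` is multiplied with `Ψ_k`; for `k = 0`, the
family `ψ ∪ G(Ψ)`. -/
def brMid : ∀ {F' : DGFunctor A B} {p : ℤ}, Chain (Coh A B) F F' p →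
    ∀ {F'' : DGFunctor A B} {m d d' : ℤ}, (Coh A B).Hom F' F'' m → Raw G W (F''.obj y) d →
    m + d + p = d' → Raw (G.comp F) W y d'
  | _, _, .nil _, F'', _, _, _, Ψ, ψ, _ =>
      cup (br (.nil F'') ψ rfl) (fun y => push G (Ψ.1 y)) (by omega)
  | _, _, .cons Ψ' P _, _, m, _, _, Ψ, ψ, _ =>
      sgn k m • br (.cons ((Coh A B).comp rfl Ψ Ψ') P rfl) ψ (by omega)

/-- The terms of the differential of `ψ{Ψ, Ψ_k, …, Ψ₁}` which do not affect `Ψ`. -/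
def brConsBd (Ψ : (Coh A B).Hom F' F'' m) (P : Chain (Coh A B) F F' p)
    (ψ : Raw G W (F''.obj y) d) {d' : ℤ} (hd : d + m + p = d') : Raw (G.comp F) W y d' :=
  fun _ _ c => (P.bdTerms.map fun t => t.1 • (br (.cons Ψ t.2 rfl) ψ rfl).ev (by omega) c).sum
    - (P.lasts.map fun s => sgn k s.e₁ •
      (cup (br (.cons Ψ s.init rfl) ψ rfl) (fun y => push G (s.f.1 y)) rfl).ev
        (by have := s.h; omega) c).sum

theorem ev_brConsBd (Ψ : (Coh A B).Hom F' F'' m) (P : Chain (Coh A B) F F' p)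
    (ψ : Raw G W (F''.obj y) d) {d' : ℤ} (hd : d + m + p = d') (h : e + d' = r)
    (c : Chain A x y e) : (brConsBd Ψ P ψ hd).ev h c =
      (P.bdTerms.map fun t => t.1 • (br (.cons Ψ t.2 rfl) ψ rfl).ev (by omega) c).sum
    - (P.lasts.map fun s => sgn k s.e₁ •
      (cup (br (.cons Ψ s.init rfl) ψ rfl) (fun y => push G (s.f.1 y)) rfl).ev
        (by have := s.h; omega) c).sum := by
  subst h; rfl

/-- The terms concerning `Ψ` are its differential and its product with the next cochain. If `P` is
empty, the latter is replaced by the cup product with `G(Ψ)`, which enters the boundary with a minus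
sign. If not, the product carries the sign of `m - 1`, opposite to that of `m`. The sign in `brMid`
makes both cases read the same. -/
theorem ev_brBd_cons (Ψ : (Coh A B).Hom F' F'' m) (P : Chain (Coh A B) F F' p) {q : ℤ}
    (hq : m - 1 + p = q) (ψ : Raw G W (F''.obj y) d) {d' : ℤ} (hd : d + q + 1 = d')
    (h : e + d' = r) (c : Chain A x y e) :
    (brBd (.cons Ψ P hq) ψ hd).ev h c =
      (br (.cons ((Coh A B).d rfl Ψ) P rfl) ψ rfl).ev (by omega) c
      - (brMid P Ψ ψ rfl).ev (by omega) c
      + sgn k (m - 1) • (brConsBd Ψ P ψ rfl).ev (by omega) c := by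
  subst hq hd
  induction P using Chain.cohInduction with
  | nil =>
    have e₁ := Chain.sum_bdTerms_cons_nil (C := Coh A B) Ψ rfl
      (fun t => (br t ψ rfl).ev (r := r) (by omega) c)
    have e₂ := (Chain.sum_lasts_cons_nil (C := Coh A B) Ψ rfl
      (fun s => sgn k s.e₁ • (cup (br s.init ψ rfl) (fun y => push G (s.f.1 y)) rfl).ev
        (r := r) (by have := s.h; omega) c)).trans
      ((congrArg (· • _) (sgn_zero k)).trans (one_smul ..))
    have e₃ := Chain.sum_bdTerms_nil (C := Coh A B) (x := F)
      (fun t => t.1 • (br (.cons Ψ t.2 rfl) ψ rfl).ev (r := r) (by omega) c)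
    have e₄ := Chain.sum_lasts_nil (C := Coh A B) (x := F)
      (fun s => sgn k s.e₁ • (cup (br (.cons Ψ s.init rfl) ψ rfl)
        (fun y => push G (s.f.1 y)) rfl).ev (r := r) (by have := s.h; omega) c)
    rw [ev_brBd, e₁, e₂, ev_brConsBd, e₃, e₄, ev_br_cons_congr, sub_zero, smul_zero]
    refine Eq.trans (congrArg _ ?_) (add_zero _).symm
    have : ∀ {s t : ℤ} (h₁ : d + 0 + m = s) (h₂ : d + 0 + m = t) (h : e + s = r) (h' : e + t = r),
        (cup (G := G.comp F'') (br (.nil F'') ψ rfl) (fun y => push G (Ψ.1 y)) h₁).ev h c =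
        (cup (G := G.comp F'') (br (.nil F'') ψ rfl) (fun y => push G (Ψ.1 y)) h₂).ev h' c := by
      intros; subst_vars; rfl
    exact this _ (by omega) _ _
  | @cons _ F₁ m' p' q Ψ' P hq _ =>
    have e₁ := Chain.sum_bdTerms_cons_cons (C := Coh A B) Ψ Ψ' P hq rfl
      (fun t => (br t ψ rfl).ev (r := r) (by omega) c)
    have e₂ := Chain.sum_lasts_cons_cons (C := Coh A B) Ψ Ψ' P hq rfl
      (fun s => sgn k s.e₁ • (cup (br s.init ψ rfl) (fun y => push G (s.f.1 y)) rfl).ev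
        (r := r) (by have := s.h; omega) c)
    have e₃ : ∀ L : List (k × Chain (Coh A B) F F₁ (q + 1)),
        (L.map fun t => t.1 • (br (.cons Ψ t.2 (e' := m - 1 + q + 1) (by omega)) ψ rfl).ev (r := r)
          (by omega) c) =
        L.map fun t => t.1 • (br (.cons Ψ t.2 rfl) ψ rfl).ev (r := r) (by omega) c := by
      intro L
      refine List.map_congr_left fun t _ => ?_
      rw [ev_br_cons_congr]
    have e₄ := List.smul_sum (r := sgn k (m - 1)) (l := (Chain.cons Ψ' P hq).lasts.map fun s =>
      sgn k s.e₁ • (cup (br (.cons Ψ s.init rfl) ψ rfl)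
        (fun y => push G (s.f.1 y)) rfl).ev (r := r) (by have := s.h; omega) c)
    rw [List.map_map] at e₄
    have e₅ : (brMid (.cons Ψ' P hq) Ψ ψ rfl).ev (r := r) (by omega) c =
        sgn k m • (br (.cons ((Coh A B).comp rfl Ψ Ψ') P rfl) ψ rfl).ev (by omega) c := by
      have : ∀ {s : ℤ} (h₁ : d + (m + m' - 1 + p') = s) (h : e + s = r),
          (sgn k m • br (.cons ((Coh A B).comp rfl Ψ Ψ') P rfl) ψ h₁).ev h c =
          sgn k m • (br (.cons ((Coh A B).comp rfl Ψ Ψ') P rfl) ψ rfl).ev (by omega) c := by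
        intro s h₁ h
        subst h₁
        exact ev_smul ..
      exact this (by omega) _
    rw [ev_brBd, e₁, e₂, ev_brConsBd, e₃, e₅, smul_sub, e₄, ev_br_cons_congr,
      ev_br_cons_congr (Ψ := (Coh A B).comp rfl Ψ Ψ')]
    simp only [Function.comp_def, smul_smul, ← sgn_add]
    simp only [sgn_sub, sgn_one]
    module

end Raw

/-! ### The differential of a brace: induction on the number of cochains -/

namespace Raw
variable {k : Type u} [Field k] {A B C : DGCat k} {F F' F'' : DGFunctor A B}
  {G G' : DGFunctor B C} {W : C.Obj} {V V' : B.Obj} {x y z : A.Obj} {d p m e r : ℤ}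

theorem comp_ev_congr (ψ : Raw G W V d) {U : C.Obj} {y : B.Obj} {s t q e : ℤ} (c : Chain B y V e)
    (h₁ : e + d = s) (h₂ : e + d = t) (h : s + q = r) (h' : t + q = r)
    (u : C.Hom U (G.obj y) q) : C.comp h (ψ.ev h₁ c) u = C.comp h' (ψ.ev h₂ c) u := by
  subst h₁ h₂; rfl

theorem brMid_empty (Ψ : (Coh A B).Hom F F'' m) (ψ : Raw G W (F''.obj y) d) {d' : ℤ}
    (hd : d + m = d') (h : e + d' = r) (c : Chain A x y e) :
    (brMid (.nil F) Ψ ψ rfl).ev (r := r) (by omega) c =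
      (cup (G := G.comp F'') (br (.nil F'') ψ rfl) (fun y => push G (Ψ.1 y)) rfl).ev (by omega) c := by
  have : ∀ {s t : ℤ} (h₁ : d + 0 + m = s) (h₂ : d + 0 + m = t) (h : e + s = r) (h' : e + t = r),
      (cup (G := G.comp F'') (br (.nil F'') ψ rfl) (fun y => push G (Ψ.1 y)) h₁).ev h c =
      (cup (G := G.comp F'') (br (.nil F'') ψ rfl) (fun y => push G (Ψ.1 y)) h₂).ev h' c := by
    intros; subst_vars; rfl
  exact this (by omega) (by omega) _ _

theorem ev_brMid_cons {Ψ' : (Coh A B).Hom F' F'' m} {P : Chain (Coh A B) F F' p} {q m' : ℤ}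
    (hq : m - 1 + p = q) {F₃ : DGFunctor A B} (Ψ : (Coh A B).Hom F'' F₃ m')
    (ψ : Raw G W (F₃.obj y) d) {d' : ℤ}
    (hd : m' + d + q = d') (h : e + d' = r) (c : Chain A x y e) :
    (brMid (.cons Ψ' P hq) Ψ ψ hd).ev h c =
      sgn k m' • (br (.cons ((Coh A B).comp rfl Ψ Ψ') P rfl) ψ rfl).ev (by omega) c := by
  obtain rfl : d' = d + (m' + m - 1 + p) := by omega
  exact ev_smul ..

theorem freeze_br_nil (ψ : Raw G W (F.obj z) d) {a d' s t : ℤ} (f : A.Hom y z a) (hd : d + 0 = d')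
    (hs : a - 1 + d' = s) (ht : t + 0 = s) (ht' : a - 1 + d = t) :
    freeze (br (.nil F) ψ hd) f hs = br (.nil F) (freeze ψ (F.map f) ht') ht := by
  refine ext_ev fun {x e r} h c => ?_
  rw [ev_freeze', br_nil_cons, ev_br_freeze_congr]

/-- With no arguments to place on the left of `Ψ`, the products seen by the whole brace are those
seen by `ins`. -/
theorem brMid_nil (P : Chain (Coh A B) F F' p) (Ψ : (Coh A B).Hom F' F'' m)
    (ψ : Raw G W (F''.obj y) d) (h : 0 + (m + d + p) = r) :
    (brMid P Ψ ψ rfl).ev h (.nil y) = (mid P (Ψ.1 y) ψ rfl).ev h (.nil y) := by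
  induction P using Chain.cohInduction with
  | nil =>
    rw [brMid_empty (hd := rfl) (h := by omega), mid_empty, cup_nil, br_nil_nil,
      ev_pcomp (hs := zero_add _), ev_pcomp (hs := zero_add _)]
    exact comp_ev_congr ψ ..
  | cons Ψ' P' hq _ =>
    rw [ev_brMid_cons, ev_mid_insert, br_cons_nil]
    rfl

/-- The analogue of `br_cons_cons`: either nothing stands to the left of `Ψ`, or `f` does, entering
`ψ` as `F''(f)`. The product of two cochains, and likewise `G(Ψ)`, is shifted one time less than the
separate factors, so that `f` passes degree `m + p`. -/
theorem brMid_peel (P : Chain (Coh A B) F F' p) (Ψ : (Coh A B).Hom F' F'' m)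
    (ψ : Raw G W (F''.obj z) d) {a e' : ℤ} (f : A.Hom y z a) (c : Chain A x y e)
    (h' : a - 1 + e = e') (h : e' + (m + d + p) = r) :
    (brMid P Ψ ψ rfl).ev h (.cons f c h') = (mid P (Ψ.1 z) ψ rfl).ev h (.cons f c h')
      + sgn k ((m + p) * (a - 1)) •
        (brMid P Ψ (freeze ψ (F''.map f) rfl) rfl).ev (by omega) c := by
  induction P using Chain.cohInduction with
  | nil =>
    rw [brMid_empty (hd := rfl) (h := by omega), brMid_empty (hd := rfl) (h := by omega),
      mid_empty, cup_cons (s := a - 1 + d + 0) (hs := by omega) (ht := rfl), br_nil_nil,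
      freeze_br_nil (ht := rfl) (ht' := rfl),
      ev_pcomp (hs := rfl), ev_pcomp (hs := rfl)]
    simp only [add_zero]
    congr 1
    exact comp_ev_congr ψ ..
  | cons Ψ' P' hq _ =>
    rw [ev_brMid_cons, ev_brMid_cons, ev_mid_insert, br_cons_cons, smul_add, smul_comm]
    congr 3
    subst hq
    ring

theorem brConsBd_nil (Ψ : (Coh A B).Hom F' F'' m) (P : Chain (Coh A B) F F' p)
    (ψ : Raw G W (F''.obj y) d) (h : 0 + (d + m + p) = r) :
    (brConsBd Ψ P ψ rfl).ev h (.nil y) = (insBd (Ψ.1 y) P ψ rfl).ev (by omega) (.nil y) := by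
  rw [ev_brConsBd, ev_insBd]
  congr 2
  · refine List.map_congr_left fun t _ => ?_
    rw [br_cons_nil]
  · refine List.map_congr_left fun s _ => ?_
    congr 1
    exact cup_nil_congr (by omega) (fun h => br_cons_nil (hq := rfl) ..) ..

theorem brConsBd_peel (Ψ : (Coh A B).Hom F' F'' m) (P : Chain (Coh A B) F F' p)
    (ψ : Raw G W (F''.obj z) d) {a e' : ℤ} (f : A.Hom y z a) (c : Chain A x y e)
    (h' : a - 1 + e = e') (h : e' + (d + m + p) = r) :
    (brConsBd Ψ P ψ rfl).ev h (.cons f c h') = (insBd (Ψ.1 z) P ψ rfl).ev (by omega) (.cons f c h')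
      + sgn k ((m + p) * (a - 1)) •
        (brConsBd Ψ P (freeze ψ (F''.map f) rfl) rfl).ev (by omega) c := by
  have e1 := sum_map_lin (l := P.bdTerms)
    (φ := fun t => t.1 • (br (.cons Ψ t.2 rfl) ψ rfl).ev (r := r) (by omega) (.cons f c h'))
    (φ₁ := fun t => t.1 • (ins (Ψ.1 z) t.2 ψ rfl).ev (r := r) (by omega) (.cons f c h'))
    (φ₂ := fun t => t.1 • (br (.cons Ψ t.2 rfl) (freeze ψ (F''.map f) rfl) rfl).ev (r := r)
      (by omega) c)
    (s := sgn k ((m + p) * (a - 1))) (fun t _ => by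
      rw [br_cons_cons, smul_add, smul_comm]
      congr 4
      ring)
  have e2 := sum_map_lin (l := P.lasts)
    (φ := fun s => sgn k s.e₁ • (cup (br (.cons Ψ s.init rfl) ψ rfl)
      (fun y => push G (s.f.1 y)) rfl).ev (r := r) (by have := s.h; omega) (.cons f c h'))
    (φ₁ := fun s => sgn k s.e₁ • (cup (ins (Ψ.1 z) s.init ψ rfl)
      (fun y => push G (s.f.1 y)) rfl).ev (r := r) (by have := s.h; omega) (.cons f c h'))
    (φ₂ := fun s => sgn k s.e₁ • (cup (br (.cons Ψ s.init rfl) (freeze ψ (F''.map f) rfl) rfl)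
      (fun y => push G (s.f.1 y)) rfl).ev (r := r) (by have := s.h; omega) c)
    (s := sgn k ((m + p) * (a - 1))) (fun s _ => by
      have := cup_peel (A := A) (φ := br (.cons Ψ s.init rfl) ψ rfl)
        (φ₀ := ins (Ψ.1 z) s.init ψ rfl)
        (φ₁ := br (.cons Ψ s.init rfl) (freeze ψ (F''.map f) rfl) rfl)
        (hd := rfl) (hd₀ := rfl) (hd₁ := rfl) (r := r) (by omega) (by omega)
        (fun h => br_cons_nil rfl ψ rfl h)
        (fun c h => br_cons_cons rfl ψ rfl f c rfl h) (χ := fun y => push G (s.f.1 y)) c h'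
        (by have := s.h; omega)
      rw [this, smul_add, smul_comm, ← sgn_add]
      congr 4
      linear_combination (a - 1) * s.h)
  rw [ev_brConsBd, ev_insBd, ev_brConsBd, e1, e2]
  module

theorem ins_lact_nil (Ψ : ∀ y, Raw F' (F''.obj y) y m) (P : Chain (Coh A B) F F' p)
    {ψ : Raw G W (F''.obj y) d} (hψ : Multilinear ψ) {m' d' : ℤ} (hm : m + 1 = m')
    (hd : m' - 1 + d + p = d') (h : 0 + d' = r) :
    (ins (lact Ψ hm : Raw F' (F''.obj y) y m') P ψ hd).ev h (.nil y) = 0 := by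
  rw [ins_nil, lact_nil, hψ.freeze_zero, br_zero, ev_zero]

/-- The left action vanishes on the empty block. The block therefore begins with `f`, which acts by
composition with `F''(f)`. -/
theorem ins_lact_cons (Ψ : ∀ y, Raw F' (F''.obj y) y m) (P : Chain (Coh A B) F F' p)
    {ψ : Raw G W (F''.obj z) d} (hψ : Multilinear ψ) {m' d' a e' : ℤ} (hm : m + 1 = m')
    (hd : m' - 1 + d + p = d') (f : A.Hom y z a) (c : Chain A x y e) (h' : a - 1 + e = e')
    (h : e' + d' = r) :
    (ins (lact Ψ hm : Raw F' (F''.obj z) z m') P ψ hd).ev h (.cons f c h') =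
      sgn k ((p + m) * (a - 1)) •
        (ins (pcomp (F''.map f) (Ψ y) rfl) P ψ rfl).ev (by omega) c := by
  rw [ins_cons, lact_nil, hψ.freeze_zero, br_zero, ev_zero, zero_add,
    freeze_lact (hs := by omega), ins_smul_left _ _ hψ, ev_smul, smul_smul, ← sgn_add, add_mul]
  congr 1
  have : ∀ {s t : ℤ} (h₁ : a + m = s) (h₂ : s - 1 + d + p = t) (h₃ : e + t = r),
      (ins (pcomp (F''.map f) (Ψ y) h₁) P ψ h₂).ev h₃ c =
      (ins (pcomp (F''.map f) (Ψ y) rfl) P ψ rfl).ev (by omega) c := by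
    intros; subst_vars; rfl
  exact this ..

theorem ins_delta (Ψ : ∀ y, Raw F' (F''.obj y) y m) (P : Chain (Coh A B) F F' p)
    {ψ : Raw G W (F''.obj y) d} (hψ : Multilinear ψ) {m' d' : ℤ} (hm : m + 1 = m')
    (hd : m' - 1 + d + p = d') (h : e + d' = r) (c : Chain A x y e) :
    (ins (delta Ψ hm y) P ψ hd).ev h c =
      (ins (diff (Ψ y) rfl) P ψ rfl).ev (by omega) c
        + (ins (lact Ψ hm : Raw F' (F''.obj y) y m') P ψ hd).ev h c := by
  subst hm hd
  rw [← ev_add, ← ins_add_left _ _ _ hψ]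
  rfl

theorem diff_nil_congr {K : DGFunctor A C} {φ : Raw K W y d} {d₀ d' d'' : ℤ} {φ₀ : Raw K W y d₀}
    (h₀ : d₀ = d) (Hnil : ∀ {r} (h : 0 + d = r), φ.ev h (.nil y) = φ₀.ev (by omega) (.nil y))
    (hd : d + 1 = d') (hd₀ : d₀ + 1 = d'') (h : 0 + d' = r) :
    (diff φ hd).ev h (.nil y) = (diff φ₀ hd₀).ev (by omega) (.nil y) := by
  subst h₀ hd₀ hd
  rw [diff_nil, diff_nil, Hnil]

/-- By `br_cons_cons` the brace is an `ins`, covered by `diff_ins`, plus a brace on the remaining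
arguments, covered by the inner induction. The first part yields `diff Ψ` only. The missing left
action in `dΨ` is the correction in `merge_br`: by `ins_merge` it inserts `F''(f) Ψ(…)`, and
`ins_lact_cons` identifies this with the left action. -/
theorem diffFormula_cons (Ψ : (Coh A B).Hom F' F'' m) {P : Chain (Coh A B) F F' p}
    (HP : DiffFormula G W P) {q : ℤ} (hq : m - 1 + p = q) :
    DiffFormula G W (.cons Ψ P hq) := by
  intro x y e d d' d'' r ψ hψ hd hd' h c
  subst hq
  induction c generalizing d d' d'' r with
  | nil =>
    subst hd hd'
    -- Without arguments there is no left action, and `dΨ` may be replaced by `diff Ψ`.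
    have e₁ := ins_delta Ψ.1 P hψ rfl rfl (r := r) (by omega) (.nil x)
    rw [ins_lact_nil _ _ hψ, add_zero] at e₁
    have e₂ : (br (.cons ((Coh A B).d rfl Ψ) P rfl) ψ rfl).ev (by omega) (.nil x) =
      (ins (diff (Ψ.1 x) rfl) P ψ rfl).ev (r := r) (by omega) (.nil x) := (br_cons_nil ..).trans e₁
    rw [diff_nil_congr (φ₀ := ins (Ψ.1 x) P ψ rfl) (hd₀ := rfl) (by omega)
      (fun h => br_cons_nil rfl ψ rfl h), diff_ins HP _ _ hψ,
      br_cons_nil, ev_brBd_cons (hd := rfl), brMid_nil, brConsBd_nil, e₂]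
    simp only [sgn_add]
    module
  | @cons y z a e e' f c h' ih =>
    subst hd hd' h'
    have e₁ := ins_delta Ψ.1 P hψ rfl rfl (r := r) (by omega) (.cons f c rfl)
    rw [ins_lact_cons _ _ hψ] at e₁
    have e₂ : ∀ {e r : ℤ} (c : Chain A x z e) (h : e + (d + (m + 1 - 1 + p)) = r),
        (ins (((Coh A B).d (q := m + 1) rfl Ψ).1 z) P ψ rfl).ev (r := r) (by omega) c =
        (ins (delta Ψ.1 (d' := m + 1) rfl z) P ψ rfl).ev (r := r) (by omega) c := fun _ _ => rfl
    rw [diff_peel (φ := br (.cons Ψ P rfl) ψ rfl)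
      (φ₀ := ins (Ψ.1 z) P ψ rfl) (φ₁ := br (.cons Ψ P rfl) (freeze ψ (F''.map f) rfl) rfl)
      (hd₀ := rfl) (hd₁ := rfl) (hs₁ := rfl) (hs₂ := rfl) (by omega) (by omega)
      (fun c h => br_cons_cons rfl ψ rfl f c rfl h), diff_ins HP _ _ hψ, ih (hψ.freeze (F''.map f) rfl) rfl (by omega) rfl,
      br_cons_cons, br_cons_cons, merge_br, ins_merge, br_freeze_diff, ev_brBd_cons (hd := rfl),
      ev_brBd_cons (hd := rfl), br_cons_cons, e₂ _ (by omega), e₁, brMid_peel, brConsBd_peel,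
      DGFunctor.map_d]
    simp only [add_mul, sub_mul, mul_sub, mul_one, one_mul, add_sub_cancel_right, sgn_add,
      sgn_sub, sgn_one]
    rcases sgn_cases k p with h₁ | h₁ <;> rcases sgn_cases k a with h₂ | h₂ <;> rw [h₁, h₂] <;>
      module

theorem ev_brBd_nil (ψ : Raw G W (F.obj y) d) {d' : ℤ} (hd : d + 0 + 1 = d') (h : e + d' = r)
    (c : Chain A x y e) : (brBd (.nil F) ψ hd).ev h c = 0 := by
  have e₁ := Chain.sum_bdTerms_nil (C := Coh A B) (x := F)
    (fun t => t.1 • (br t.2 ψ rfl).ev (r := r) (by omega) c)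
  have e₂ := Chain.sum_lasts_nil (C := Coh A B) (x := F)
    (fun s => sgn k s.e₁ • (cup (br s.init ψ rfl) (fun y => push G (s.f.1 y)) rfl).ev
      (r := r) (by have := s.h; omega) c)
  rw [ev_brBd]
  exact (congrArg₂ _ e₁ e₂).trans (sub_zero 0)

theorem diffFormula (P : Chain (Coh A B) F F' p) : DiffFormula G W P := by
  induction P using Chain.cohInduction with
  | nil =>
    intro x y e d d' d'' r ψ hψ hd hd' h c
    rw [br_nil_diff, ev_brBd_nil, smul_zero, sub_zero]
  | cons Ψ P hq HP => exact diffFormula_cons Ψ HP hq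

end Raw

/-! ### The left action and the cup product under braces -/

namespace Chain
variable {k : Type u} [Field k] {C : DGCat k} {x y z : C.Obj} {a e e' : ℤ}
  {M : Type*} [AddCommGroup M]

theorem sum_splits_nil (φ : Split C x x 0 → M) :
    ((nil x).splits.map φ).sum = φ ⟨nil x, nil x, add_zero 0⟩ := by
  simp [splits]

theorem sum_splits_cons (f : C.Hom y z a) (c : Chain C x y e) (h : a - 1 + e = e')
    (φ : Split C x z e' → M) : ((cons f c h).splits.map φ).sum =
      φ ⟨nil z, cons f c h, zero_add e'⟩ + (c.splits.map fun s =>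
        φ ⟨cons f s.left rfl, s.right, by have := s.h; omega⟩).sum := by
  rw [splits, List.map_cons, List.sum_cons, List.map_map]
  rfl

end Chain
namespace Raw
variable {k : Type u} [Field k] {A B C : DGCat k} {F F' F'' : DGFunctor A B}
  {G G' : DGFunctor B C} {W : C.Obj} {V V' : B.Obj} {x y z : A.Obj} {d d₁ d₂ n p m e r : ℤ}

theorem comp_ev_congr₂ (ψ : Raw G W V d) {K : DGFunctor A C} (φ : Raw K (G.obj V) y d₁)
    {s t s' t' e' : ℤ} (b : Chain B V V e') (c : Chain A x y e)
    (h₁ : e' + d = s) (h₂ : e' + d = t) (h₁' : e + d₁ = s') (h₂' : e + d₁ = t')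
    (h : s + s' = r) (h' : t + t' = r) :
    C.comp h (ψ.ev h₁ b) (φ.ev h₁' c) = C.comp h' (ψ.ev h₂ b) (φ.ev h₂' c) := by
  subst h₁ h₂ h₁' h₂'; rfl

theorem br_pcomp (P : Chain (Coh A B) F F' p) {U : C.Obj} {a s t v : ℤ} (u : C.Hom U W a)
    (ψ : Raw G U (F'.obj y) d) (hs : a + d = s) (ht : s + p = t) (hv : d + p = v)
    (hv' : a + v = t) : br P (pcomp u ψ hs) ht = pcomp u (br P ψ hv) hv' := by
  refine ext_ev fun {x e r} h c => ?_
  rw [ev_br, ev_pcomp (hs := rfl), ev_br, map_list_sum, List.map_map]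
  congr 1
  refine List.map_congr_left fun w _ => ?_
  simp only [Function.comp]
  rw [map_smul, ev_pcomp (s := e + v) (hs := by omega)]

theorem br_nil_lact (Θ : ∀ y, Raw G (G'.obj y) y n) {n' d' : ℤ} (hn : n + 1 = n')
    (hd : n' + 0 = d') (h : e + d' = r) (c : Chain A x y e) :
    (br (.nil F) (lact Θ hn : Raw G (G'.obj (F.obj y)) _ n') hd).ev h c =
      (lact (G := G'.comp F) (fun y => br (.nil F) (Θ (F.obj y)) rfl) rfl).ev (by omega) c := by
  cases c with
  | nil => rw [br_nil_nil, lact_nil, lact_nil]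
  | @cons y _ a e _ f c h' =>
    rw [br_nil_cons, freeze_lact (hs := by omega), br_smul, ev_smul,
      br_pcomp (hv := rfl) (hv' := by omega), lact_cons (hs := rfl), ev_pcomp', ev_pcomp']
    simp only [add_zero]
    rfl

/-- The left action takes off the first entry of the chain fed into it. In `ins` this entry is a
value of `Ψ`, so `G'(Ψ(…))` is split off on the left of the brace of `Θ` with `P`. -/
theorem ins_lact (Ψ : Raw F' V y m) (P : Chain (Coh A B) F F' p) (Θ : ∀ y, Raw G (G'.obj y) y n)
    {n' d' : ℤ} (hn : n + 1 = n') (hd : m - 1 + n' + p = d') (h : e + d' = r)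
    (c : Chain A x y e) :
    (ins Ψ P (lact Θ hn : Raw G (G'.obj V) V n') hd).ev h c = sgn k (n * (m - 1)) •
      (cup (G := G'.comp F') (push G' Ψ) (fun y => br P (Θ (F'.obj y)) rfl) rfl).ev
        (by omega) c := by
  rw [ev_ins, ev_cup, List.smul_sum, List.map_map]
  congr 1
  refine List.map_congr_left fun t _ => ?_
  simp only [Function.comp]
  have := t.h
  rw [freeze_lact (hs := by omega), br_smul, ev_smul, br_pcomp (hv := rfl) (hv' := by omega),
    ev_pcomp', ev_push, smul_smul, smul_smul, ← sgn_add, ← sgn_add]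
  congr 2
  ring

/-- The first entry fed into `Θ` is `F''(f)` or a value of `Ψ`. The first case is the left action on
the brace itself, the second is the product with `id ⊗ Ψ` in the formula for the differential. -/
theorem br_cons_lact (Ψ : (Coh A B).Hom F' F'' m) (P : Chain (Coh A B) F F' p)
    (Θ : ∀ y, Raw G (G'.obj y) y n) {q n' d' : ℤ} (hq : m - 1 + p = q) (hn : n + 1 = n')
    (hd : n' + q = d') (h : e + d' = r) (c : Chain A x y e) :
    (br (.cons Ψ P hq) (lact Θ hn : Raw G (G'.obj (F''.obj y)) _ n') hd).ev h c =
      (lact (G := G'.comp F'') (fun y => br (.cons Ψ P hq) (Θ (F''.obj y)) rfl) rfl).ev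
        (by omega) c
      + sgn k (n * (m - 1)) • (cup (G := G'.comp F') (push G' (Ψ.1 y))
        (fun y => br P (Θ (F'.obj y)) rfl) rfl).ev (by omega) c := by
  cases c with
  | nil => rw [br_cons_nil, lact_nil, ins_lact]; exact (zero_add _).symm
  | @cons y _ a e _ f c h' =>
    rw [br_cons_cons, ins_lact, add_comm, freeze_lact (hs := by omega), br_smul, ev_smul,
      br_pcomp (hv := rfl) (hv' := by omega), lact_cons (hs := rfl), smul_smul, ← sgn_add,
      ev_pcomp', ev_pcomp']
    congr 3
    subst hq hn
    ring

/-- The sum of the products `ψ{Ψ_k, …, Ψ_{l+1}} ∪ φ{Ψ_l, …, Ψ₁}`. -/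
def brCup (P : Chain (Coh A B) F F' p) (ψ : Raw G' W (F'.obj y) d₂)
    (φ : ∀ y, Raw G (G'.obj y) y d₁) {d' : ℤ} (hd : d₂ + d₁ + p = d') :
    Raw (G.comp F) W y d' := fun _ _ c =>
  (P.splits.map fun s => sgn k (d₁ * s.e₁) •
    (cup (G := G'.comp s.y) (br s.left ψ rfl)
      (fun y => br s.right (φ (DGFunctor.obj (C := A) (D := B) s.y y)) rfl) rfl).ev
      (by have := s.h; omega) c).sum

/-- The analogue of `brCup` for `ins`. -/
def insCup (Ψ : Raw F' V y m) (P : Chain (Coh A B) F F' p) (ψ : Raw G' W V d₂)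
    (φ : ∀ y, Raw G (G'.obj y) y d₁) {d' : ℤ} (hd : m - 1 + d₂ + d₁ + p = d') :
    Raw (G.comp F) W y d' := fun _ _ c =>
  (P.splits.map fun s => sgn k (d₁ * s.e₁) •
    (cup (G := G'.comp s.y) (ins Ψ s.left ψ rfl)
      (fun y => br s.right (φ (DGFunctor.obj (C := A) (D := B) s.y y)) rfl) rfl).ev
      (by have := s.h; omega) c).sum

theorem ev_brCup (P : Chain (Coh A B) F F' p) (ψ : Raw G' W (F'.obj y) d₂)
    (φ : ∀ y, Raw G (G'.obj y) y d₁) {d' : ℤ} (hd : d₂ + d₁ + p = d') (h : e + d' = r)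
    (c : Chain A x y e) : (brCup P ψ φ hd).ev h c = (P.splits.map fun s => sgn k (d₁ * s.e₁) •
    (cup (G := G'.comp s.y) (br s.left ψ rfl)
      (fun y => br s.right (φ (DGFunctor.obj (C := A) (D := B) s.y y)) rfl) rfl).ev
      (by have := s.h; omega) c).sum := by
  subst h; rfl

theorem ev_insCup (Ψ : Raw F' V y m) (P : Chain (Coh A B) F F' p) (ψ : Raw G' W V d₂)
    (φ : ∀ y, Raw G (G'.obj y) y d₁) {d' : ℤ} (hd : m - 1 + d₂ + d₁ + p = d') (h : e + d' = r)
    (c : Chain A x y e) : (insCup Ψ P ψ φ hd).ev h c =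
    (P.splits.map fun s => sgn k (d₁ * s.e₁) •
    (cup (G := G'.comp s.y) (ins Ψ s.left ψ rfl)
      (fun y => br s.right (φ (DGFunctor.obj (C := A) (D := B) s.y y)) rfl) rfl).ev
      (by have := s.h; omega) c).sum := by
  subst h; rfl

theorem insCup_nil (Ψ : Raw F' V y m) (P : Chain (Coh A B) F F' p) (ψ : Raw G' W V d₂)
    (φ : ∀ y, Raw G (G'.obj y) y d₁) {d' : ℤ} (hd : m - 1 + d₂ + d₁ + p = d') (h : 0 + d' = r) :
    (insCup Ψ P ψ φ hd).ev h (.nil y) =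
      (brCup P (freeze ψ (Ψ.ev (zero_add m) (.nil y)) rfl) φ rfl).ev (by omega) (.nil y) := by
  rw [ev_insCup, ev_brCup]
  congr 1
  refine List.map_congr_left fun s _ => ?_
  congr 1
  exact cup_nil_congr rfl (fun h => ins_nil ..) ..

theorem insCup_cons (Ψ : Raw F' V z m) (P : Chain (Coh A B) F F' p) (ψ : Raw G' W V d₂)
    (φ : ∀ y, Raw G (G'.obj y) y d₁) {d' a e' : ℤ} (hd : m - 1 + d₂ + d₁ + p = d')
    (f : A.Hom y z a) (c : Chain A x y e) (h' : a - 1 + e = e')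
    (h : e' + d' = r) :
    (insCup Ψ P ψ φ hd).ev h (.cons f c h') =
      (brCup P (freeze ψ (Ψ.ev (zero_add m) (.nil z)) rfl) φ rfl).ev (by omega) (.cons f c h')
      + sgn k ((d₁ + p) * (a - 1)) • (insCup (freeze Ψ f rfl) P ψ φ rfl).ev (by omega) c := by
  rw [ev_insCup, ev_brCup, ev_insCup]
  refine sum_map_lin fun s _ => ?_
  have := cup_peel (A := A) (φ := ins Ψ s.left ψ rfl)
    (φ₀ := br s.left (freeze ψ (Ψ.ev (zero_add m) (.nil z)) rfl) rfl)
    (φ₁ := ins (freeze Ψ f rfl) s.left ψ rfl)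
    (hd := rfl) (hd₀ := rfl) (hd₁ := rfl) (r := r) rfl (by omega)
    (fun h => ins_nil Ψ s.left ψ rfl h)
    (fun c h => ins_cons Ψ s.left ψ rfl f c rfl h)
    (χ := fun y => br s.right (φ (DGFunctor.obj (C := A) (D := B) s.y y)) rfl) c h'
    (by have := s.h; omega)
  rw [this, smul_add, smul_comm, ← sgn_add]
  congr 4
  linear_combination (a - 1) * s.h

/-- The formula for `(ψ ∪ φ){Ψ_k, …, Ψ₁}`. -/
def CupFormula (G G' : DGFunctor B C) (W : C.Obj) (P : Chain (Coh A B) F F' p) : Prop :=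
  ∀ {x y : A.Obj} {e d₁ d₂ d d' r : ℤ} (ψ : Raw G' W (F'.obj y) d₂)
    (φ : ∀ y, Raw G (G'.obj y) y d₁)
    (hd : d₂ + d₁ = d) (hd' : d + p = d') (h : e + d' = r) (c : Chain A x y e),
    (br P (cup ψ φ hd) hd').ev h c = (brCup P ψ φ rfl).ev (by omega) c

theorem br_freeze_cup {P : Chain (Coh A B) F F' p} (HP : CupFormula G G' W P) {a : ℤ}
    (u : B.Hom (F'.obj y) V a) (ψ : Raw G' W V d₂) (φ : ∀ y, Raw G (G'.obj y) y d₁)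
    {s t : ℤ} (hd : d₂ + d₁ = d) (hs : a - 1 + d = s) (ht : s + p = t) (h : e + t = r)
    (c : Chain A x y e) :
    (br P (freeze (cup ψ φ hd) u hs) ht).ev h c =
      (pcomp (ψ.ev (zero_add d₂) (.nil V)) (br P (freeze (φ V) u rfl) rfl) rfl).ev (by omega) c
      + sgn k (d₁ * (a - 1)) • (brCup P (freeze ψ u rfl) φ rfl).ev (by omega) c := by
  rw [freeze_cup (hs := rfl) (ht := by omega) (hs' := rfl) (ht' := by omega), br_add, br_smul,
    ev_add, ev_smul, HP,
    br_pcomp (hv := rfl) (hv' := by omega), ev_pcomp', ev_pcomp']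

/-- The first entry, a value of `Ψ`, goes to `φ` or to `ψ`. In the first case `ψ` has no arguments
and contributes its arity zero value as a left factor; in the second `Ψ` belongs to the left part of
the split chain. -/
theorem ins_cup {P : Chain (Coh A B) F F' p} (HP : CupFormula G G' W P) (c : Chain A x y e) :
    ∀ {V : B.Obj} {m d₁ d₂ d d' r : ℤ} (Ψ : Raw F' V y m) (ψ : Raw G' W V d₂)
      (φ : ∀ y, Raw G (G'.obj y) y d₁) (hd : d₂ + d₁ = d) (hd' : m - 1 + d + p = d')
      (h : e + d' = r),
    (ins Ψ P (cup ψ φ hd) hd').ev h c =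
      (pcomp (ψ.ev (zero_add d₂) (.nil V)) (ins Ψ P (φ V) rfl) rfl).ev (by omega) c
      + sgn k (d₁ * (m - 1)) • (insCup Ψ P ψ φ rfl).ev (by omega) c := by
  induction c with
  | nil =>
    intro V m d₁ d₂ d d' r Ψ ψ φ hd hd' h
    rw [ins_nil, br_freeze_cup HP, insCup_nil, ev_pcomp', ev_pcomp', ins_nil]
  | @cons y z a e e' f c h' ih =>
    intro V m d₁ d₂ d d' r Ψ ψ φ hd hd' h
    rw [ins_cons, br_freeze_cup HP, ih, insCup_cons, ev_pcomp', ev_pcomp (s := e' + (m - 1 + d₁ + p)) (hs := by omega), ev_pcomp', ins_cons,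
      map_add, map_smul]
    simp only [add_mul, mul_sub, mul_add, mul_one, sgn_add, sgn_sub]
    module

theorem brCup_nil (ψ : Raw G' W (F.obj y) d₂) (φ : ∀ y, Raw G (G'.obj y) y d₁) {d' : ℤ}
    (hd : d₂ + d₁ + 0 = d') (h : e + d' = r) (c : Chain A x y e) :
    (brCup (.nil F) ψ φ hd).ev h c = (cup (G := G'.comp F) (br (.nil F) ψ (add_zero _))
      (fun y => br (.nil F) (φ (F.obj y)) (add_zero _)) rfl).ev (by omega) c := by
  have : ∀ {s t v : ℤ} (h₁ : d₂ + 0 = s) (h₂ : d₁ + 0 = t) (h₃ : s + t = v) (h : e + v = r),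
      (cup (G := G'.comp F) (br (.nil F) ψ h₁) (fun y => br (.nil F) (φ (F.obj y)) h₂) h₃).ev h c =
      (cup (G := G'.comp F) (br (.nil F) ψ (add_zero _))
      (fun y => br (.nil F) (φ (F.obj y)) (add_zero _)) rfl).ev (by omega) c := by
    intro s t v h₁ h₂ h₃ h
    obtain rfl : d₂ = s := by omega
    obtain rfl : d₁ = t := by omega
    subst h₃
    rfl
  have e₁ := Chain.sum_splits_nil (C := Coh A B) (x := F) (fun s => sgn k (d₁ * s.e₁) •
    (cup (G := G'.comp s.y) (br s.left ψ rfl)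
      (fun y => br s.right (φ (DGFunctor.obj (C := A) (D := B) s.y y)) rfl) rfl).ev (r := r)
      (by have := s.h; omega) c)
  rw [ev_brCup, e₁, mul_zero, sgn_zero, one_smul]
  exact this rfl rfl rfl (by omega)

/-- Precomposition with `F` does not affect where a chain is cut; only the trivial split of the
empty chain of cochains is present. -/
theorem cupFormula_nil : CupFormula G G' W (Chain.nil (C := Coh A B) F) := by
  intro x y e d₁ d₂ d d' r ψ φ hd hd' h c
  induction c generalizing d₂ d d' r with
  | nil =>
    rw [br_nil_nil, brCup_nil, cup_nil, cup_nil, ev_pcomp', ev_pcomp', br_nil_nil, br_nil_nil]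
  | @cons y z a e e' f c h' ih =>
    rw [br_nil_cons, brCup_nil, cup_cons (s := a - 1 + d₂) (hs := rfl) (ht := rfl), br_nil_nil,
      freeze_br_nil (ht := by omega) (ht' := rfl), ev_pcomp', br_nil_cons,
      freeze_cup (hs := rfl) (ht := by omega) (hs' := rfl) (ht' := by omega), br_add, br_smul,
      ev_add, ev_smul, ih, brCup_nil, br_pcomp (hv := rfl) (hv' := by omega), ev_pcomp']
    rw [comp_ev_congr₂]

/-- A split of the longer chain has an empty left part or a left part beginning with `Ψ`; in the
second case it comes from a split of `P`. -/
theorem brCup_cons (Ψ : (Coh A B).Hom F' F'' m) (P : Chain (Coh A B) F F' p) {q : ℤ}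
    (hq : m - 1 + p = q) (ψ : Raw G' W (F''.obj y) d₂) (φ : ∀ y, Raw G (G'.obj y) y d₁) {d' : ℤ}
    (hd : d₂ + d₁ + q = d') (h : e + d' = r) (c : Chain A x y e) :
    (brCup (.cons Ψ P hq) ψ φ hd).ev h c = (cup (G := G'.comp F'') (br (.nil F'') ψ (add_zero _))
      (fun y => br (.cons Ψ P hq) (φ (F''.obj y)) rfl) rfl).ev (by omega) c
    + sgn k (d₁ * (m - 1)) • (P.splits.map fun s => sgn k (d₁ * s.e₁) •
    (cup (G := G'.comp s.y) (br (.cons Ψ s.left rfl) ψ rfl)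
      (fun y => br s.right (φ (DGFunctor.obj (C := A) (D := B) s.y y)) rfl) rfl).ev
      (by have := s.h; omega) c).sum := by
  have e₁ := Chain.sum_splits_cons (C := Coh A B) Ψ P hq (fun s => sgn k (d₁ * s.e₁) •
    (cup (G := G'.comp s.y) (br s.left ψ rfl)
      (fun y => br s.right (φ (DGFunctor.obj (C := A) (D := B) s.y y)) rfl) rfl).ev (r := r)
      (by have := s.h; omega) c)
  have e₂ : ∀ {s v : ℤ} (h₁ : d₂ + 0 = s) (h₃ : s + (d₁ + q) = v) (h : e + v = r),
      (cup (G := G'.comp F'') (br (.nil F'') ψ h₁)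
        (fun y => br (.cons Ψ P hq) (φ (F''.obj y)) rfl) h₃).ev h c =
      (cup (G := G'.comp F'') (br (.nil F'') ψ (add_zero _))
        (fun y => br (.cons Ψ P hq) (φ (F''.obj y)) rfl) rfl).ev (by omega) c := by
    intro s v h₁ h₃ h
    obtain rfl : d₂ = s := by omega
    subst h₃
    rfl
  rw [ev_brCup, e₁, e₂, mul_zero, sgn_zero, one_smul, List.smul_sum, List.map_map]
  simp only [Function.comp_def, smul_smul, ← sgn_add, ← mul_add]

/-- Both the `ins` part and the part with first entry `F''(f)` produce terms with `ψ` in arity zero;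
by `br_cons_cons` for `φ` these recombine into the left factor of arity zero times the whole brace
of `φ`. The remaining terms are matched by `ins_cup` and by the induction on the arguments. -/
theorem cupFormula_cons (Ψ : (Coh A B).Hom F' F'' m) {P : Chain (Coh A B) F F' p}
    (HP : CupFormula G G' W P) {q : ℤ} (hq : m - 1 + p = q) :
    CupFormula G G' W (.cons Ψ P hq) := by
  intro x y e d₁ d₂ d d' r ψ φ hd hd' h c
  induction c generalizing d₂ d d' r with
  | nil =>
    rw [br_cons_nil, ins_cup HP, brCup_cons, cup_nil, ev_insCup, ev_pcomp', ev_pcomp', br_cons_nil,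
      br_nil_nil]
    refine congrArg₂ (· + ·) (comp_ev_congr₂ ..) (congrArg _ (congrArg _ ?_))
    refine List.map_congr_left fun s _ => ?_
    congr 1
    exact (cup_nil_congr (by omega) (fun h => br_cons_nil (hq := rfl) ..) ..).symm
  | @cons y z a e e' f c h' ih =>
    have e₁ := sum_map_lin (l := P.splits)
      (φ := fun s => sgn k (d₁ * s.e₁) •
        (cup (G := G'.comp s.y) (br (.cons Ψ s.left rfl) ψ rfl)
          (fun y => br s.right (φ (DGFunctor.obj (C := A) (D := B) s.y y)) rfl) rfl).ev (r := r)
          (by have := s.h; omega) (.cons f c h'))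
      (φ₁ := fun s => sgn k (d₁ * s.e₁) •
        (cup (G := G'.comp s.y) (ins (Ψ.1 z) s.left ψ rfl)
          (fun y => br s.right (φ (DGFunctor.obj (C := A) (D := B) s.y y)) rfl) rfl).ev (r := r)
          (by have := s.h; omega) (.cons f c h'))
      (φ₂ := fun s => sgn k (d₁ * s.e₁) •
        (cup (G := G'.comp s.y) (br (.cons Ψ s.left rfl) (freeze ψ (F''.map f) rfl) rfl)
          (fun y => br s.right (φ (DGFunctor.obj (C := A) (D := B) s.y y)) rfl) rfl).ev (r := r)
          (by have := s.h; omega) c)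
      (s := sgn k ((d₁ + q) * (a - 1))) (fun s _ => by
        have := cup_peel (A := A) (φ := br (.cons Ψ s.left rfl) ψ rfl)
          (φ₀ := ins (Ψ.1 z) s.left ψ rfl)
          (φ₁ := br (.cons Ψ s.left rfl) (freeze ψ (F''.map f) rfl) rfl)
          (hd := rfl) (hd₀ := rfl) (hd₁ := rfl) (r := r) (by omega) (by omega)
          (fun h => br_cons_nil rfl ψ rfl h)
          (fun c h => br_cons_cons rfl ψ rfl f c rfl h)
          (χ := fun y => br s.right (φ (DGFunctor.obj (C := A) (D := B) s.y y)) rfl) c h'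
          (by have := s.h; omega)
        rw [this, smul_add, smul_comm, ← sgn_add]
        congr 4
        rw [← hq]
        linear_combination (a - 1) * s.h)
    rw [br_cons_cons, ins_cup HP, brCup_cons, cup_cons (s := a - 1 + d₂) (hs := rfl) (ht := rfl),
      e₁, br_nil_nil,
      freeze_br_nil (ht := by omega) (ht' := rfl),
      ev_pcomp' (ψ := br (.cons Ψ P hq) (φ (F''.obj z)) rfl), br_cons_cons,
      freeze_cup (hs := rfl) (ht := by omega) (hs' := rfl) (ht' := by omega), br_add, br_smul,
      ev_add, ev_smul, ih, brCup_cons, br_pcomp (hv := rfl) (hv' := by omega),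
      ev_pcomp (s := e' + (d₁ + q)) (hs := by omega),
      ev_insCup, ev_pcomp (s := e' + (d₁ + q)) (hs := by omega), map_add, map_smul]
    simp only [add_mul, mul_sub, mul_one, sgn_add, sgn_sub]
    module

theorem cupFormula (P : Chain (Coh A B) F F' p) : CupFormula G G' W P := by
  induction P using Chain.cohInduction with
  | nil => exact cupFormula_nil
  | cons Ψ P hq HP => exact cupFormula_cons Ψ HP hq

end Raw

/-! ### Braces are multilinear and normalized, in the arguments and in the cochains -/

namespace Raw
variable {k : Type u} [Field k] {A B C : DGCat k} {F F' F'' : DGFunctor A B}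
  {G G' : DGFunctor B C} {W : C.Obj} {V V' : B.Obj} {x y z : A.Obj} {d p m e r : ℤ}

/-- The brace with `(Ψ, P)` is built from `ins`, and `ins` from braces with `P`; `HP` is what the
induction on `P` in `br_multilinear` supplies. -/
theorem ins_multilinear {P : Chain (Coh A B) F F' p}
    (HP : ∀ {y : A.Obj} {d d' : ℤ} {ψ : Raw G W (F'.obj y) d} (hd : d + p = d'),
      Multilinear ψ → Multilinear (br P ψ hd)) {t : k} {c₁ c₂ c₃ : Chain A x y e}
    (S : Chain.SlotLin t c₁ c₂ c₃) : ∀ {V : B.Obj} {m d d' r : ℤ} {Ψ : Raw F' V y m}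
      {ψ : Raw G W V d} (_ : Multilinear Ψ) (_ : Multilinear ψ) (hd : m - 1 + d + p = d')
      (h : e + d' = r),
    (ins Ψ P ψ hd).ev h c₃ = t • (ins Ψ P ψ hd).ev h c₁ + (ins Ψ P ψ hd).ev h c₂ := by
  induction S with
  | head f g c h' =>
    intro V m d d' r Ψ ψ hΨ hψ hd h
    rw [ins_cons, ins_cons, ins_cons, HP rfl (hψ.freeze _ _) _ (.head f g c h'), hΨ.freeze_lin,
      ins_lin_left _ _ _ hψ, ev_add, ev_smul]
    module
  | tail f h' S ih =>
    intro V m d d' r Ψ ψ hΨ hψ hd h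
    rw [ins_cons, ins_cons, ins_cons, HP rfl (hψ.freeze _ _) _ (.tail f h' S),
      ih (hΨ.freeze _ _) hψ]
    module

theorem ins_normalized {P : Chain (Coh A B) F F' p}
    (HP : ∀ {y : A.Obj} {d d' : ℤ} {ψ : Raw G W (F'.obj y) d} (hd : d + p = d'),
      Multilinear ψ → Normalized ψ → Normalized (br P ψ hd)) {c : Chain A x y e}
    (S : Chain.HasId c) : ∀ {V : B.Obj} {m d d' r : ℤ} {Ψ : Raw F' V y m}
      {ψ : Raw G W V d} (_ : Normalized Ψ) (_ : Multilinear ψ) (_ : Normalized ψ)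
      (hd : m - 1 + d + p = d') (h : e + d' = r), (ins Ψ P ψ hd).ev h c = 0 := by
  induction S with
  | head c h' =>
    intro V m d d' r Ψ ψ hΨ hψ hψ' hd h
    rw [ins_cons, HP rfl (hψ.freeze _ _) (hψ'.freeze _ _) _ (.head c h'), hΨ.freeze_id,
      ins_zero_left _ hψ, ev_zero, smul_zero, add_zero]
  | tail f h' S ih =>
    intro V m d d' r Ψ ψ hΨ hψ hψ' hd h
    rw [ins_cons, HP rfl (hψ.freeze _ _) (hψ'.freeze _ _) _ (.tail f h' S), ih (hΨ.freeze _ _) hψ hψ', smul_zero,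
      add_zero]

theorem br_multilinear (P : Chain (Coh A B) F F' p) : ∀ {y : A.Obj} {d d' : ℤ}
    {ψ : Raw G W (F'.obj y) d} (hd : d + p = d'), Multilinear ψ → Multilinear (br P ψ hd) := by
  induction P using Chain.cohInduction with
  | nil =>
    intro y d d' ψ hd hψ x e r h t c₁ c₂ c₃ S
    induction S generalizing d d' r with
    | head f g c h' =>
      rw [br_nil_cons, br_nil_cons, br_nil_cons, map_add, map_smul, hψ.freeze_lin, br_lin, ev_add,
        ev_smul]
    | tail f h' S ih =>
      rw [br_nil_cons, br_nil_cons, br_nil_cons, ih _ (hψ.freeze _ _)]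
  | cons Ψ P hq HP =>
    intro y d d' ψ hd hψ x e r h t c₁ c₂ c₃ S
    induction S generalizing d d' r with
    | head f g c h' =>
      rw [br_cons_cons, br_cons_cons, br_cons_cons, map_add, map_smul, hψ.freeze_lin, br_lin,
        ev_add, ev_smul, ins_multilinear HP (.head f g c h') (Ψ.2 _).1 hψ]
      module
    | tail f h' S ih =>
      rw [br_cons_cons, br_cons_cons, br_cons_cons, ih _ (hψ.freeze _ _),
        ins_multilinear HP (.tail f h' S) (Ψ.2 _).1 hψ]
      module

/-- An identity among the arguments reaches `ψ` as `F_s(id) = id`, or it is an argument of some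
`Ψ_s`. In the second case `ψ` receives the entry zero, and its multilinearity is needed. -/
theorem br_normalized (P : Chain (Coh A B) F F' p) : ∀ {y : A.Obj} {d d' : ℤ}
    {ψ : Raw G W (F'.obj y) d} (hd : d + p = d'), Multilinear ψ → Normalized ψ →
      Normalized (br P ψ hd) := by
  induction P using Chain.cohInduction with
  | nil =>
    intro y d d' ψ hd hψ hψ' x e r h c S
    induction S generalizing d d' r with
    | head c h' => rw [br_nil_cons, DGFunctor.map_id, hψ'.freeze_id, br_zero, ev_zero]
    | tail f h' S ih => rw [br_nil_cons, ih _ (hψ.freeze _ _) (hψ'.freeze _ _)]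
  | cons Ψ P hq HP =>
    intro y d d' ψ hd hψ hψ' x e r h c S
    induction S generalizing d d' r with
    | head c h' =>
      rw [br_cons_cons, DGFunctor.map_id, hψ'.freeze_id, br_zero, ev_zero, smul_zero, add_zero,
        ins_normalized HP (.head c h') (Ψ.2 _).2 hψ hψ']
    | tail f h' S ih =>
      rw [br_cons_cons, ih _ (hψ.freeze _ _) (hψ'.freeze _ _), smul_zero, add_zero,
        ins_normalized HP (.tail f h' S) (Ψ.2 _).2 hψ hψ']

theorem br_cons_lin {Ψ Φ Ω : (Coh A B).Hom F' F'' m} {t : k} (H : Ω.1 = t • Ψ.1 + Φ.1) (P : Chain (Coh A B) F F' p)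
    (c : Chain A x y e) : ∀ {d q d' r : ℤ} {ψ : Raw G W (F''.obj y) d} (_ : Multilinear ψ)
    (hq : m - 1 + p = q) (hd : d + q = d') (h : e + d' = r),
    (br (.cons Ω P hq) ψ hd).ev h c =
      t • (br (.cons Ψ P hq) ψ hd).ev h c + (br (.cons Φ P hq) ψ hd).ev h c := by
  induction c with
  | nil =>
    intro d q d' r ψ hψ hq hd h
    have := ins_lin_left (Ψ.1 x) (Φ.1 x) P hψ t rfl
    rw [br_cons_nil, br_cons_nil, br_cons_nil, H]
    exact (congrArg (fun χ => ev χ _ _) this).trans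
      ((ev_add ..).trans (congrArg (· + _) (ev_smul ..)))
  | @cons y z a e e' f c h' ih =>
    intro d q d' r ψ hψ hq hd h
    have e₁ : ∀ {r : ℤ} (h : e' + (m - 1 + d + p) = r),
        (ins (Ω.1 z) P ψ rfl).ev h (.cons f c h') = t • (ins (Ψ.1 z) P ψ rfl).ev h (.cons f c h')
          + (ins (Φ.1 z) P ψ rfl).ev h (.cons f c h') := by
      intro r h
      rw [H, ← ev_smul, ← ev_add]
      exact congrArg (fun χ => ev χ h _) (ins_lin_left (Ψ.1 z) (Φ.1 z) P hψ t rfl)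
    rw [br_cons_cons, br_cons_cons, br_cons_cons, ih (hψ.freeze _ _), e₁]
    module

theorem ins_lin_tail {P₁ P₂ P₃ : Chain (Coh A B) F F' p} {t : k}
    (H : ∀ {x y : A.Obj} {e d d' r : ℤ} {ψ : Raw G W (F'.obj y) d} (_ : Multilinear ψ)
      (hd : d + p = d') (h : e + d' = r) (c : Chain A x y e),
      (br P₃ ψ hd).ev h c = t • (br P₁ ψ hd).ev h c + (br P₂ ψ hd).ev h c)
    (Ψ : Raw F' V y m) {ψ : Raw G W V d} (hψ : Multilinear ψ) {d' : ℤ} (hd : m - 1 + d + p = d')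
    (h : e + d' = r) (c : Chain A x y e) :
    (ins Ψ P₃ ψ hd).ev h c = t • (ins Ψ P₁ ψ hd).ev h c + (ins Ψ P₂ ψ hd).ev h c := by
  rw [ev_ins, ev_ins, ev_ins]
  refine sum_map_lin' fun s _ => ?_
  rw [H (hψ.freeze _ _)]
  module

theorem br_lin_tail {P₁ P₂ P₃ : Chain (Coh A B) F F' p} {t : k}
    (H : ∀ {x y : A.Obj} {e d d' r : ℤ} {ψ : Raw G W (F'.obj y) d} (_ : Multilinear ψ)
      (hd : d + p = d') (h : e + d' = r) (c : Chain A x y e),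
      (br P₃ ψ hd).ev h c = t • (br P₁ ψ hd).ev h c + (br P₂ ψ hd).ev h c)
    (Ψ : (Coh A B).Hom F' F'' m) (c : Chain A x y e) : ∀ {d q d' r : ℤ}
      {ψ : Raw G W (F''.obj y) d} (_ : Multilinear ψ) (hq : m - 1 + p = q) (hd : d + q = d')
      (h : e + d' = r), (br (.cons Ψ P₃ hq) ψ hd).ev h c =
        t • (br (.cons Ψ P₁ hq) ψ hd).ev h c + (br (.cons Ψ P₂ hq) ψ hd).ev h c := by
  induction c with
  | nil =>
    intro d q d' r ψ hψ hq hd h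
    rw [br_cons_nil, br_cons_nil, br_cons_nil, ins_lin_tail H _ hψ]
  | cons f c h' ih =>
    intro d q d' r ψ hψ hq hd h
    rw [br_cons_cons, br_cons_cons, br_cons_cons, ih (hψ.freeze _ _), ins_lin_tail H _ hψ]
    module

theorem br_slotLin {F F' : (Coh A B).Obj} {P₁ P₂ P₃ : Chain (Coh A B) F F' p} {t : k}
    (S : Chain.SlotLin t P₁ P₂ P₃) : ∀ {x y : A.Obj} {e d d' r : ℤ}
      {ψ : Raw G W (DGFunctor.obj F' y) d} (_ : Multilinear ψ)
      (hd : d + p = d') (h : e + d' = r) (c : Chain A x y e),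
      (br P₃ ψ hd).ev h c = t • (br P₁ ψ hd).ev h c + (br P₂ ψ hd).ev h c := by
  induction S with
  | head Ψ Φ P hq => exact fun hψ hd h c => br_cons_lin rfl P c hψ hq hd h
  | tail Ψ hq S ih => exact fun hψ hd h c => br_lin_tail ih Ψ c hψ hq hd h

/-- The identity cochain is nonzero on the empty block only; there it feeds an identity morphism
into the normalized family `ψ`. -/
theorem ins_one_eq_zero (P : Chain (Coh A B) F F' p) {ψ : Raw G W (F'.obj y) d}
    (hψ : Multilinear ψ) (hψ' : Normalized ψ) {d' : ℤ} (hd : 0 - 1 + d + p = d') (h : e + d' = r)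
    (c : Chain A x y e) : (ins (one F' y) P ψ hd).ev h c = 0 := by
  have e₁ : ∀ {s t : ℤ} (h₁ : 0 + 0 = s) (h₂ : s - 1 + d = t),
      freeze ψ ((one F' y).ev h₁ (.nil y)) h₂ = 0 := by
    intro s t h₁ h₂
    subst h₁
    exact hψ'.freeze_id ..
  cases c with
  | nil => rw [ins_nil, e₁, br_zero, ev_zero]
  | cons f c h' =>
    rw [ins_cons, e₁, br_zero, ev_zero, freeze_one, ins_zero_left _ hψ, ev_zero, smul_zero,
      add_zero]

theorem br_cons_id (P : Chain (Coh A B) F F' p) (c : Chain A x y e) : ∀ {d q d' r : ℤ}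
    {ψ : Raw G W (F'.obj y) d} (_ : Multilinear ψ) (_ : Normalized ψ)
    (hq : 0 - 1 + p = q) (hd : d + q = d') (h : e + d' = r),
    (br (.cons ((Coh A B).id F') P hq) ψ hd).ev h c = 0 := by
  induction c with
  | nil =>
    intro d q d' r ψ hψ hψ' hq hd h
    rw [br_cons_nil]
    exact ins_one_eq_zero P hψ hψ' ..
  | cons f c h' ih =>
    intro d q d' r ψ hψ hψ' hq hd h
    rw [br_cons_cons, ih (hψ.freeze _ _) (hψ'.freeze _ _), smul_zero, add_zero]
    exact ins_one_eq_zero P hψ hψ' ..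

theorem br_cons_eq_zero {P : Chain (Coh A B) F F' p}
    (H : ∀ {x y : A.Obj} {e d d' r : ℤ} {ψ : Raw G W (F'.obj y) d} (_ : Multilinear ψ)
      (_ : Normalized ψ) (hd : d + p = d') (h : e + d' = r) (c : Chain A x y e),
      (br P ψ hd).ev h c = 0)
    (Ψ : (Coh A B).Hom F' F'' m) (c : Chain A x y e) : ∀ {d q d' r : ℤ}
      {ψ : Raw G W (F''.obj y) d} (_ : Multilinear ψ) (_ : Normalized ψ) (hq : m - 1 + p = q)
      (hd : d + q = d') (h : e + d' = r), (br (.cons Ψ P hq) ψ hd).ev h c = 0 := by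
  have H' : ∀ {x y : A.Obj} {e d d' r : ℤ} {V : B.Obj} {Ψ : Raw F' V y m} {ψ : Raw G W V d}
      (_ : Multilinear ψ) (_ : Normalized ψ) (hd : m - 1 + d + p = d') (h : e + d' = r)
      (c : Chain A x y e), (ins Ψ P ψ hd).ev h c = 0 := by
    intro x y e d d' r V Ψ ψ hψ hψ' hd h c
    rw [ev_ins, List.sum_eq_zero]
    intro u hu
    obtain ⟨s, _, rfl⟩ := List.mem_map.1 hu
    rw [H (hψ.freeze _ _) (hψ'.freeze _ _), smul_zero]
  induction c with
  | nil =>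
    intro d q d' r ψ hψ hψ' hq hd h
    rw [br_cons_nil, H' hψ hψ']
  | cons f c h' ih =>
    intro d q d' r ψ hψ hψ' hq hd h
    rw [br_cons_cons, ih (hψ.freeze _ _) (hψ'.freeze _ _), smul_zero, add_zero, H' hψ hψ']

theorem br_hasId {F F' : (Coh A B).Obj} {P : Chain (Coh A B) F F' p}
    (S : Chain.HasId P) : ∀ {x y : A.Obj} {e d d' r : ℤ}
      {ψ : Raw G W (DGFunctor.obj F' y) d} (_ : Multilinear ψ) (_ : Normalized ψ)
      (hd : d + p = d') (h : e + d' = r) (c : Chain A x y e),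
      (br P ψ hd).ev h c = 0 := by
  induction S with
  | head P hq => exact fun hψ hψ' hd h c => br_cons_id P c hψ hψ' hq hd h
  | tail Ψ hq S ih => exact fun hψ hψ' hd h c => br_cons_eq_zero ih Ψ c hψ hψ' hq hd h

theorem br_nil_one {d' : ℤ} (hd : 0 + 0 = d') (h : e + d' = r) (c : Chain A x y e) :
    (br (.nil F) (one G (F.obj y)) hd).ev h c = (one (G.comp F) y).ev (by omega) c := by
  cases c with
  | nil =>
    rw [br_nil_nil, ev_one_nil _ (by omega), ev_one_nil _ (by omega)]
  | cons f c h' => rw [br_nil_cons, freeze_one, br_zero, ev_zero, ev_one_cons]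

/-- As soon as a cochain is inserted, the outer family is evaluated on a nonempty chain, where the
identity cochain is zero. -/
theorem br_cons_one (Ψ : (Coh A B).Hom F' F'' m) (P : Chain (Coh A B) F F' p) {q d' : ℤ}
    (hq : m - 1 + p = q) (hd : 0 + q = d') (h : e + d' = r) (c : Chain A x y e) :
    (br (.cons Ψ P hq) (one G (F''.obj y)) hd).ev h c = 0 := by
  have H : ∀ {d' r : ℤ} (hd : m - 1 + 0 + p = d') (h : e + d' = r),
      (ins (Ψ.1 y) P (one G (F''.obj y)) hd).ev h c = 0 := by
    intro d' r hd h
    rw [ev_ins, List.sum_eq_zero]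
    intro u hu
    obtain ⟨s, _, rfl⟩ := List.mem_map.1 hu
    rw [freeze_one, br_zero, ev_zero, smul_zero]
  cases c with
  | nil => rw [br_cons_nil, H]
  | cons f c h' => rw [br_cons_cons, H, freeze_one, br_zero, ev_zero, smul_zero, add_zero]

end Raw

/-! ### Braces as cochains, and their relations in `Coh(A, C)` -/

namespace Coh
variable {k : Type u} [Field k] {C D : DGCat k} {F G H : (Coh C D).Obj} {x y : C.Obj}
  {e n p q r : ℤ}

theorem hom_ext {ψ φ : (Coh C D).Hom F G n}
    (h : ∀ {x y : C.Obj} {e r : ℤ} (c : Chain C x y e) (h : e + n = r), ap ψ c h = ap φ c h) :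
    ψ = φ :=
  Subtype.ext (funext fun _ => Raw.ext_ev fun hr c => h c hr)

section
variable (c : Chain C x y e) (h : e + n = r) (ψ φ : (Coh C D).Hom F G n)

theorem ap_add : ap (ψ + φ) c h = ap ψ c h + ap φ c h := Raw.ev_add ..

theorem ap_sub : ap (ψ - φ) c h = ap ψ c h - ap φ c h := Raw.ev_sub ..

theorem ap_smul (t : k) : ap (t • ψ) c h = t • ap ψ c h := Raw.ev_smul ..

theorem ap_zero : ap (0 : (Coh C D).Hom F G n) c h = 0 := Raw.ev_zero ..

theorem ap_sum {α : Type*} (l : List α) (f : α → (Coh C D).Hom F G n) :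
    ap (l.map f).sum c h = (l.map fun t => ap (f t) c h).sum := by
  induction l with
  | nil => exact ap_zero c h
  | cons t l ih => exact (ap_add c h (f t) _).trans (congrArg _ ih)

end

theorem ap_d (h : p + 1 = q) (ψ : (Coh C D).Hom F G p) (c : Chain C x y e) (hr : e + q = r) :
    ap ((Coh C D).d h ψ) c hr = (Raw.diff (ψ.1 y) h).ev hr c + (Raw.lact ψ.1 h).ev hr c :=
  Raw.ev_add ..

end Coh

section
variable {k : Type u} [Field k] {A B C : DGCat k} {F F' F'' : (Coh A B).Obj}
  {G G' G'' : (Coh B C).Obj} {x y z : A.Obj} {n p q e r : ℤ}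

/-- The cochain `Θ{Ψ_k, …, Ψ₁}`, where `P = (Ψ_k, …, Ψ₁)`. -/
def braceHom (Θ : (Coh B C).Hom G G' n) (P : Chain (Coh A B) F F' p) (h : n + p = q) :
    (Coh A C).Hom (compObj G F) (compObj G' F') q :=
  ⟨fun y => Raw.br P (Θ.1 (DGFunctor.obj F' y)) h, fun _ =>
    ⟨Raw.br_multilinear P h (Θ.2 _).1, Raw.br_normalized P h (Θ.2 _).1 (Θ.2 _).2⟩⟩

/-- The cochain `(f_N, …, f₁) ↦ G(Ψ(f_N, …, f₁))`. -/
def pushHom (G : (Coh B C).Obj) (Ψ : (Coh A B).Hom F F' n) :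
    (Coh A C).Hom (compObj G F) (compObj G F') n := Coh.push G Ψ

theorem ap_braceHom_eq_brace (Θ : (Coh B C).Hom G G' n) (P : Chain (Coh A B) F F' p)
    (h : n + p = q) (c : Chain A x y e) (hr : e + q = r) :
    Coh.ap (braceHom Θ P h) c hr = brace Θ P c (by omega) :=
  Raw.ev_br P _ h ..

theorem brace_nil {G G' : DGFunctor B C} {F : DGFunctor A B} (Θ : (Coh B C).Hom G G' n)
    (c : Chain A x y e) (hr : e + (n + 0) = r) :
    brace Θ (.nil F) c hr = Coh.ap Θ (c.map F) (by omega) := by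
  simp only [brace, braceTerms, List.map_cons, List.map_nil, List.sum_cons, List.sum_nil, one_smul,
    add_zero]
  exact Raw.ev_cast ..

theorem braceHom_lin (t : k)
    (Θ Θ' : (Coh B C).Hom G G' n) (P : Chain (Coh A B) F F' p)
    (h : n + p = q) : braceHom (t • Θ + Θ') P h = t • braceHom Θ P h + braceHom Θ' P h :=
  Subtype.ext (funext fun _ => Raw.br_lin P _ _ t h)

theorem braceHom_slotLin (Θ : (Coh B C).Hom G G' n) {t : k}
    {P₁ P₂ P₃ : Chain (Coh A B) F F' p} (S : Chain.SlotLin t P₁ P₂ P₃) (h : n + p = q) :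
    braceHom Θ P₃ h = t • braceHom Θ P₁ h + braceHom Θ P₂ h :=
  Coh.hom_ext fun c hr => (Raw.br_slotLin S (Θ.2 _).1 h hr c).trans
    (by rw [Coh.ap_add, Coh.ap_smul]; rfl)

theorem braceHom_hasId (Θ : (Coh B C).Hom G G' n) {P : Chain (Coh A B) F F' p}
    (S : Chain.HasId P) (h : n + p = q) : braceHom Θ P h = 0 :=
  Coh.hom_ext fun c hr => (Raw.br_hasId S (Θ.2 _).1 (Θ.2 _).2 h hr c).trans
    (Coh.ap_zero (F := compObj G F) (G := compObj G' F') c hr).symm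

theorem braceHom_id_nil (G : (Coh B C).Obj) (F : (Coh A B).Obj) (h : 0 + 0 = (0 : ℤ)) :
    braceHom ((Coh B C).id G) (.nil F) h = (Coh A C).id (compObj G F) :=
  Coh.hom_ext fun c hr => Raw.br_nil_one h hr c

theorem braceHom_id_cons (G : (Coh B C).Obj) {m : ℤ}
    (Ψ : (Coh A B).Hom F' F'' m) (P : Chain (Coh A B) F F' p) {s : ℤ} (hq : m - 1 + p = q)
    (h : 0 + q = s) : braceHom ((Coh B C).id G) (.cons Ψ P hq) h = 0 :=
  Coh.hom_ext fun c hr => (Raw.br_cons_one Ψ P hq h hr c).trans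
    (Coh.ap_zero (F := compObj G F) (G := compObj G F'') c hr).symm

theorem braceHom_comp {n₂ n₁ : ℤ}
    (Θ₂ : (Coh B C).Hom G' G'' n₂) (Θ₁ : (Coh B C).Hom G G' n₁)
    (P : Chain (Coh A B) F F' p) (hn : n₂ + n₁ = n) (h : n + p = q) :
    braceHom ((Coh B C).comp hn Θ₂ Θ₁) P h = (P.splits.map fun s => sgn k (n₁ * s.e₁) •
      (Coh A C).comp (by have := s.h; omega) (braceHom Θ₂ s.left rfl)
        (braceHom Θ₁ s.right rfl)).sum := by
  refine Coh.hom_ext fun {x y e r} c hr => (Raw.cupFormula P _ _ hn h hr c).trans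
    ((Raw.ev_brCup P _ _ rfl ..).trans (Eq.trans ?_ (Coh.ap_sum ..).symm))
  refine congrArg _ (List.map_congr_left fun s _ => ?_)
  refine Eq.trans (congrArg _ ?_) (Coh.ap_smul ..).symm
  have := s.h
  have : ∀ {t : ℤ} (h₁ : n₂ + s.e₁ + (n₁ + s.e₂) = t) (h₂ : e + t = r),
      (Raw.cup (G := DGFunctor.comp G' s.y) (Raw.br s.left (Θ₂.1 (DGFunctor.obj F' y)) rfl)
        (fun y => Raw.br s.right (Θ₁.1 (DGFunctor.obj (C := A) (D := B) s.y y)) rfl) rfl).ev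
        (by omega) c =
      (Raw.cup (G := DGFunctor.comp G' s.y) (Raw.br s.left (Θ₂.1 (DGFunctor.obj F' y)) rfl)
        (fun y => Raw.br s.right (Θ₁.1 (DGFunctor.obj (C := A) (D := B) s.y y)) rfl) h₁).ev
        h₂ c := by
    intros; subst_vars; rfl
  exact this (by omega) hr

/-- `diffFormula` gives everything except the left actions. Those of `Θ` and of its brace differ by
the term with `heads`, according to `br_nil_lact` and `br_cons_lact`. -/
theorem d_braceHom {n' : ℤ}
    (Θ : (Coh B C).Hom G G' n) (P : Chain (Coh A B) F F' p) (h : n + p = q)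
    (hr : q + 1 = r) (hn : n + 1 = n') :
    (Coh A C).d hr (braceHom Θ P h) = braceHom ((Coh B C).d hn Θ) P (by omega)
      - sgn k n • (P.dTerms.map fun t => t.1 • braceHom Θ t.2 (by omega)).sum
      - sgn k n • (P.mTerms.map fun t => t.1 • braceHom Θ t.2 (by omega)).sum
      + sgn k n • (P.lasts.map fun s => sgn k s.e₁ •
          (Coh A C).comp (by have := s.h; omega) (braceHom Θ s.init rfl) (pushHom G s.f)).sum
      - (P.heads.map fun s => sgn k (n * (s.a - 1)) •
          (Coh A C).comp (by have := s.h; omega) (pushHom G' s.f) (braceHom Θ s.tail rfl)).sum := by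
  refine Coh.hom_ext fun {x y e t} c ht => ?_
  -- The boundary family, written with the three sums of the formula to be proved.
  have hd : ∀ {s : ℤ} (hs : n + p + 1 = s) (h' : e + s = t),
      (Raw.brBd P (Θ.1 (DGFunctor.obj F' y)) hs).ev h' c =
      Coh.ap (P.dTerms.map fun t => t.1 • braceHom Θ t.2 (q := r) (by omega)).sum c ht
      + Coh.ap (P.mTerms.map fun t => t.1 • braceHom Θ t.2 (q := r) (by omega)).sum c ht
      - Coh.ap (P.lasts.map fun s => sgn k s.e₁ •
          (Coh A C).comp (r := r) (by have := s.h; omega) (braceHom Θ s.init rfl)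
            (pushHom G s.f)).sum c ht := by
    intro s hs h'
    obtain rfl : r = s := by omega
    have e₁ : ∀ l : List (k × Chain (Coh A B) F F' (p + 1)),
        Coh.ap (l.map fun t => t.1 • braceHom Θ t.2 (q := r) (by omega)).sum c ht =
        (l.map fun t => t.1 • (Raw.br t.2 (Θ.1 (DGFunctor.obj F' y)) rfl).ev (by omega) c).sum :=
      fun l => (Coh.ap_sum ..).trans <| congrArg _ <| List.map_congr_left fun t _ =>
        (Coh.ap_smul ..).trans (congrArg _ (Raw.ev_br_congr t.2 _ (by omega) rfl ht (by omega) c))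
    have e₂ : Coh.ap (P.lasts.map fun s => sgn k s.e₁ •
          (Coh A C).comp (r := r) (by have := s.h; omega) (braceHom Θ s.init rfl)
            (pushHom G s.f)).sum c ht = (P.lasts.map fun s => sgn k s.e₁ •
      (Raw.cup (Raw.br s.init (Θ.1 (DGFunctor.obj F' y)) rfl)
        (fun y => Raw.push G (s.f.1 y)) rfl).ev (by have := s.h; omega) c).sum := by
      refine (Coh.ap_sum ..).trans <| congrArg _ <| List.map_congr_left fun s _ =>
        (Coh.ap_smul ..).trans (congrArg _ ?_)
      have : ∀ {u v : ℤ} (h₁ : n + s.e₁ + s.a = u) (h₂ : n + s.e₁ + s.a = v) (h₃ : e + u = t)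
          (h₄ : e + v = t), (Raw.cup (Raw.br s.init (Θ.1 (DGFunctor.obj F' y)) rfl)
            (fun y => Raw.push G (s.f.1 y)) h₁).ev h₃ c =
          (Raw.cup (Raw.br s.init (Θ.1 (DGFunctor.obj F' y)) rfl)
            (fun y => Raw.push G (s.f.1 y)) h₂).ev h₄ c := by
        intros; subst_vars; rfl
      exact this (by have := s.h; omega) rfl ht (by have := s.h; omega)
    rw [e₁, e₁, e₂]
    refine (Raw.ev_brBd P _ hs h' c).trans ?_
    rw [Chain.bdTerms, List.map_append, List.sum_append]
    rfl
  -- The left actions: for the empty chain `heads` is empty and the two agree; otherwise its only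
  -- entry is the product split off in `br_cons_lact`.
  have hl : (Raw.lact (braceHom Θ P h).1 hr).ev ht c +
      Coh.ap (P.heads.map fun s => sgn k (n * (s.a - 1)) •
        (Coh A C).comp (r := r) (by have := s.h; omega) (pushHom G' s.f)
          (braceHom Θ s.tail rfl)).sum c ht =
      (Raw.br P (Raw.lact Θ.1 hn : Raw G (DGFunctor.obj G' (DGFunctor.obj F' y)) _ _)
        (d' := r) (by omega)).ev (by omega) c := by
    cases P with
    | nil =>
      have e₁ := Raw.br_nil_lact (F := F) (G := G) Θ.1 hn (d' := r) (by omega) ht c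
      refine Eq.trans ?_ e₁.symm
      refine (congrArg (_ + ·) (Coh.ap_zero c ht)).trans ?_
      refine (add_zero _).trans ?_
      obtain rfl : q = n + 0 := h.symm
      subst hr
      rfl
    | cons Ψ P hq =>
      have e₁ := Raw.br_cons_lact (G := G) Ψ P Θ.1 hq hn (d' := r) (by omega) ht c
      refine Eq.trans ?_ e₁.symm
      subst h hr
      refine congrArg (_ + ·) ?_
      refine (Coh.ap_sum c ht [(⟨Ψ, P, hq⟩ : Chain.Head (Coh A B) ..)] _).trans ?_
      refine (add_zero _).trans ((Coh.ap_smul ..).trans (congrArg _ ?_))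
      have : ∀ {u v a e' : ℤ} {F₁ : (Coh A B).Obj} (Ψ : (Coh A B).Hom F₁ F' a)
          (P : Chain (Coh A B) F F₁ e')
          (h₁ : a + (n + e') = u) (h₂ : a + (n + e') = v) (h₃ : e + u = t) (h₄ : e + v = t),
          (Raw.cup (F := DGFunctor.comp G F) (G := DGFunctor.comp G' F₁)
            (Raw.push G' (Ψ.1 y))
            (fun y => Raw.br P (Θ.1 (DGFunctor.obj F₁ y)) rfl) h₁).ev h₃ c =
          (Raw.cup (F := DGFunctor.comp G F) (G := DGFunctor.comp G' F₁)
            (Raw.push G' (Ψ.1 y))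
            (fun y => Raw.br P (Θ.1 (DGFunctor.obj F₁ y)) rfl) h₂).ev h₄ c := by
        intros; subst_vars; rfl
      exact this Ψ P (by omega) (by omega) (by omega) (by omega)
  have he : Coh.ap (braceHom ((Coh B C).d hn Θ) P (q := r) (by omega)) c ht =
    (Raw.br P (Raw.diff (Θ.1 (DGFunctor.obj F' y)) hn) (d' := r) (by omega)).ev ht c
    + (Raw.br P (Raw.lact Θ.1 hn : Raw G (DGFunctor.obj G' (DGFunctor.obj F' y)) _ _)
        (d' := r) (by omega)).ev ht c := by
    exact (congrArg (fun χ => Raw.ev χ ht c) (Raw.br_add P (Raw.diff (Θ.1 _) hn)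
      (Raw.lact Θ.1 hn : Raw G (DGFunctor.obj G' (DGFunctor.obj F' y)) _ _)
      (by omega))).trans (Raw.ev_add ..)
  -- The final rearrangement, in an arbitrary module, so that the summands enter as variables.
  have key : ∀ {M : Type u} [AddCommGroup M] [Module k M] {D L T₁ T₂ T₃ T₄ T₅ T₆ : M} {s : k},
      D = T₁ - s • (T₃ + T₄ - T₅) → L + T₆ = T₂ →
      D + L = T₁ + T₂ - s • T₃ - s • T₄ + s • T₅ - T₆ := by
    rintro M _ _ D L T₁ T₂ T₃ T₄ T₅ T₆ s rfl rfl
    module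
  rw [Coh.ap_d, Coh.ap_sub, Coh.ap_add, Coh.ap_sub, Coh.ap_sub, Coh.ap_smul, Coh.ap_smul,
    Coh.ap_smul, he]
  have e₁ := Raw.diffFormula P (Θ.2 (DGFunctor.obj F' y)).1 h hr ht c
  rw [hd rfl (by omega)] at e₁
  refine key (e₁.trans (congrArg (· - _) ?_)) hl
  have : ∀ {s u v : ℤ} (h₁ : n + 1 = s) (h₂ : s + p = u) (h₃ : e + u = t) (h₄ : n + 1 + p = v)
      (h₅ : e + v = t),
      (Raw.br P (Raw.diff (Θ.1 (DGFunctor.obj F' y)) rfl) h₄).ev h₅ c =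
      (Raw.br P (Raw.diff (Θ.1 (DGFunctor.obj F' y)) h₁) h₂).ev h₃ c := by
    intros; subst_vars; rfl
  exact this hn _ ht rfl _
end

variable {k : Type u} [Field k]

namespace DGMaps
variable {C D : DGCat k} {obj : C.Obj → D.Obj} (m : DGMaps C D obj) {x y : C.Obj} {n : ℤ}

theorem map_zero : m.map (0 : C.Hom x y n) = 0 := _root_.map_zero m.map

theorem map_add (f g : C.Hom x y n) : m.map (f + g) = m.map f + m.map g := _root_.map_add ..

theorem map_smul (t : k) (f : C.Hom x y n) : m.map (t • f) = t • m.map f := _root_.map_smul ..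

end DGMaps

/-! ### The universal property of the twisted tensor product -/

namespace Twist

/-- The values of a dg functor out of the twisted tensor product on the generators: operations in
the dg category `E` which satisfy the relations of the twisted tensor product. -/
structure Generators (C D E : DGCat k) (obj : C.Obj × D.Obj → E.Obj) where
  eps : ∀ {x x' : C.Obj} {y y' : D.Obj} {a e n : ℤ}, C.Hom x x' a → Chain D y y' e → a + e = n →
    E.Hom (obj (x, y)) (obj (x', y')) n
  right : ∀ (x : C.Obj) {y y' : D.Obj} {n : ℤ}, D.Hom y y' n →
    E.Hom (obj (x, y)) (obj (x, y')) n
  right_lin : ∀ (x : C.Obj) {y y' : D.Obj} {n : ℤ} (t : k) (g g' : D.Hom y y' n),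
    right x (t • g + g') = t • right x g + right x g'
  right_id : ∀ (x : C.Obj) (y : D.Obj), right x (D.id y) = E.id (obj (x, y))
  right_comp : ∀ (x : C.Obj) {y y' y'' : D.Obj} {p q r : ℤ} (h : p + q = r) (g' : D.Hom y' y'' p)
    (g : D.Hom y y' q), right x (D.comp h g' g) = E.comp h (right x g') (right x g)
  right_d : ∀ (x : C.Obj) {y y' : D.Obj} {p q : ℤ} (h : p + 1 = q) (g : D.Hom y y' p),
    E.d h (right x g) = right x (D.d h g)
  eps_lin : ∀ {x x' : C.Obj} {y y' : D.Obj} {a e n : ℤ} (t : k) (f f' : C.Hom x x' a)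
    (c : Chain D y y' e) (h : a + e = n), eps (t • f + f') c h = t • eps f c h + eps f' c h
  eps_slotLin : ∀ {x x' : C.Obj} {y y' : D.Obj} {a e n : ℤ} (f : C.Hom x x' a) {t : k}
    {c₁ c₂ c₃ : Chain D y y' e}, Chain.SlotLin t c₁ c₂ c₃ → ∀ h : a + e = n,
    eps f c₃ h = t • eps f c₁ h + eps f c₂ h
  eps_id_nil : ∀ (x : C.Obj) (y : D.Obj) (h : 0 + 0 = (0 : ℤ)),
    eps (C.id x) (Chain.nil y) h = E.id (obj (x, y))
  eps_id_cons : ∀ (x : C.Obj) {y y' y'' : D.Obj} {b e e' n : ℤ} (g : D.Hom y' y'' b)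
    (c : Chain D y y' e) (h' : b - 1 + e = e') (h : 0 + e' = n),
    eps (C.id x) (Chain.cons g c h') h = 0
  eps_hasId : ∀ {x x' : C.Obj} {y y' : D.Obj} {a e n : ℤ} (f : C.Hom x x' a)
    {c : Chain D y y' e}, Chain.HasId c → ∀ h : a + e = n, eps f c h = 0
  eps_comp : ∀ {x x' x'' : C.Obj} {y y' : D.Obj} {a₂ a₁ a e n : ℤ} (f₂ : C.Hom x' x'' a₂)
    (f₁ : C.Hom x x' a₁) (c : Chain D y y' e) (ha : a₂ + a₁ = a) (h : a + e = n),
    eps (C.comp ha f₂ f₁) c h = (c.splits.map fun s => sgn k (a₁ * s.e₁) •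
      E.comp (by have := s.h; omega) (eps f₂ s.left rfl) (eps f₁ s.right rfl)).sum
  d_eps : ∀ {x x' : C.Obj} {y y' : D.Obj} {a a' e n n' : ℤ} (f : C.Hom x x' a)
    (c : Chain D y y' e) (h : a + e = n) (hn : n + 1 = n') (ha : a + 1 = a'),
    E.d hn (eps f c h) = eps (C.d ha f) c (by omega)
      - sgn k a • (c.dTerms.map fun t => t.1 • eps f t.2 (by omega)).sum
      - sgn k a • (c.mTerms.map fun t => t.1 • eps f t.2 (by omega)).sum
      + sgn k a • (c.lasts.map fun s => sgn k s.e₁ •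
          E.comp (by have := s.h; omega) (eps f s.init rfl) (right x s.f)).sum
      - (c.heads.map fun s => sgn k (a * (s.a - 1)) •
          E.comp (by have := s.h; omega) (right x' s.f) (eps f s.tail rfl)).sum

namespace Generators
variable {C D E : DGCat k} {obj : C.Obj × D.Obj → E.Obj} (V : Generators C D E obj)

/-- The value of an expression. -/
def interp : ∀ {X Y : C.Obj × D.Obj} {n : ℤ}, Pre C D X Y n → E.Hom (obj X) (obj Y) n
  | _, _, _, .eps f c h => V.eps f c h
  | _, _, _, .right x g => V.right x g
  | _, _, _, .id X => E.id (obj X)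
  | _, _, _, .comp h g f => E.comp h (interp g) (interp f)
  | _, _, _, .zero _ _ _ => 0
  | _, _, _, .add f g => interp f + interp g
  | _, _, _, .smul t f => t • interp f
  | _, _, _, .d h f => E.d h (interp f)

theorem interp_sum {X Y : C.Obj × D.Obj} {n : ℤ} {α : Type*} (l : List α)
    (f : α → Pre C D X Y n) :
    V.interp (Pre.sum (l.map f)) = (l.map fun t => V.interp (f t)).sum := by
  induction l with
  | nil => rfl
  | cons t l ih => exact congrArg (V.interp (f t) + ·) ih

/-- Each relation is an axiom of dg categories, true in `E`, or one of the conditions on the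
generators. This makes `interp` well defined on the quotient. -/
theorem interp_rel {X Y : C.Obj × D.Obj} {n : ℤ} {f g : Pre C D X Y n} (H : Pre.Rel f g) :
    V.interp f = V.interp g := by
  induction H with
  | refl => rfl
  | symm _ ih => exact ih.symm
  | trans _ _ ih ih' => exact ih.trans ih'
  | comp_congr h _ _ ih ih' => simp only [interp, ih, ih']
  | add_congr _ _ ih ih' => simp only [interp, ih, ih']
  | smul_congr t _ ih => simp only [interp, ih]
  | d_congr h _ ih => simp only [interp, ih]
  | add_assoc => exact _root_.add_assoc ..
  | add_comm => exact _root_.add_comm ..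
  | zero_add => exact _root_.zero_add ..
  | neg_add => simp [interp]
  | smul_add => exact _root_.smul_add ..
  | add_smul => exact _root_.add_smul ..
  | mul_smul => exact SemigroupAction.mul_smul ..
  | one_smul => exact _root_.one_smul ..
  | add_comp => simp [interp]
  | smul_comp => simp [interp]
  | comp_add => simp [interp]
  | comp_smul => simp [interp]
  | id_comp => exact E.id_comp _
  | comp_id => exact E.comp_id _
  | assoc => exact E.assoc ..
  | d_add => simp [interp]
  | d_smul => simp [interp]
  | d_d => exact E.d_d ..
  | leibniz => exact E.leibniz ..
  | right_lin => exact V.right_lin ..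
  | right_id => exact V.right_id ..
  | right_comp => exact V.right_comp ..
  | right_d => exact V.right_d ..
  | eps_lin => exact V.eps_lin ..
  | eps_slotLin _ S => exact V.eps_slotLin _ S _
  | eps_id_nil => exact V.eps_id_nil ..
  | eps_id_cons => exact V.eps_id_cons ..
  | eps_hasId _ S => exact V.eps_hasId _ S _
  | eps_comp f₂ f₁ c ha h =>
    simp only [interp_sum, interp]
    exact V.eps_comp f₂ f₁ c ha h
  | d_eps f c h hn ha =>
    -- The relation lists the five groups of terms with their signs as scalars, and its sum ends in
    -- a zero.
    refine (V.d_eps f c h hn ha).trans ?_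
    simp only [Pre.sum, interp, Pre.epsSum, interp_sum]
    module

/-- The dg functor on the twisted tensor product with given values on the generators. -/
def lift : DGMaps (Twist C D) E obj where
  map :=
    { toFun := Quot.lift V.interp fun _ _ H => V.interp_rel H
      map_add' := by rintro ⟨f⟩ ⟨g⟩; rfl
      map_smul' := by rintro t ⟨f⟩; rfl }
  map_id _ := rfl
  map_comp := by rintro X Y Z p q r h ⟨g⟩ ⟨f⟩; rfl
  map_d := by rintro X Y p q h ⟨f⟩; rfl

end Generators

/-- Every morphism is represented by an expression in the generators, and a dg functor respects all
operations occurring in expressions. -/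
theorem maps_ext {C D E : DGCat k} {obj : C.Obj × D.Obj → E.Obj}
    {m m' : DGMaps (Twist C D) E obj}
    (he : ∀ {x x' : C.Obj} {y y' : D.Obj} {a e n : ℤ} (f : C.Hom x x' a) (c : Chain D y y' e)
      (h : a + e = n), m.map (eps f c h) = m'.map (eps f c h))
    (hr : ∀ (x : C.Obj) {y y' : D.Obj} {n : ℤ} (g : D.Hom y y' n),
      m.map (right (C := C) x g) = m'.map (right (C := C) x g)) : m = m' := by
  have key : ∀ {X Y : C.Obj × D.Obj} {n : ℤ} (f : Pre C D X Y n),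
      m.map (x := X) (y := Y) (Quot.mk _ f) = m'.map (x := X) (y := Y) (Quot.mk _ f) := by
    intro X Y n f
    induction f with
    | eps f c h => exact he f c h
    | right x g => exact hr x g
    | id X => exact (m.map_id X).trans (m'.map_id X).symm
    | comp h g f ihg ihf =>
      exact (m.map_comp h (Quot.mk _ g) (Quot.mk _ f)).trans
        ((congrArg₂ (fun a b => E.comp h a b) ihg ihf).trans
          (m'.map_comp h (Quot.mk _ g) (Quot.mk _ f)).symm)
    | zero X Y n => exact m.map_zero.trans m'.map_zero.symm
    | add f g ihf ihg =>
      exact (m.map_add (Quot.mk _ f) (Quot.mk _ g)).trans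
        ((congrArg₂ (· + ·) ihf ihg).trans (m'.map_add (Quot.mk _ f) (Quot.mk _ g)).symm)
    | smul t f ih =>
      exact (m.map_smul t (Quot.mk _ f)).trans
        ((congrArg (t • ·) ih).trans (m'.map_smul t (Quot.mk _ f)).symm)
    | d h f ih =>
      exact (m.map_d h (Quot.mk _ f)).trans
        ((congrArg (E.d h) ih).trans (m'.map_d h (Quot.mk _ f)).symm)
  -- Apart from `map`, the fields of the structure are proofs; equality of the maps suffices.
  obtain ⟨φ, _, _, _⟩ := m
  obtain ⟨φ', _, _, _⟩ := m'
  obtain rfl : @φ = @φ' := by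
    funext X Y n
    refine LinearMap.ext ?_
    rintro ⟨f⟩
    exact key f
  rfl

end Twist

/-! ### The dg functor on the twisted tensor product: existence and uniqueness -/

namespace Coh
variable {C D : DGCat k} {F G H : (Coh C D).Obj} {x y : C.Obj} {e n p q r : ℤ}

theorem ap_comp_eq_sum (h : p + q = n) (ψ : (Coh C D).Hom G H p) (φ : (Coh C D).Hom F G q)
    (c : Chain C x y e) (hr : e + n = r) :
    ap ((Coh C D).comp h ψ φ) c hr = (c.splits.map fun s => sgn k (q * s.e₁) •
      D.comp (by have := s.h; omega) (ap ψ s.left rfl) (ap φ s.right rfl)).sum :=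
  Raw.ev_cup (ψ.1 y) φ.1 h hr c

theorem ap_d_eq_sum (h : p + 1 = q) (ψ : (Coh C D).Hom F G p) (c : Chain C x y e)
    (hr : e + q = r) :
    ap ((Coh C D).d h ψ) c hr = D.d (by omega) (ap ψ c rfl)
      + sgn k p • (c.dTerms.map fun t => t.1 • ap ψ t.2 (by omega)).sum
      + sgn k p • (c.mTerms.map fun t => t.1 • ap ψ t.2 (by omega)).sum
      - sgn k p • (c.lasts.map fun s => sgn k s.e₁ •
          D.comp (by have := s.h; omega) (ap ψ s.init rfl) (F.map s.f)).sum
      + (c.heads.map fun s => sgn k (p * (s.a - 1)) •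
          D.comp (by have := s.h; omega) (G.map s.f) (ap ψ s.tail rfl)).sum :=
  (ap_d h ψ c hr).trans
    (congrArg₂ (· + ·) (Raw.ev_diff (ψ.1 y) h hr c) (Raw.ev_lact ψ.1 h hr c))

end Coh

/-- The braces and the compositions with dg functors satisfy the relations of the twisted tensor
product. -/
def twistedCompositionGenerators (A B C : DGCat k) :
    Twist.Generators (Coh B C) (Coh A B) (Coh A C) fun X => compObj X.1 X.2 where
  eps Θ P h := braceHom Θ P h
  right G _ _ _ Ψ := pushHom G Ψ
  right_lin G _ _ _ t Ψ Ψ' :=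
    (map_add (Coh.push (C := A) G) (t • Ψ) Ψ').trans
      (congrArg (· + Coh.push G Ψ') (map_smul (Coh.push G) t Ψ))
  right_id G F := (post A G).toMaps.map_id F
  right_comp G _ _ _ _ _ _ h Ψ' Ψ := (post A G).toMaps.map_comp h Ψ' Ψ
  right_d G _ _ _ _ h Ψ := ((post A G).toMaps.map_d h Ψ).symm
  eps_lin := braceHom_lin
  eps_slotLin Θ _ _ _ _ S h := braceHom_slotLin Θ S h
  eps_id_nil := braceHom_id_nil
  eps_id_cons G _ _ _ _ _ _ _ Ψ P h' h := braceHom_id_cons G Ψ P h' h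
  eps_hasId Θ _ S h := braceHom_hasId Θ S h
  eps_comp := braceHom_comp
  d_eps Θ P h hn ha := d_braceHom Θ P h hn ha

/-- The dg functor `Coh(B, C) ⊗̃ Coh(A, B) ⟶ Coh(A, C)`. -/
def twistedComposition (A B C : DGCat k) : TwistMaps A B C :=
  (twistedCompositionGenerators A B C).lift

/-- The lift takes the prescribed values by construction; `left` is the case of the empty chain,
where the brace is precomposition with `F` (`brace_nil`). -/
theorem isTwistedComposition (A B C : DGCat k) :
    IsTwistedComposition (twistedComposition A B C) where
  left {G G'} n Θ F x y e r c h := by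
    have e₁ := ap_braceHom_eq_brace (G := G) (G' := G') Θ (Chain.nil (C := Coh A B) F) (add_zero n) c h
    exact e₁.trans (brace_nil Θ c (by omega))
  right G _ _ _ Ψ _ _ _ _ c h := Raw.ev_push G (Ψ.1 _) h c
  eps Θ P hq _ _ _ _ c h := ap_braceHom_eq_brace Θ P hq c h

theorem IsTwistedComposition.eq {A B C : DGCat k} {m m' : TwistMaps A B C}
    (hm : IsTwistedComposition m) (hm' : IsTwistedComposition m') : m = m' :=
  Twist.maps_ext
    (fun Θ P h => Coh.hom_ext fun c hr => (hm.eps Θ P h c hr).trans (hm'.eps Θ P h c hr).symm)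
    (fun G _ _ _ Ψ => Coh.hom_ext fun c hr => (hm.right G Ψ c hr).trans (hm'.right G Ψ c hr).symm)

/-! ### The categorified Tsygan map -/

section
variable {A B C : DGCat k} {F F' : (Coh A B).Obj} {G G' : (Coh B C).Obj} {n p q r : ℤ}

/-- Composition with the dg functor `G`, as an object of `Coh(Coh(A, B), Coh(A, C))`. -/
def postObj (A : DGCat k) (G : (Coh B C).Obj) : (Coh (Coh A B) (Coh A C)).Obj := post A G

/-- The cochain `(Ψ_k, …, Ψ₁) ↦ Θ{Ψ_k, …, Ψ₁}` on `Coh(A, B)`. -/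
def tsyganHom (A : DGCat k) (Θ : (Coh B C).Hom G G' n) :
    (Coh (Coh A B) (Coh A C)).Hom (postObj A G) (postObj A G') n :=
  ⟨fun _ _ _ P => braceHom Θ P (add_comm _ _), fun F' =>
    ⟨by
      intro F e r h t c₁ c₂ c₃ S
      subst h
      exact braceHom_slotLin Θ S _, by
      intro F e r h c S
      subst h
      exact braceHom_hasId Θ S _⟩⟩

theorem ap_tsyganHom (Θ : (Coh B C).Hom G G' n) (P : Chain (Coh A B) F F' p) (h : p + n = q) :
    Coh.ap (tsyganHom A Θ) P h = braceHom Θ P (by omega) := by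
  subst h; rfl

theorem braceHom_add (Θ Θ' : (Coh B C).Hom G G' n) (P : Chain (Coh A B) F F' p)
    (h : n + p = q) : braceHom (Θ + Θ') P h = braceHom Θ P h + braceHom Θ' P h := by
  simpa only [one_smul] using braceHom_lin 1 Θ Θ' P h

theorem braceHom_smul (t : k) (Θ : (Coh B C).Hom G G' n) (P : Chain (Coh A B) F F' p)
    (h : n + p = q) : braceHom (t • Θ) P h = t • braceHom Θ P h := by
  -- Additivity at `0 + 0` forces the brace of the zero cochain to vanish.
  have h₀ := braceHom_add 0 0 P h (G := G) (G' := G')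
  rw [add_zero, left_eq_add] at h₀
  simpa only [add_zero, h₀] using braceHom_lin t Θ 0 P h

theorem comp_braceHom_congr {F'' : (Coh A B).Obj} {G'' : (Coh B C).Obj} {n' p' a b a' b' : ℤ}
    (Θ' : (Coh B C).Hom G' G'' n') (Θ : (Coh B C).Hom G G' n) (P' : Chain (Coh A B) F' F'' p')
    (P : Chain (Coh A B) F F' p) (ha : n' + p' = a) (hb : n + p = b) (ha' : n' + p' = a')
    (hb' : n + p = b') (h : a + b = r) (h' : a' + b' = r) :
    (Coh A C).comp h (braceHom Θ' P' ha) (braceHom Θ P hb) =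
      (Coh A C).comp h' (braceHom Θ' P' ha') (braceHom Θ P hb') := by
  subst ha ha' hb hb'; rfl

theorem comp_braceHom_push_congr {F'' : (Coh A B).Obj} {m a a' : ℤ} (Θ : (Coh B C).Hom G G' n)
    (P : Chain (Coh A B) F' F'' p) (Ψ : (Coh A B).Hom F F' m) (ha : n + p = a)
    (ha' : n + p = a') (h : a + m = r) (h' : a' + m = r) :
    (Coh A C).comp h (braceHom Θ P ha) (pushHom G Ψ) =
      (Coh A C).comp h' (braceHom Θ P ha') (pushHom G Ψ) := by
  subst ha ha'; rfl

theorem comp_push_braceHom_congr {F'' : (Coh A B).Obj} {m a a' : ℤ} (Θ : (Coh B C).Hom G G' n)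
    (P : Chain (Coh A B) F F' p) (Ψ : (Coh A B).Hom F' F'' m) (ha : n + p = a)
    (ha' : n + p = a') (h : m + a = r) (h' : m + a' = r) :
    (Coh A C).comp h (pushHom G' Ψ) (braceHom Θ P ha) =
      (Coh A C).comp h' (pushHom G' Ψ) (braceHom Θ P ha') := by
  subst ha ha'; rfl

/-- The dg functor `Coh(B, C) ⟶ Coh(Coh(A, B), Coh(A, C))`. -/
def tsyganMaps (A B C : DGCat k) :
    DGMaps (Coh B C) (Coh (Coh A B) (Coh A C)) (postObj A) where
  map {G G' n} :=
    { toFun := fun Θ => tsyganHom A Θ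
      map_add' := fun Θ Θ' => Coh.hom_ext fun P h =>
        (ap_tsyganHom ..).trans <| (braceHom_add Θ Θ' P _).trans <|
          (congrArg₂ (· + ·) (ap_tsyganHom Θ P h) (ap_tsyganHom Θ' P h)).symm.trans
            (Coh.ap_add P h (tsyganHom A Θ) (tsyganHom A Θ')).symm
      map_smul' := fun t Θ => Coh.hom_ext fun P h =>
        (ap_tsyganHom ..).trans <| (braceHom_smul t Θ P _).trans <|
          (congrArg (t • ·) (ap_tsyganHom Θ P h)).symm.trans
            (Coh.ap_smul P h (tsyganHom A Θ) t).symm }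
  map_id G := Coh.hom_ext fun {F F' e r} P h => by
    refine (ap_tsyganHom ..).trans ?_
    cases P with
    | nil =>
      obtain rfl : r = 0 := by omega
      exact braceHom_id_nil G F _
    | cons Ψ P hq =>
      exact (braceHom_id_cons G Ψ P hq (by omega)).trans
        (Raw.ev_one_cons (F := post A G) Ψ P hq h).symm
  map_comp h Θ₂ Θ₁ := Coh.hom_ext fun P hr => by
    refine (ap_tsyganHom ..).trans <| (braceHom_comp Θ₂ Θ₁ P h _).trans <| Eq.trans ?_
      (Coh.ap_comp_eq_sum h (tsyganHom A Θ₂) (tsyganHom A Θ₁) P hr).symm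
    exact congrArg _ (List.map_congr_left fun s _ => congrArg _
      (comp_braceHom_congr Θ₂ Θ₁ s.left s.right ..))
  map_d {G G' p q} h Θ := Coh.hom_ext fun {F F' e r} P hr => by
    -- Solving the formula for the differential of a brace for the term with `dΘ` turns its signs
    -- into those of the differential of cochains on `Coh(A, B)`.
    have key : ∀ {M : Type u} [AddCommGroup M] [Module k M] {D B T₁ T₂ L H T₁' T₂' L' H' : M}
        {s : k}, D = B - s • T₁ - s • T₂ + s • L - H → T₁' = T₁ → T₂' = T₂ → L' = L → H' = H →
        B = D + s • T₁' + s • T₂' - s • L' + H' := by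
      rintro M _ _ D B T₁ T₂ L H _ _ _ _ s rfl rfl rfl rfl rfl
      module
    refine (ap_tsyganHom ..).trans (Eq.trans ?_ (Coh.ap_d_eq_sum h (tsyganHom A Θ) P hr).symm)
    have hd := d_braceHom Θ P (add_comm p e) (r := r) (by omega) h
    have h₁ : ∀ l : List (k × Chain (Coh A B) F F' (e + 1)),
        (l.map fun t => t.1 • Coh.ap (tsyganHom A Θ) t.2 (r := r) (by omega)).sum =
          (l.map fun t => t.1 • braceHom Θ t.2 (q := r) (by omega)).sum := fun l =>
      congrArg _ (List.map_congr_left fun t _ => congrArg _ (ap_tsyganHom Θ t.2 _))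
    have h₂ : ∀ s ∈ P.lasts, sgn k s.e₁ • (Coh A C).comp (r := r) (by have := s.h; omega)
          (Coh.ap (tsyganHom A Θ) s.init rfl) ((post A G).map s.f) =
        sgn k s.e₁ • (Coh A C).comp (by have := s.h; omega) (braceHom Θ s.init rfl)
          (pushHom G s.f) :=
      fun s _ => congrArg _ (comp_braceHom_push_congr Θ s.init s.f ..)
    have h₃ : ∀ s ∈ P.heads, sgn k (p * (s.a - 1)) • (Coh A C).comp (r := r)
          (by have := s.h; omega) ((post A G').map s.f) (Coh.ap (tsyganHom A Θ) s.tail rfl) =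
        sgn k (p * (s.a - 1)) • (Coh A C).comp (by have := s.h; omega) (pushHom G' s.f)
          (braceHom Θ s.tail rfl) :=
      fun s _ => congrArg _ (comp_push_braceHom_congr Θ s.tail s.f ..)
    refine key hd (h₁ _) (h₁ _) (congrArg _ (List.map_congr_left h₂))
      (congrArg _ (List.map_congr_left h₃))

end
end DG

theorem mainTheorem5 {k : Type u} [Field k] (A B C : DG.DGCat k) :
    ∃ m : DG.DGMaps (DG.Twist (DG.Coh B C) (DG.Coh A B)) (DG.Coh A C)
        (fun X => DG.compObj X.1 X.2),
      -- the values on the generators, which determine `m`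
      DG.IsTwistedComposition m ∧
      (∀ m' : DG.TwistMaps A B C, DG.IsTwistedComposition m' → m' = m) ∧
      -- compatibility with the differential
      (∀ {G G' : (DG.Coh B C).Obj} {F F' : (DG.Coh A B).Obj} {n n' p q r : ℤ}
        (Θ : (DG.Coh B C).Hom G G' n) (P : DG.Chain (DG.Coh A B) F F' p)
        (hq : n + p = q) (hr : q + 1 = r) (hn : n + 1 = n'),
        (DG.Coh A C).d hr (DG.TwistMaps.eps m Θ P hq) =
          m.map ((DG.Twist (DG.Coh B C) (DG.Coh A B)).d hr (DG.Twist.eps Θ P hq)) ∧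
        (DG.Coh A C).d hr (DG.TwistMaps.eps m Θ P hq) =
          DG.TwistMaps.eps m ((DG.Coh B C).d hn Θ) P (by omega)
          - DG.sgn k n • (P.dTerms.map fun t =>
              t.1 • DG.TwistMaps.eps m Θ t.2 (by omega)).sum
          - DG.sgn k n • (P.mTerms.map fun t =>
              t.1 • DG.TwistMaps.eps m Θ t.2 (by omega)).sum
          + DG.sgn k n • (P.lasts.map fun s => DG.sgn k s.e₁ •
              (DG.Coh A C).comp (by have := s.h; omega) (DG.TwistMaps.eps m Θ s.init rfl)
                (DG.TwistMaps.right m G s.f)).sum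
          - (P.heads.map fun s => DG.sgn k (n * (s.a - 1)) •
              (DG.Coh A C).comp (by have := s.h; omega) (DG.TwistMaps.right m G' s.f)
                (DG.TwistMaps.eps m Θ s.tail rfl)).sum) ∧
      -- compatibility with the cup product
      (∀ {G₀ G₁ G₂ : (DG.Coh B C).Obj} {F F' : (DG.Coh A B).Obj} {n₂ n₁ n p q : ℤ}
        (Θ₂ : (DG.Coh B C).Hom G₁ G₂ n₂) (Θ₁ : (DG.Coh B C).Hom G₀ G₁ n₁)
        (P : DG.Chain (DG.Coh A B) F F' p) (hn : n₂ + n₁ = n) (hq : n + p = q),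
        (P.splits.map fun s => DG.sgn k (n₁ * s.e₁) •
          (DG.Coh A C).comp (by have := s.h; omega) (DG.TwistMaps.eps m Θ₂ s.left rfl)
            (DG.TwistMaps.eps m Θ₁ s.right rfl)).sum =
          DG.TwistMaps.eps m ((DG.Coh B C).comp hn Θ₂ Θ₁) P hq) ∧
      -- the associated dg functor `Coh(B, C) ⟶ Coh(Coh(A, B), Coh(A, C))`
      (∃ T : DG.DGMaps (DG.Coh B C) (DG.Coh (DG.Coh A B) (DG.Coh A C)) (fun G => DG.post A G),
        ∀ {G G' : (DG.Coh B C).Obj} {F F' : (DG.Coh A B).Obj} {n p q : ℤ}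
          (Θ : (DG.Coh B C).Hom G G' n) (P : DG.Chain (DG.Coh A B) F F' p) (hq : n + p = q)
          (hq' : p + n = q), DG.Coh.ap (T.map Θ) P hq' = DG.TwistMaps.eps m Θ P hq) := by
  -- On generators the lift unfolds to `braceHom` and `pushHom`, so the identities for braces are
  -- literally the required formulas.
  refine ⟨DG.twistedComposition A B C, DG.isTwistedComposition A B C,
    fun m' hm' => hm'.eq (DG.isTwistedComposition A B C), fun {G G' F F' n n' p q r} Θ P hq hr hn =>
      ⟨((DG.twistedComposition A B C).map_d hr (DG.Twist.eps Θ P hq)).symm,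
        DG.d_braceHom Θ P hq hr hn⟩,
    fun Θ₂ Θ₁ P hn hq => (DG.braceHom_comp Θ₂ Θ₁ P hn hq).symm,
    DG.tsyganMaps A B C, fun Θ P hq hq' => DG.ap_tsyganHom Θ P hq'⟩
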